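/- Let $R$ be a commutative ring in which $2$ is invertible, and let $\mathcal C$ be an $R$-linear symmetric monoidal category which has all small colimits, with $\otimes$ preserving them in each variable. Let $(\pi,\xi)$ be a parity structure on $\mathcal C$: an object $\pi$ with symmetry $\sigma_{\pi,\pi}=-\mathrm{id}_{\pi\otimes\pi}$ and an isomorphism $\xi:\pi\otimes\pi\cong 1$. An odd map $x\to y$ is a morphism $\pi\otimes x\to y$ in $\mathcal C$; the composite of two odd maps $f:x\to y$, $g:y\to z$ is the morphism $x\cong\pi\otimes\pi\otimes x\xrightarrow{\mathrm{id}\otimes f}\pi\otimes y\xrightarrow{g}z$, using $\xi^{-1}$, and tensor products of odd maps with identities are formed by moving $\pi$ to its place with $\sigma$. For a commutative monoid $a$ with multiplication $\mu$ and unit $u$, and an odd map $f:a^{\otimes m}\to a$ ($m\ge 1$), let $T(f):a^{\otimes(m+1)}\to a$ be the odd map $$T(f)(x\otimes y_1\otimes\cdots\otimes y_m)=f(y_1\otimes\cdots\otimes y_{m-1}\otimes x\,y_m)-x\cdot f(y_1\otimes\cdots\otimes y_m),$$ all strands (including $\pi$) being permuted with $\sigma$. An odd map $\Delta:a\to a$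 is a differential operator of order $\le k$ if $T^{k+1}(\Delta)=0$. It is a BV operator, and $(a,\Delta)$ is a BV algebra in $\mathcal C$, if it has order $\le2$, $\Delta\circ\Delta=0$ and $\Delta\circ u=0$. Let $Q=[s,t:Q_1\to Q_0]$ be a finite quiver with double $\overline Q$ (each $a\in Q_1$ gets a reversed arrow $\overline a$, and $\overline{\overline a}=a$). Put $\langle a,\overline a\rangle=1$ and $\langle\overline a,a\rangle=-1$ for $a\in Q_1$, and $\langle a,b\rangle=0$ for all other pairs of arrows of $\overline Q$. For each vertex $i$ let $c_i\in\mathcal C$ be dualisable, with $\mathrm{ev}_i:c_i^\vee\otimes c_i\to1$ and $\mathrm{coev}_i:1\to c_i\otimes c_i^\vee$, and let $\iota_i:\pi\otimes c_i\to c_i$ be an odd map with $\iota_i\circ\iota_i=\mathrm{id}$. Let $\iota_i^\vee:\pi\otimes c_i^\vee\to c_i^\vee$ be the dual odd map, obtained by inserting $\mathrm{coev}_i$, moving $\pi$ past $c_i^\vee$ with $\sigma$, applying $\iota_i$ and then $\mathrm{ev}_i$. For an arrow $a$ of $\overline Q$ put $h_a^\vee=c_{s(a)}\otimes c_{t(a)}^\vee$,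 and let $\widetilde h_a^\vee$ be the coequaliser of $\iota_{s(a)}\otimes\mathrm{id}$ and $\mathrm{id}\otimes\iota_{t(a)}^\vee:\pi\otimes h_a^\vee\to h_a^\vee$. Let $\widetilde h^\vee=\bigoplus_a\widetilde h_a^\vee$ over all arrows of $\overline Q$, and let $S\widetilde h^\vee$ be the free commutative monoid on $\widetilde h^\vee$ in $\mathcal C$ (which exists). Define odd maps $\phi^\pm_{ab}:h_a^\vee\otimes h_b^\vee\to S\widetilde h^\vee$ as follows. If $b\ne\overline a$, then $\phi^\pm_{ab}=0$. If $b=\overline a$, write $i=s(a)=t(b)$ and $j=t(a)=s(b)$, so that $h_a^\vee\otimes h_b^\vee=c_i\otimes c_j^\vee\otimes c_j\otimes c_i^\vee$. * $\phi^-_{ab}$ is $\langle a,b\rangle$ times the following odd map: evaluate $c_j^\vee\otimes c_j\to1$ (inner cap) and $c_i\otimes c_i^\vee\to1$ (outer cap), joined by an odd chord, i.e. take the difference "insert $\iota_i$ on the strand $c_i$" minus "insert $\iota_j$ on the strand $c_j$" before evaluating; then apply the unit $1\to S\widetilde h^\vee$. * $\phi^+_{ab}$ is $\langle a,b\rangle$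 times the following odd map: insert the two cups $\mathrm{coev}_i:1\to c_i\otimes c_i^\vee$ and $\mathrm{coev}_j:1\to c_j\otimes c_j^\vee$, joined by an odd chord, i.e. take the difference "$\iota_j$ on the strand $c_j$ of the $j$-cup" minus "$\iota_i$ on the strand $c_i$ of the $i$-cup"; use $\sigma$ to form the four pairs ($c_i$ of the $i$-cup, incoming $c_j^\vee$), (incoming $c_i$, $c_j^\vee$ of the $j$-cup), ($c_j$ of the $j$-cup, incoming $c_i^\vee$), (incoming $c_j$, $c_i^\vee$ of the $i$-cup), which are two copies of $h_a^\vee$ and two copies of $h_b^\vee$; then map each copy to $S\widetilde h^\vee$ and multiply. Then for each sign there is a unique odd differential operator $\widetilde\Delta^\pm$ of order $\le 2$ on $S\widetilde h^\vee$ which vanishes on $S^0\widetilde h^\vee$ and $S^1\widetilde h^\vee$ and whose restriction along $h_a^\vee\otimes h_b^\vee\to S^2\widetilde h^\vee\to S\widetilde h^\vee$ is $\phi^\pm_{ab}$ for all arrows $a,b$ of $\overline Q$. Moreover $\widetilde\Delta^\pm\circ\widetilde\Delta^\pm=0$ and $\widetilde\Delta^\pm\circ u=0$, where $u$ is the unit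 of $S\widetilde h^\vee$. That is, $(S\widetilde h^\vee,\widetilde\Delta^+)$ and $(S\widetilde h^\vee,\widetilde\Delta^-)$ are BV algebras in $\mathcal C$. -/

import Mathlib

open CategoryTheory MonoidalCategory Limits
open scoped MonObj

noncomputable section

namespace NecklaceBV

universe v u w w'

section Parity

variable (C : Type u) [Category.{v} C] [MonoidalCategory C] [SymmetricCategory C] [Preadditive C]

/-- A parity structure on a linear symmetric monoidal category: an object `π` whose
self-symmetry is `-id`, together with an isomorphism `ξ : π ⊗ π ≅ 𝟙`. -/
structure ParityStructure where
  /-- the odd unit `π` -/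
  pi : C
  /-- the isomorphism `ξ` -/
  xi : pi ⊗ pi ≅ 𝟙_ C
  braiding_pi : (β_ pi pi).hom = -𝟙 (pi ⊗ pi)

variable {C}
variable (P : ParityStructure C)

/-- Odd maps `x → y` are the maps `π ⊗ x ⟶ y`. -/
abbrev OddHom (x y : C) : Type v := P.pi ⊗ x ⟶ y

/-- The composite "`g` after `f`" of two odd maps. It is the even map
`x ≅ π ⊗ (π ⊗ x) ⟶ π ⊗ y ⟶ z`, where the first isomorphism uses `ξ⁻¹`. -/
def oddComp {x y z : C} (f : OddHom P x y) (g : OddHom P y z) : x ⟶ z :=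
  (λ_ x).inv ≫ P.xi.inv ▷ x ≫ (α_ P.pi P.pi x).hom ≫ P.pi ◁ f ≫ g

/-- The odd map `f ⊗ id_y`. -/
def oddWhiskerRight {x x' : C} (f : OddHom P x x') (y : C) : OddHom P (x ⊗ y) (x' ⊗ y) :=
  (α_ P.pi x y).inv ≫ f ▷ y

/-- The odd map `id_x ⊗ g`: the strand `π` is moved past `x` with the symmetry. -/
def oddWhiskerLeft (x : C) {y y' : C} (g : OddHom P y y') : OddHom P (x ⊗ y) (x ⊗ y') :=
  (α_ P.pi x y).inv ≫ (β_ P.pi x).hom ▷ y ≫ (α_ x P.pi y).hom ≫ x ◁ g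

/-- The dual `f^∨ : π ⊗ c^∨ ⟶ c^∨` of an odd endomorphism `f` of `c`, where `π` is kept fixed:
`π ⊗ c^∨ ≅ c^∨ ⊗ π`, then insert `coev : 𝟙 ⟶ c ⊗ c^∨`, apply `f` and evaluate. -/
def oddDual (c : C) [HasRightDual c] (f : OddHom P c c) : OddHom P cᘁ cᘁ :=
  (β_ P.pi cᘁ).hom ≫ (ρ_ (cᘁ ⊗ P.pi)).inv ≫ (cᘁ ⊗ P.pi) ◁ η_ c cᘁ ≫
    (α_ cᘁ P.pi (c ⊗ cᘁ)).hom ≫ cᘁ ◁ (α_ P.pi c cᘁ).inv ≫ cᘁ ◁ (f ▷ cᘁ) ≫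
      (α_ cᘁ c cᘁ).inv ≫ ε_ c cᘁ ▷ cᘁ ≫ (λ_ cᘁ).hom

end Parity

section DiffOp

variable {C : Type u} [Category.{v} C] [MonoidalCategory C] [SymmetricCategory C]

/-- `tensorPow a m` is `a^{⊗(m+1)}`. -/
def tensorPow (a : C) : ℕ → C
  | 0 => a
  | m + 1 => a ⊗ tensorPow a m

/-- The map `a ⊗ a^{⊗(m+1)} ⟶ a^{⊗(m+1)}` multiplying the new factor into the last one:
`x ⊗ y₀ ⊗ ⋯ ⊗ yₘ ↦ ± y₀ ⊗ ⋯ ⊗ (x yₘ)`. -/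
def mulLast (a : C) [MonObj a] : (m : ℕ) → (a ⊗ tensorPow a m ⟶ tensorPow a m)
  | 0 => μ[a]
  | m + 1 => (α_ a a (tensorPow a m)).inv ≫ (β_ a a).hom ▷ tensorPow a m ≫
      (α_ a a (tensorPow a m)).hom ≫ a ◁ mulLast a m

variable [Preadditive C] (P : ParityStructure C)

/-- The operator `T` on odd maps `f : a^{⊗(m+1)} → a`:
`T f (x, y) = ± f (x · y) - ± x · f (y)`. -/
def oddT (a : C) [MonObj a] (m : ℕ) (f : OddHom P (tensorPow a m) a) :
    OddHom P (tensorPow a (m + 1)) a :=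
  P.pi ◁ mulLast a m ≫ f - oddWhiskerLeft P a f ≫ μ[a]

/-- The iterate `T^k Δ` for an odd endomorphism `Δ` of `a`. -/
def oddTIter (a : C) [MonObj a] (Δ : OddHom P a a) : (k : ℕ) → OddHom P (tensorPow a k) a
  | 0 => Δ
  | k + 1 => oddT P a k (oddTIter a Δ k)

/-- `Δ` is an odd differential operator of order (at most) `k` on `a`: `T^{k+1} Δ = 0`. -/
def IsOddDiffOp (a : C) [MonObj a] (k : ℕ) (Δ : OddHom P a a) : Prop :=
  oddTIter P a Δ (k + 1) = 0

/-- `Δ` is a Batalin-Vilkovisky operator on the commutative monoid `a`, i.e. `(a, Δ)` is a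
BV algebra: an odd differential operator of order 2, of square zero, that kills the unit. -/
structure IsBVOperator (a : C) [MonObj a] [IsCommMonObj a] (Δ : OddHom P a a) : Prop where
  order_two : IsOddDiffOp P a 2 Δ
  sq_zero : oddComp P Δ Δ = 0
  unit_zero : P.pi ◁ η[a] ≫ Δ = 0

end DiffOp

section Free

variable {C : Type u} [Category.{v} C] [MonoidalCategory C] [SymmetricCategory C]

/-- A free commutative monoid `Sx` on `x`: a commutative monoid with a map `x ⟶ Sx` that is
initial among all maps from `x` to a commutative monoid. -/
structure FreeCommMon (x : C) where
  /-- the object `Sx` -/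
  obj : C
  [mon : MonObj obj]
  [comm : IsCommMonObj obj]
  /-- the structural map `x ⟶ Sx` -/
  incl : x ⟶ obj
  existsUnique_lift : ∀ (b : C) [MonObj b] [IsCommMonObj b] (f : x ⟶ b),
    ∃! g : obj ⟶ b, IsMonHom g ∧ incl ≫ g = f

attribute [instance] FreeCommMon.mon
attribute [instance] FreeCommMon.comm

end Free

section Quiver

/- A quiver has vertices `V`, arrows `E`, source `s` and target `t`. The arrows of its double are
`E ⊕ E`: `inl e` is the original arrow `e` and `inr e` is its double, running backwards. -/
variable {V : Type w} {E : Type w'} (s t : E → V)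

/-- Source in the double quiver. -/
def src : E ⊕ E → V
  | .inl e => s e
  | .inr e => t e

/-- Target in the double quiver. -/
def tgt : E ⊕ E → V
  | .inl e => t e
  | .inr e => s e

/-- The involution `a ↦ ā` of the arrows of the double quiver. -/
def bar : E ⊕ E → E ⊕ E
  | .inl e => .inr e
  | .inr e => .inl e

theorem src_bar (a : E ⊕ E) : src s t (bar a) = tgt s t a := by cases a <;> rfl

theorem tgt_bar (a : E ⊕ E) : tgt s t (bar a) = src s t a := by cases a <;> rfl

open scoped Classical in
/-- The antisymmetric pairing: `⟨a, ā⟩ = 1` and `⟨ā, a⟩ = -1` for `a` an original arrow, and `0`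
for all other pairs. -/
def pairing : E ⊕ E → E ⊕ E → ℤ
  | .inl e, .inr f => if e = f then 1 else 0
  | .inr e, .inl f => if e = f then -1 else 0
  | _, _ => 0

end Quiver

section Rep

variable {C : Type u} [Category.{v} C] [MonoidalCategory C] [SymmetricCategory C]
  [Preadditive C] [HasColimits C] (P : ParityStructure C)
  {V : Type w} {E : Type w'} [Finite E] (s t : E → V)
  (c : V → C) [∀ i, HasRightDual (c i)] (J : ∀ i, OddHom P (c i) (c i))

/-- `h_a^∨ = c_{s(a)} ⊗ c_{t(a)}^∨`. -/
abbrev hDual (a : E ⊕ E) : C := c (src s t a) ⊗ (c (tgt s t a))ᘁ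

/-- `h̃_a^∨`, the coequaliser of `J_{s(a)} ⊗ id` and `id ⊗ J_{t(a)}^∨`. -/
def hTildeDualAt (a : E ⊕ E) : C :=
  coequalizer
    (oddWhiskerRight P (J (src s t a)) (c (tgt s t a))ᘁ)
    (oddWhiskerLeft P (c (src s t a)) (oddDual P (c (tgt s t a)) (J (tgt s t a))))

/-- `h̃^∨ = ⨁_a h̃_a^∨`, over all arrows of the double quiver. -/
def hTildeDual : C :=
  haveI : HasFiniteCoproducts C := ⟨fun _ => inferInstance⟩
  ∐ fun a : E ⊕ E => hTildeDualAt P s t c J a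

/-- The canonical map `h_a^∨ ⟶ h̃_a^∨ ⟶ h̃^∨`. -/
def toTilde (a : E ⊕ E) : hDual s t c a ⟶ hTildeDual P s t c J :=
  haveI : HasFiniteCoproducts C := ⟨fun _ => inferInstance⟩
  coequalizer.π _ _ ≫ Sigma.ι (fun a : E ⊕ E => hTildeDualAt P s t c J a) a

/-- The evaluation `(c_i ⊗ c_j^∨) ⊗ (c_j ⊗ c_i^∨) ⟶ 𝟙`: an inner cap joining the two strands
coloured `j` and an outer cap joining the two strands coloured `i`. -/
def evPair (i j : V) : (c i ⊗ (c j)ᘁ) ⊗ (c j ⊗ (c i)ᘁ) ⟶ 𝟙_ C :=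
  (α_ (c i) (c j)ᘁ (c j ⊗ (c i)ᘁ)).hom ≫ c i ◁ (α_ (c j)ᘁ (c j) (c i)ᘁ).inv ≫
    c i ◁ (ε_ (c j) (c j)ᘁ ▷ (c i)ᘁ) ≫ c i ◁ (λ_ (c i)ᘁ).hom ≫
      (β_ (c i) (c i)ᘁ).hom ≫ ε_ (c i) (c i)ᘁ

/-- The evaluation with an odd chord from the inner cap to the outer cap: `J_i` inserted on the
outer cap minus `J_j` inserted on the inner cap. -/
def evChord (i j : V) : OddHom P ((c i ⊗ (c j)ᘁ) ⊗ (c j ⊗ (c i)ᘁ)) (𝟙_ C) :=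
  (oddWhiskerRight P (oddWhiskerRight P (J i) (c j)ᘁ) (c j ⊗ (c i)ᘁ) -
    oddWhiskerLeft P (c i ⊗ (c j)ᘁ) (oddWhiskerRight P (J j) (c i)ᘁ)) ≫ evPair c i j

/-- The coevaluation of `c_i` with `J_i` inserted. -/
def oddCoev (i : V) : P.pi ⟶ c i ⊗ (c i)ᘁ :=
  (ρ_ P.pi).inv ≫ P.pi ◁ η_ (c i) (c i)ᘁ ≫ oddWhiskerRight P (J i) (c i)ᘁ

/-- Two cups coloured `i` and `j` with an odd chord from the `i`-cup to the `j`-cup: `J_j`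
inserted on the `j`-cup minus `J_i` inserted on the `i`-cup. -/
def coevChord (i j : V) : P.pi ⟶ (c i ⊗ (c i)ᘁ) ⊗ (c j ⊗ (c j)ᘁ) :=
  (λ_ P.pi).inv ≫ (η_ (c i) (c i)ᘁ ⊗ₘ oddCoev P c J j) -
    (ρ_ P.pi).inv ≫ (oddCoev P c J i ⊗ₘ η_ (c j) (c j)ᘁ)

/-- The rearrangement of the four cup strands `p₁, …, p₄` and the four incoming strands
`q₁, …, q₄` into four pairs:
`(p₁ p₂)(p₃ p₄) ⊗ (q₁ q₂)(q₃ q₄) ⟶ ((p₁ q₂)(q₃ p₂)) ⊗ ((p₃ q₄)(q₁ p₄))`. -/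
def shuffle (p₁ p₂ p₃ p₄ q₁ q₂ q₃ q₄ : C) :
    ((p₁ ⊗ p₂) ⊗ (p₃ ⊗ p₄)) ⊗ ((q₁ ⊗ q₂) ⊗ (q₃ ⊗ q₄)) ⟶
      ((p₁ ⊗ q₂) ⊗ (q₃ ⊗ p₂)) ⊗ ((p₃ ⊗ q₄) ⊗ (q₁ ⊗ p₄)) :=
  ((p₁ ⊗ p₂) ⊗ (p₃ ⊗ p₄)) ◁
      ((α_ q₁ q₂ (q₃ ⊗ q₄)).hom ≫ (β_ q₁ (q₂ ⊗ (q₃ ⊗ q₄))).hom ≫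
        (α_ q₂ (q₃ ⊗ q₄) q₁).hom ≫ q₂ ◁ (α_ q₃ q₄ q₁).hom ≫ (α_ q₂ q₃ (q₄ ⊗ q₁)).inv) ≫
    tensorμ (p₁ ⊗ p₂) (p₃ ⊗ p₄) (q₂ ⊗ q₃) (q₄ ⊗ q₁) ≫
      (tensorμ p₁ p₂ q₂ q₃ ⊗ₘ tensorμ p₃ p₄ q₄ q₁) ≫
        (((p₁ ⊗ q₂) ◁ (β_ p₂ q₃).hom) ⊗ₘ ((p₃ ⊗ q₄) ◁ (β_ p₄ q₁).hom))

/-- The quartic odd map `(c_i ⊗ c_j^∨) ⊗ (c_j ⊗ c_i^∨) → S`. Insert an `i`-cup and a `j`-cup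
joined by an odd chord, and pair the strands up: the incoming `c_i` with the `c_j^∨` of the `j`-cup,
the incoming `c_j^∨` with the `c_i` of the `i`-cup, the incoming `c_j` with the `c_i^∨` of the
`i`-cup and the incoming `c_i^∨` with the `c_j` of the `j`-cup. Then apply
`f : c_i ⊗ c_j^∨ ⟶ S` and `g : c_j ⊗ c_i^∨ ⟶ S` to these four pairs and multiply in `S`. -/
def quarticChord (S : C) [MonObj S] (i j : V) (f : c i ⊗ (c j)ᘁ ⟶ S) (g : c j ⊗ (c i)ᘁ ⟶ S) :
    OddHom P ((c i ⊗ (c j)ᘁ) ⊗ (c j ⊗ (c i)ᘁ)) S :=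
  coevChord P c J i j ▷ ((c i ⊗ (c j)ᘁ) ⊗ (c j ⊗ (c i)ᘁ)) ≫
    shuffle (c i) (c i)ᘁ (c j) (c j)ᘁ (c i) (c j)ᘁ (c j) (c i)ᘁ ≫
      ((f ⊗ₘ g) ⊗ₘ (g ⊗ₘ f)) ≫ (μ[S] ⊗ₘ μ[S]) ≫ μ[S]

/-- `evChord` followed by the unit of `S`, read along equalities of vertices. -/
def minusCore (S : C) [MonObj S] : {i j k l : V} → j = k → i = l →
    OddHom P ((c i ⊗ (c j)ᘁ) ⊗ (c k ⊗ (c l)ᘁ)) S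
  | i, j, _, _, rfl, rfl => evChord P c J i j ≫ η[S]

/-- `quarticChord`, read along equalities of vertices. -/
def plusCore (S : C) [MonObj S] : {i j k l : V} → j = k → i = l →
    (c i ⊗ (c j)ᘁ ⟶ S) → (c k ⊗ (c l)ᘁ ⟶ S) → OddHom P ((c i ⊗ (c j)ᘁ) ⊗ (c k ⊗ (c l)ᘁ)) S
  | i, j, _, _, rfl, rfl, f, g => quarticChord P c J S i j f g

variable {P s t c J}
variable (S : FreeCommMon (hTildeDual P s t c J))

/-- The canonical map `h_a^∨ ⟶ h̃^∨ ⟶ S h̃^∨`. -/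
def gen (a : E ⊕ E) : hDual s t c a ⟶ S.obj := toTilde P s t c J a ≫ S.incl

open scoped Classical in
/-- The `ab`-th component `h_a^∨ ⊗ h_b^∨ → S h̃^∨` of the odd map `φ⁻`: `⟨a, b⟩` times the
evaluation with an odd chord. -/
def phiMinus (a b : E ⊕ E) : OddHom P (hDual s t c a ⊗ hDual s t c b) S.obj :=
  if h : b = bar a then
    pairing a b • minusCore P c J S.obj
      (h ▸ (src_bar s t a).symm : tgt s t a = src s t b)
      (h ▸ (tgt_bar s t a).symm : src s t a = tgt s t b)
  else 0

open scoped Classical in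
/-- The `ab`-th component `h_a^∨ ⊗ h_b^∨ → S h̃^∨` of the odd map `φ⁺`: `⟨a, b⟩` times the
quartic map built from two coevaluations with an odd chord. -/
def phiPlus (a b : E ⊕ E) : OddHom P (hDual s t c a ⊗ hDual s t c b) S.obj :=
  if h : b = bar a then
    pairing a b • plusCore P c J S.obj
      (h ▸ (src_bar s t a).symm : tgt s t a = src s t b)
      (h ▸ (tgt_bar s t a).symm : src s t a = tgt s t b) (gen S a) (gen S b)
  else 0

/-- `Δ` is the odd differential operator of order 2 on `S h̃^∨` extending `φ`: it vanishes on
`S^0` and `S^1`, and on the image of `h_a^∨ ⊗ h_b^∨` in `S^2 h̃^∨` it is `φ a b`. -/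
structure IsExtension
    (φ : ∀ a b : E ⊕ E, OddHom P (hDual s t c a ⊗ hDual s t c b) S.obj)
    (Δ : OddHom P S.obj S.obj) : Prop where
  order_two : IsOddDiffOp P S.obj 2 Δ
  on_zero : P.pi ◁ η[S.obj] ≫ Δ = 0
  on_one : P.pi ◁ S.incl ≫ Δ = 0
  on_two : ∀ a b : E ⊕ E, P.pi ◁ ((gen S a ⊗ₘ gen S b) ≫ μ[S.obj]) ≫ Δ = φ a b

end Rep

end NecklaceBV

end

/-! For a cocommutative comonoid `K`, call a morphism `K ⟶ X` a point of `X`. Points have pure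
tensors `x ⊠ y`, which the symmetry swaps without sign, and the points of a commutative monoid form
a commutative ring. Every object `Z` has a generic point, over the square-zero comonoid `𝟙 ⊞ Z`, so
equations of morphisms can be checked on points (`spans_top`, `Spans.purePts`). Parity survives only
in the rule that points `θ, θ'` of `π` anticommute: an odd operator `Δ` becomes a family of additive
operators `Δ_θ` on commutative rings with `Δ_θ Δ_θ' = -Δ_θ' Δ_θ`.

Existence and uniqueness. The free commutative monoid is a coproduct of symmetric powers, and maps
out of it are built by recursion on monomials. A symmetric `φ` on pairs of generators integrates
twice: `φ` gives derivations `d_y`, and these give an operator with commutators `[Δ, y] = d_y`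
(`exists_oddDiffOp`). An operator of order `≤ k` that kills products of at most `k` generators kills
all products (`DiffOpOn.vanish`), whence uniqueness. Both `φ⁻` and `φ⁺` have the chord shape `N(ιp,
q') B(q, p') - N(p, q') B(ιq, p')`, with matrices `N`, `B` commuting with `ι`: identity matrices for
`φ⁻`, and `N = XY`, `B = YX` for `φ⁺`, where `X` and `Y` are the generic matrices of an arrow and
its reverse. This shape together with `ι² = id` makes `φ` descend to the coequalisers.

Square zero. By anticommutation `2 Δ_θ Δ_θ' = [Δ_θ, Δ_θ']`, which has order `≤ 3`; as `2` is
invertible, products of at most three generators suffice (`IsExtension.oddComp_eq_zero`). For `Δ⁻`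
the values on pairs are scalars, which `Δ` kills. For `Δ⁺` on two generators one has `{N, B} = 0`,
`ΔN = -N tr(ιB)`, `ΔB = B tr(ιN)` and `tr(ιB) = tr(ιN)`; here `tr N = tr B = 0` because the trace is
cyclic while `ι_θ ι_θ' = ξ(θ, θ')` is antisymmetric. On three generators `Δ_θ Δ_θ'` is a Jacobiator:
it vanishes termwise unless all arrows lie over one edge, and there the terms cancel since `θ` and
`θ'` anticommute. -/

open CategoryTheory MonoidalCategory Limits
open scoped MonObj

noncomputable section

namespace NecklaceBV

universe v u w w'

set_option linter.unusedSectionVars false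

/-! ### Points over a comonoid and their pure tensors. -/

section Points

open scoped ComonObj

variable {C : Type u} [Category.{v} C] [MonoidalCategory C]

/-- The pure tensor of two points with values in a comonoid `K`. -/
def pair {K X Y : C} [ComonObj K] (x : K ⟶ X) (y : K ⟶ Y) : K ⟶ X ⊗ Y :=
  Δ[K] ≫ (x ⊗ₘ y)

infixr:70 " ⊠ " => pair

/-- The multiple of a point by a scalar point. -/
def scal {K Y : C} [ComonObj K] (s : K ⟶ 𝟙_ C) (y : K ⟶ Y) : K ⟶ Y :=
  (s ⊠ y) ≫ (λ_ Y).hom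

section Eval

variable {K X Y Z X' Y' W : C} [ComonObj K]

@[simp] lemma pair_tensorHom (x : K ⟶ X) (y : K ⟶ Y) (f : X ⟶ X') (g : Y ⟶ Y') :
    (x ⊠ y) ≫ (f ⊗ₘ g) = (x ≫ f) ⊠ (y ≫ g) := by
  simp [pair]

@[simp] lemma pair_tensorHom_assoc (x : K ⟶ X) (y : K ⟶ Y) (f : X ⟶ X') (g : Y ⟶ Y')
    (h : X' ⊗ Y' ⟶ Z) : (x ⊠ y) ≫ (f ⊗ₘ g) ≫ h = ((x ≫ f) ⊠ (y ≫ g)) ≫ h := by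
  rw [← pair_tensorHom, Category.assoc]

@[simp] lemma pair_whiskerLeft (x : K ⟶ X) (y : K ⟶ Y) (g : Y ⟶ Y') :
    (x ⊠ y) ≫ X ◁ g = x ⊠ (y ≫ g) := by
  rw [← id_tensorHom, pair_tensorHom, Category.comp_id]

@[simp] lemma pair_whiskerLeft_assoc (x : K ⟶ X) (y : K ⟶ Y) (g : Y ⟶ Y')
    (h : X ⊗ Y' ⟶ Z) : (x ⊠ y) ≫ X ◁ g ≫ h = (x ⊠ (y ≫ g)) ≫ h := by
  rw [← pair_whiskerLeft, Category.assoc]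

@[simp] lemma pair_whiskerRight (x : K ⟶ X) (y : K ⟶ Y) (f : X ⟶ X') :
    (x ⊠ y) ≫ f ▷ Y = (x ≫ f) ⊠ y := by
  rw [← tensorHom_id, pair_tensorHom, Category.comp_id]

@[simp] lemma pair_whiskerRight_assoc (x : K ⟶ X) (y : K ⟶ Y) (f : X ⟶ X')
    (h : X' ⊗ Y ⟶ Z) : (x ⊠ y) ≫ f ▷ Y ≫ h = ((x ≫ f) ⊠ y) ≫ h := by
  rw [← pair_whiskerRight, Category.assoc]

@[simp] lemma pair_associator (x : K ⟶ X) (y : K ⟶ Y) (z : K ⟶ Z) :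
    ((x ⊠ y) ⊠ z) ≫ (α_ X Y Z).hom = x ⊠ (y ⊠ z) := by
  have h1 : (Δ[K] ≫ (x ⊗ₘ y)) ⊗ₘ z = Δ[K] ▷ K ≫ ((x ⊗ₘ y) ⊗ₘ z) := by
    rw [← tensorHom_id, tensorHom_comp_tensorHom, Category.id_comp]
  have h2 : x ⊗ₘ (Δ[K] ≫ (y ⊗ₘ z)) = K ◁ Δ[K] ≫ (x ⊗ₘ (y ⊗ₘ z)) := by
    rw [← id_tensorHom, tensorHom_comp_tensorHom, Category.id_comp]
  simp only [pair, h1, h2, Category.assoc, associator_naturality]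
  rw [ComonObj.comul_assoc_assoc]

@[simp] lemma pair_associator_assoc (x : K ⟶ X) (y : K ⟶ Y) (z : K ⟶ Z)
    (h : X ⊗ Y ⊗ Z ⟶ W) :
    ((x ⊠ y) ⊠ z) ≫ (α_ X Y Z).hom ≫ h = (x ⊠ (y ⊠ z)) ≫ h := by
  rw [← pair_associator, Category.assoc]

@[simp] lemma pair_associator_inv (x : K ⟶ X) (y : K ⟶ Y) (z : K ⟶ Z) :
    (x ⊠ (y ⊠ z)) ≫ (α_ X Y Z).inv = (x ⊠ y) ⊠ z := by
  rw [← pair_associator]; simp [-pair_associator]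

@[simp] lemma pair_associator_inv_assoc (x : K ⟶ X) (y : K ⟶ Y) (z : K ⟶ Z)
    (h : (X ⊗ Y) ⊗ Z ⟶ W) :
    (x ⊠ (y ⊠ z)) ≫ (α_ X Y Z).inv ≫ h = ((x ⊠ y) ⊠ z) ≫ h := by
  rw [← pair_associator_inv, Category.assoc]

@[simp] lemma pair_leftUnitor (s : K ⟶ 𝟙_ C) (y : K ⟶ Y) :
    (s ⊠ y) ≫ (λ_ Y).hom = scal s y := rfl

@[simp] lemma scal_counit (y : K ⟶ Y) : scal ε[K] y = y := by
  simp [scal, pair]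

lemma counit_pair (y : K ⟶ Y) : ε[K] ⊠ y = y ≫ (λ_ Y).inv := by
  simp [pair]

lemma pair_counit (y : K ⟶ Y) : y ⊠ ε[K] = y ≫ (ρ_ Y).inv := by
  simp [pair]

@[simp] lemma comp_leftUnitor_inv (y : K ⟶ Y) : y ≫ (λ_ Y).inv = ε[K] ⊠ y :=
  (counit_pair y).symm

@[simp] lemma comp_leftUnitor_inv_assoc (y : K ⟶ Y) (h : 𝟙_ C ⊗ Y ⟶ Z) :
    y ≫ (λ_ Y).inv ≫ h = (ε[K] ⊠ y) ≫ h := by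
  rw [counit_pair, Category.assoc]

@[simp] lemma comp_rightUnitor_inv (y : K ⟶ Y) : y ≫ (ρ_ Y).inv = y ⊠ ε[K] :=
  (pair_counit y).symm

@[simp] lemma comp_rightUnitor_inv_assoc (y : K ⟶ Y) (h : Y ⊗ 𝟙_ C ⟶ Z) :
    y ≫ (ρ_ Y).inv ≫ h = (y ⊠ ε[K]) ≫ h := by
  rw [pair_counit, Category.assoc]

@[simp] lemma counit_pair_rightUnitor (y : K ⟶ Y) : (y ⊠ ε[K]) ≫ (ρ_ Y).hom = y := by
  simp [pair_counit, -comp_rightUnitor_inv]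

@[simp] lemma counit_pair_rightUnitor_assoc (y : K ⟶ Y) (h : Y ⟶ Z) :
    (y ⊠ ε[K]) ≫ (ρ_ Y).hom ≫ h = y ≫ h := by
  rw [← Category.assoc, counit_pair_rightUnitor]

lemma scal_comp (s : K ⟶ 𝟙_ C) (y : K ⟶ Y) (f : Y ⟶ Z) : scal s y ≫ f = scal s (y ≫ f) := by
  rw [scal, scal, Category.assoc, ← leftUnitor_naturality, pair_whiskerLeft_assoc]

lemma scal_pair (s : K ⟶ 𝟙_ C) (x : K ⟶ X) (y : K ⟶ Y) :
    scal s x ⊠ y = scal s (x ⊠ y) := by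
  rw [scal, scal, ← pair_whiskerRight, ← pair_associator_inv]
  simp [-pair_leftUnitor, -pair_whiskerRight, -pair_associator_inv]

/-- This compatibility with the diagonal is what allows a change of the test comonoid in the middle
of a computation. -/
lemma comp_pair {K' : C} [ComonObj K'] (r : K' ⟶ K) [IsComonHom r] (x : K ⟶ X) (y : K ⟶ Y) :
    r ≫ (x ⊠ y) = (r ≫ x) ⊠ (r ≫ y) := by
  rw [pair, pair, IsComonHom.hom_comul_assoc, tensorHom_comp_tensorHom]

lemma comp_pair_assoc {K' : C} [ComonObj K'] (r : K' ⟶ K) [IsComonHom r] (x : K ⟶ X)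
    (y : K ⟶ Y) (h : X ⊗ Y ⟶ Z) : r ≫ (x ⊠ y) ≫ h = ((r ≫ x) ⊠ (r ≫ y)) ≫ h := by
  rw [← comp_pair, Category.assoc]

end Eval

section Braided

variable {K X Y Z : C} [SymmetricCategory C] [ComonObj K] [IsCommComonObj K]

-- Cocommutativity of `K` removes every permutation of strands from the formulas: points behave like
-- elements of even degree.
@[simp] lemma pair_braiding (x : K ⟶ X) (y : K ⟶ Y) : (x ⊠ y) ≫ (β_ X Y).hom = y ⊠ x := by
  simp only [pair, Category.assoc, BraidedCategory.braiding_naturality,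
    IsCommComonObj.comul_comm_assoc]

@[simp] lemma pair_braiding_assoc (x : K ⟶ X) (y : K ⟶ Y) (h : Y ⊗ X ⟶ Z) :
    (x ⊠ y) ≫ (β_ X Y).hom ≫ h = (y ⊠ x) ≫ h := by
  rw [← Category.assoc, pair_braiding]

lemma pair_scal (s : K ⟶ 𝟙_ C) (x : K ⟶ X) (y : K ⟶ Y) :
    x ⊠ scal s y = scal s (x ⊠ y) := by
  rw [← pair_braiding, scal_pair, scal_comp, pair_braiding]

lemma pair_rightUnitor (s : K ⟶ 𝟙_ C) (y : K ⟶ Y) : (y ⊠ s) ≫ (ρ_ Y).hom = scal s y := by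
  rw [scal, ← pair_braiding y s, Category.assoc, braiding_leftUnitor]

end Braided

section Additive

variable {K X Y Z : C} [Preadditive C] [MonoidalPreadditive C] [ComonObj K]

@[simp] lemma add_pair (x x' : K ⟶ X) (y : K ⟶ Y) : (x + x') ⊠ y = x ⊠ y + x' ⊠ y := by
  simp [pair, MonoidalPreadditive.add_tensor]

@[simp] lemma pair_add (x : K ⟶ X) (y y' : K ⟶ Y) : x ⊠ (y + y') = x ⊠ y + x ⊠ y' := by
  simp [pair, MonoidalPreadditive.tensor_add]

/-- The pure tensor of points as a biadditive map. -/
def pairHom (K X Y : C) [ComonObj K] : (K ⟶ X) →+ (K ⟶ Y) →+ (K ⟶ X ⊗ Y) :=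
  AddMonoidHom.mk' (fun x => AddMonoidHom.mk' (fun y => x ⊠ y) (pair_add x))
    (fun x x' => by ext y; exact add_pair x x' y)

@[simp] lemma zero_pair (y : K ⟶ Y) : (0 : K ⟶ X) ⊠ y = 0 :=
  DFunLike.congr_fun (map_zero (pairHom K X Y)) y

@[simp] lemma pair_zero (x : K ⟶ X) : x ⊠ (0 : K ⟶ Y) = 0 := map_zero (pairHom K X Y x)

@[simp] lemma neg_pair (x : K ⟶ X) (y : K ⟶ Y) : (-x) ⊠ y = -(x ⊠ y) :=
  DFunLike.congr_fun (map_neg (pairHom K X Y) x) y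

@[simp] lemma sub_pair (x x' : K ⟶ X) (y : K ⟶ Y) : (x - x') ⊠ y = x ⊠ y - x' ⊠ y :=
  DFunLike.congr_fun (map_sub (pairHom K X Y) x x') y

end Additive

end Points

/-! ### Jointly epimorphic families of points and generic points. -/

section Detection

open scoped ComonObj

variable {C : Type u} [Category.{v} C] [MonoidalCategory C] [SymmetricCategory C]

/-- A family of points of `Z` which is jointly epimorphic, also after tensoring. -/
def Spans {Z : C} (G : ∀ (K : C) [ComonObj K] [IsCommComonObj K], (K ⟶ Z) → Prop) : Prop :=
  ∀ (W Y : C) (f g : W ⊗ Z ⟶ Y),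
    (∀ (K : C) [ComonObj K] [IsCommComonObj K] (z : K ⟶ Z), G K z → W ◁ z ≫ f = W ◁ z ≫ g) → f = g

lemma Spans.ext {Z : C} {G : ∀ (K : C) [ComonObj K] [IsCommComonObj K], (K ⟶ Z) → Prop}
    (hG : Spans G) {Y : C} {f g : Z ⟶ Y}
    (h : ∀ (K : C) [ComonObj K] [IsCommComonObj K] (z : K ⟶ Z), G K z → z ≫ f = z ≫ g) : f = g := by
  have := hG (𝟙_ C) Y ((λ_ Z).hom ≫ f) ((λ_ Z).hom ≫ g) (fun K _ _ z hz => by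
    rw [leftUnitor_naturality_assoc, leftUnitor_naturality_assoc, h K z hz])
  simpa using this

variable {A B X Y : C}

/-- The projection of a tensor product of comonoids to the first factor. -/
def projLeft (A B : C) [ComonObj B] : A ⊗ B ⟶ A := A ◁ ε[B] ≫ (ρ_ A).hom

/-- The projection of a tensor product of comonoids to the second factor. -/
def projRight (A B : C) [ComonObj A] : A ⊗ B ⟶ B := ε[A] ▷ B ≫ (λ_ B).hom

lemma comul_counit_counit (B : C) [ComonObj B] :
    Δ[B] ≫ (ε[B] ⊗ₘ ε[B]) = ε[B] ≫ (λ_ _).inv := by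
  rw [ComonObj.counit_comul_hom]

instance [ComonObj A] [ComonObj B] : IsComonHom (projLeft A B) where
  hom_counit := by simp [projLeft, tensorHom_def']
  hom_comul := by
    have h1 : projLeft A B ⊗ₘ projLeft A B =
        ((𝟙 A ⊗ₘ ε[B]) ⊗ₘ (𝟙 A ⊗ₘ ε[B])) ≫ ((ρ_ A).hom ⊗ₘ (ρ_ A).hom) := by
      simp [projLeft]
    rw [Comon.tensorObj_comul, Category.assoc, h1, ← tensorμ_natural_assoc,
      tensorHom_comp_tensorHom_assoc, comul_counit_counit, projLeft]
    have h2 : (A ⊗ A) ◁ (λ_ (𝟙_ C)).inv ≫ tensorμ A A (𝟙_ C) (𝟙_ C) ≫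
        ((ρ_ A).hom ⊗ₘ (ρ_ A).hom) = (ρ_ (A ⊗ A)).hom := by
      simp only [tensorμ, braiding_tensorUnit_right]
      monoidal
    have h3 : Δ[A] ≫ (𝟙 A ⊗ₘ 𝟙 A) ⊗ₘ ε[B] ≫ (λ_ (𝟙_ C)).inv =
        A ◁ ε[B] ≫ Δ[A] ▷ 𝟙_ C ≫ (A ⊗ A) ◁ (λ_ (𝟙_ C)).inv := by
      rw [id_tensorHom_id, Category.comp_id, tensorHom_def', MonoidalCategory.whiskerLeft_comp,
        Category.assoc, whisker_exchange]
    rw [h3, Category.assoc, Category.assoc, Category.assoc, h2, rightUnitor_naturality]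

instance [ComonObj A] [ComonObj B] : IsComonHom (projRight A B) where
  hom_counit := by simp [projRight, MonoidalCategory.tensorHom_def]
  hom_comul := by
    have h1 : projRight A B ⊗ₘ projRight A B =
        ((ε[A] ⊗ₘ 𝟙 B) ⊗ₘ (ε[A] ⊗ₘ 𝟙 B)) ≫ ((λ_ B).hom ⊗ₘ (λ_ B).hom) := by
      simp [projRight]
    rw [Comon.tensorObj_comul, Category.assoc, h1, ← tensorμ_natural_assoc,
      tensorHom_comp_tensorHom_assoc, comul_counit_counit, projRight]
    have h2 : tensorμ (𝟙_ C) (𝟙_ C) B B ≫ ((λ_ B).hom ⊗ₘ (λ_ B).hom) =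
        (λ_ (𝟙_ C)).hom ▷ (B ⊗ B) ≫ (λ_ (B ⊗ B)).hom := by
      simp only [tensorμ, braiding_tensorUnit_left]
      monoidal
    rw [h2]
    simp [MonoidalCategory.tensorHom_def, -comp_leftUnitor_inv, -comp_leftUnitor_inv_assoc,
      -comp_rightUnitor_inv, -comp_rightUnitor_inv_assoc]

/-- A point over `A` and a point over `B` both pull back to `A ⊗ B`, where their external tensor
product becomes a pure tensor. -/
lemma projLeft_pair_projRight [ComonObj A] [ComonObj B] (x : A ⟶ X) (y : B ⟶ Y) :
    (projLeft A B ≫ x) ⊠ (projRight A B ≫ y) = x ⊗ₘ y := by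
  have h1 : projLeft A B ⊗ₘ projRight A B =
      ((𝟙 A ⊗ₘ ε[B]) ⊗ₘ (ε[A] ⊗ₘ 𝟙 B)) ≫ ((ρ_ A).hom ⊗ₘ (λ_ B).hom) := by
    simp [projLeft, projRight]
  have h2 : Δ[A ⊗ B] ≫ (projLeft A B ⊗ₘ projRight A B) = 𝟙 _ := by
    rw [Comon.tensorObj_comul, Category.assoc, h1, ← tensorμ_natural_assoc,
      tensorHom_comp_tensorHom_assoc, id_tensorHom, tensorHom_id, ComonObj.comul_counit,
      ComonObj.counit_comul]
    simp only [tensorμ, braiding_tensorUnit_left]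
    monoidal
  rw [pair, ← tensorHom_comp_tensorHom, reassoc_of% h2]

/-- A family of points stable under change of the comonoid. -/
def Stable {Z : C} (G : ∀ (K : C) [ComonObj K] [IsCommComonObj K], (K ⟶ Z) → Prop) : Prop :=
  ∀ (K K' : C) [ComonObj K] [IsCommComonObj K] [ComonObj K'] [IsCommComonObj K'] (r : K' ⟶ K)
    [IsComonHom r] (z : K ⟶ Z), G K z → G K' (r ≫ z)

/-- The pure tensors of points in two families. -/
def PurePts (G : ∀ (K : C) [ComonObj K] [IsCommComonObj K], (K ⟶ X) → Prop)
    (H : ∀ (K : C) [ComonObj K] [IsCommComonObj K], (K ⟶ Y) → Prop)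
    (K : C) [ComonObj K] [IsCommComonObj K] (z : K ⟶ X ⊗ Y) : Prop :=
  ∃ x y, G K x ∧ H K y ∧ z = x ⊠ y

variable {G : ∀ (K : C) [ComonObj K] [IsCommComonObj K], (K ⟶ X) → Prop}
    {H : ∀ (K : C) [ComonObj K] [IsCommComonObj K], (K ⟶ Y) → Prop}

lemma stable_top (Z : C) : Stable (Z := Z) (fun _ _ _ _ => True) :=
  fun _ _ _ _ _ _ _ _ _ _ => trivial

lemma Stable.purePts (hG : Stable G) (hH : Stable H) : Stable (PurePts G H) := by
  rintro K K' _ _ _ _ r _ z ⟨x, y, hx, hy, rfl⟩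
  exact ⟨r ≫ x, r ≫ y, hG _ _ r _ hx, hH _ _ r _ hy, comp_pair _ _ _⟩

/-- The factors are detected one at a time, the other one being absorbed into the spectator `W`;
this is why `Spans` asks for detection after tensoring. Stability lets both points be pulled back to
the common comonoid `A ⊗ B`. -/
lemma Spans.purePts (hG : Spans G) (hH : Spans H) (sG : Stable G) (sH : Stable H) :
    Spans (PurePts G H) := by
  intro W V f g h
  refine (cancel_epi (α_ W X Y).hom).1 (hH (W ⊗ X) V _ _ fun B _ _ y hy => ?_)
  refine (cancel_epi ((α_ W B X).hom ≫ W ◁ (β_ B X).hom ≫ (α_ W X B).inv)).1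
    (hG (W ⊗ B) V _ _ fun A _ _ x hx => ?_)
  have := h (A ⊗ B) ((projLeft A B ≫ x) ⊠ (projRight A B ≫ y))
    ⟨_, _, sG _ _ _ _ hx, sH _ _ _ _ hy, rfl⟩
  rw [projLeft_pair_projRight] at this
  have key : (W ⊗ B) ◁ x ≫ ((α_ W B X).hom ≫ W ◁ (β_ B X).hom ≫ (α_ W X B).inv) ≫
      (W ⊗ X) ◁ y ≫ (α_ W X Y).hom =
      (α_ W B A).hom ≫ W ◁ (β_ B A).hom ≫ W ◁ (x ⊗ₘ y) := by
    simp [MonoidalCategory.tensorHom_def]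
    rw [← MonoidalCategory.whiskerLeft_comp_assoc, BraidedCategory.braiding_naturality_right,
      MonoidalCategory.whiskerLeft_comp_assoc]
  simp only [← Category.assoc] at key ⊢
  rw [key, Category.assoc, Category.assoc, this]
  simp

variable [Preadditive C] [MonoidalPreadditive C] [HasBinaryBiproducts C]

/-- The square-zero comonoid `𝟙 ⊞ Z`, on which `Z` has a generic point. -/
def Gen (Z : C) : C := 𝟙_ C ⊞ Z

/-- The generic point of `Z`. -/
def genPt (Z : C) : Gen Z ⟶ Z := biprod.snd

/-- The inclusion of `Z` in the comonoid on which it has a generic point. -/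
def genIncl (Z : C) : Z ⟶ Gen Z := biprod.inr

/-- The distinguished point of the comonoid on which `Z` has a generic point. -/
def genOne (Z : C) : 𝟙_ C ⟶ Gen Z := biprod.inl

/-- The counit of the comonoid on which `Z` has a generic point. -/
def genCounit (Z : C) : Gen Z ⟶ 𝟙_ C := biprod.fst

@[simp] lemma genIncl_genPt (Z : C) : genIncl Z ≫ genPt Z = 𝟙 Z := biprod.inr_snd
@[simp] lemma genIncl_genCounit (Z : C) : genIncl Z ≫ genCounit Z = 0 := biprod.inr_fst
@[simp] lemma genOne_genCounit (Z : C) : genOne Z ≫ genCounit Z = 𝟙 _ := biprod.inl_fst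

lemma Gen.hom_ext {Z Y : C} {f g : Gen Z ⟶ Y} (h : genOne Z ≫ f = genOne Z ≫ g)
    (h' : genIncl Z ≫ f = genIncl Z ≫ g) : f = g :=
  biprod.hom_ext' _ _ h h'

/-- The comultiplication of the comonoid on which `Z` has a generic point. -/
def genComul (Z : C) : Gen Z ⟶ Gen Z ⊗ Gen Z :=
  biprod.desc ((λ_ _).inv ≫ (genOne Z ⊗ₘ genOne Z))
    ((λ_ _).inv ≫ (genOne Z ⊗ₘ genIncl Z) + (ρ_ _).inv ≫ (genIncl Z ⊗ₘ genOne Z))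

@[simp] lemma genOne_comul (Z : C) : genOne Z ≫ genComul Z =
  (λ_ _).inv ≫ (genOne Z ⊗ₘ genOne Z) := biprod.inl_desc _ _

@[simp] lemma genIncl_comul (Z : C) : genIncl Z ≫ genComul Z =
    (λ_ _).inv ≫ (genOne Z ⊗ₘ genIncl Z) + (ρ_ _).inv ≫ (genIncl Z ⊗ₘ genOne Z) :=
  biprod.inr_desc _ _

@[simp] lemma genOne_comul_assoc (Z : C) {Y : C} (h : _ ⟶ Y) : genOne Z ≫ genComul Z ≫ h =
    (λ_ _).inv ≫ (genOne Z ⊗ₘ genOne Z) ≫ h := by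
  rw [← Category.assoc, genOne_comul, Category.assoc]

@[simp] lemma genIncl_comul_assoc (Z : C) {Y : C} (h : _ ⟶ Y) : genIncl Z ≫ genComul Z ≫ h =
    (λ_ _).inv ≫ (genOne Z ⊗ₘ genIncl Z) ≫ h + (ρ_ _).inv ≫ (genIncl Z ⊗ₘ genOne Z) ≫ h := by
  rw [← Category.assoc, genIncl_comul]; simp

lemma tensorHom_comp_eq_whiskerLeft {W X X' X'' Y : C} (f : W ⟶ Y) (g : X ⟶ X') (h : X' ⟶ X'') :
    f ⊗ₘ (g ≫ h) = W ◁ g ≫ (f ⊗ₘ h) := by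
  rw [← id_tensorHom, tensorHom_comp_tensorHom, Category.id_comp]

lemma comp_tensorHom_eq_whiskerRight {W X X' X'' Y : C} (f : W ⟶ Y) (g : X ⟶ X') (h : X' ⟶ X'') :
    (g ≫ h) ⊗ₘ f = g ▷ W ≫ (h ⊗ₘ f) := by
  rw [← tensorHom_id, tensorHom_comp_tensorHom, Category.id_comp]

/-- This is the comonoid in which `genOne` is grouplike and `genIncl` is primitive over it. -/
instance (Z : C) : ComonObj (Gen Z) where
  counit := genCounit Z
  comul := genComul Z
  counit_comul := by
    apply Gen.hom_ext
    · simp [← tensorHom_id]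
    · simp [← tensorHom_id]
  comul_counit := by
    apply Gen.hom_ext
    · simp [← id_tensorHom, unitors_inv_equal]
    · simp [← id_tensorHom]
  comul_assoc := by
    apply Gen.hom_ext
    · simp only [genOne_comul_assoc, ← tensorHom_id, ← id_tensorHom,
        tensorHom_comp_tensorHom_assoc, tensorHom_comp_tensorHom, Category.comp_id, genOne_comul]
      simp only [tensorHom_comp_eq_whiskerLeft, comp_tensorHom_eq_whiskerRight, associator_naturality, Category.assoc]
      monoidal
    · simp only [genIncl_comul_assoc, ← tensorHom_id, ← id_tensorHom,
        tensorHom_comp_tensorHom_assoc, tensorHom_comp_tensorHom, Category.comp_id, genOne_comul,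
        genIncl_comul, MonoidalPreadditive.tensor_add, MonoidalPreadditive.add_tensor,
        Preadditive.add_comp, Preadditive.comp_add]
      simp only [tensorHom_comp_eq_whiskerLeft, comp_tensorHom_eq_whiskerRight, associator_naturality, Category.assoc]
      simp only [add_assoc]
      congr 1
      · monoidal
      congr 1
      · monoidal
      · monoidal

instance (Z : C) : IsCommComonObj (Gen Z) where
  comul_comm := by
    change genComul Z ≫ _ = genComul Z
    apply Gen.hom_ext
    · simp [unitors_inv_equal]
    · simp [add_comm]

/-- The generic point is a split epimorphism with section `genIncl`, so it alone detects equality.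
-/
lemma spans_top (Z : C) : Spans (Z := Z) (fun _ _ _ _ => True) := by
  intro W Y f g h
  have := whisker_eq (W ◁ genIncl Z) (h (Gen Z) (genPt Z) trivial)
  simpa only [← MonoidalCategory.whiskerLeft_comp_assoc, genIncl_genPt,
    MonoidalCategory.whiskerLeft_id, Category.id_comp] using this

end Detection

/-! ### Differential operators on commutative rings. -/

section DiffOpOn

variable {A : Type*} [CommRing A]

/-- The commutator of an additive operator with the multiplication by `f`. -/
def adj (Z : A →+ A) (f : A) : A →+ A :=
  Z.comp (AddMonoidHom.mulLeft f) - (AddMonoidHom.mulLeft f).comp Z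

@[simp] lemma adj_apply (Z : A →+ A) (f x : A) : adj Z f x = Z (f * x) - f * Z x := rfl

/-- The `n`-fold commutators of `Z` with the multiplications by elements of `G` vanish, i.e. `Z`
is a differential operator of order `< n` relative to `G`. -/
def DiffOpOn (G : Set A) : ℕ → (A →+ A) → Prop
  | 0, Z => Z = 0
  | n + 1, Z => ∀ f ∈ G, DiffOpOn G n (adj Z f)

namespace DiffOpOn

variable {G : Set A} {n : ℕ} {Z Z' : A →+ A}

lemma zero (G : Set A) (n : ℕ) : DiffOpOn G n (0 : A →+ A) := by
  induction n with
  | zero => rfl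
  | succ n ih =>
    intro f _
    convert ih
    ext x; simp

lemma add (h : DiffOpOn G n Z) (h' : DiffOpOn G n Z') : DiffOpOn G n (Z + Z') := by
  induction n generalizing Z Z' with
  | zero => obtain rfl : Z = 0 := h; obtain rfl : Z' = 0 := h'; exact add_zero _
  | succ n ih =>
    intro f hf
    convert ih (h f hf) (h' f hf) using 1
    ext x; simp; ring

lemma neg (h : DiffOpOn G n Z) : DiffOpOn G n (-Z) := by
  induction n generalizing Z with
  | zero => obtain rfl : Z = 0 := h; exact neg_zero
  | succ n ih =>
    intro f hf
    convert ih (h f hf) using 1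
    ext x; simp; ring

lemma sub (h : DiffOpOn G n Z) (h' : DiffOpOn G n Z') : DiffOpOn G n (Z - Z') := by
  rw [sub_eq_add_neg]
  exact h.add h'.neg

lemma mulLeft_comp (h : DiffOpOn G n Z) (a : A) :
    DiffOpOn G n ((AddMonoidHom.mulLeft a).comp Z) := by
  induction n generalizing Z with
  | zero => obtain rfl : Z = 0 := h; exact AddMonoidHom.comp_zero _
  | succ n ih =>
    intro f hf
    convert ih (h f hf) using 1
    ext x; simp; ring

lemma comp_mulLeft (h : DiffOpOn G n Z) (a : A) :
    DiffOpOn G n (Z.comp (AddMonoidHom.mulLeft a)) := by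
  induction n generalizing Z with
  | zero => obtain rfl : Z = 0 := h; exact AddMonoidHom.zero_comp _
  | succ n ih =>
    intro f hf
    convert ih (h f hf) using 1
    ext x; simp [mul_left_comm]

/-- By the Leibniz rule `[Z, fg] = [Z, f] g + f [Z, g]`, commutators with generators control
commutators with their products. -/
lemma closure (h : DiffOpOn G n Z) : DiffOpOn (Submonoid.closure G : Set A) n Z := by
  induction n generalizing Z with
  | zero => exact h
  | succ n ih =>
    intro f hf
    induction hf using Submonoid.closure_induction with
    | mem f hf => exact ih (h f hf)
    | one =>
      convert zero _ n
      ext x; simp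
    | mul f g _ _ hf hg =>
      convert (hf.comp_mulLeft g).add (hg.mulLeft_comp f) using 1
      ext x; simp [mul_assoc]; ring

/-- The commutator `adj Z a` has order one less and kills products of one factor less, so it kills
all products by induction on `k`. Then `Z (a * l) = a * Z l`, and induction on the length finishes.
-/
lemma vanish (k : ℕ) (h : DiffOpOn G (k + 1) Z)
    (h0 : ∀ l : List A, (∀ x ∈ l, x ∈ G) → l.length ≤ k → Z l.prod = 0)
    (l : List A) (hl : ∀ x ∈ l, x ∈ G) : Z l.prod = 0 := by
  induction k generalizing Z l with
  | zero =>
    induction l with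
    | nil => exact h0 [] (by simp) (by simp)
    | cons a l ih =>
      have h1 := h a (hl a (by simp))
      have h2 : adj Z a l.prod = 0 := by rw [show adj Z a = 0 from h1]; rfl
      rw [adj_apply, ih (fun x hx => hl x (by simp [hx])), mul_zero, sub_zero] at h2
      simpa using h2
  | succ k ihk =>
    induction l with
    | nil => exact h0 [] (by simp) (by simp)
    | cons a l ih =>
      have ha := hl a (by simp)
      have hl' : ∀ x ∈ l, x ∈ G := fun x hx => hl x (by simp [hx])
      have h2 : adj Z a l.prod = 0 := by
        refine ihk (h a ha) (fun l' hl' hk => ?_) l hl'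
        have h3 := h0 (a :: l') (by simpa [ha] using hl') (by simpa using hk)
        rw [adj_apply, h0 l' hl' (by omega), mul_zero, sub_zero, ← List.prod_cons, h3]
      rw [adj_apply, ih hl', mul_zero, sub_zero] at h2
      simpa using h2

/-- By the Jacobi identity `[[D, D'], f] = [[D, f], D'] + [D, [D', f]]`, so orders add up to one
less than for a composite. -/
lemma commutator {m n : ℕ} {D D' : A →+ A} (h : DiffOpOn Set.univ (m + 1) D)
    (h' : DiffOpOn Set.univ (n + 1) D') :
    DiffOpOn Set.univ (m + n) (D.comp D' - D'.comp D) := by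
  induction hk : m + n generalizing m n D D' with
  | zero =>
    obtain ⟨rfl, rfl⟩ : m = 0 ∧ n = 0 := by omega
    -- An operator of order zero is multiplication by its value at `1`, and multiplications commute.
    have e : ∀ {Z : A →+ A}, DiffOpOn Set.univ (0 + 1) Z → ∀ x, Z x = x * Z 1 := by
      intro Z hZ x
      have h1 : adj Z x 1 = 0 := by rw [show adj Z x = 0 from hZ x trivial]; rfl
      rw [adj_apply, mul_one] at h1
      exact sub_eq_zero.1 h1
    change _ = _
    ext x
    simp only [AddMonoidHom.sub_apply, AddMonoidHom.comp_apply, AddMonoidHom.zero_apply]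
    rw [e h (D' x), e h' (D x), e h x, e h' x]
    ring
  | succ k ih =>
    intro f hf
    have h1 : DiffOpOn Set.univ k ((adj D f).comp D' - D'.comp (adj D f)) := by
      cases m with
      | zero =>
        rw [show adj D f = 0 from h f hf]
        simpa using zero Set.univ k
      | succ m => exact ih (h f hf) h' (by omega)
    have h2 : DiffOpOn Set.univ k (D.comp (adj D' f) - (adj D' f).comp D) := by
      cases n with
      | zero =>
        rw [show adj D' f = 0 from h' f hf]
        simpa using zero Set.univ k
      | succ n => exact ih h (h' f hf) (by omega)
    convert h1.add h2 using 1
    ext x; simp; ring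

end DiffOpOn

end DiffOpOn

/-! ### The commutative ring of points of a commutative monoid. -/

section PointRing

open scoped ComonObj

variable {C : Type u} [Category.{v} C] [MonoidalCategory C] [SymmetricCategory C]
  [Preadditive C] [MonoidalPreadditive C]
  {K A : C} [ComonObj K] [IsCommComonObj K] [MonObj A] [IsCommMonObj A]

instance pointMul : Mul (K ⟶ A) := ⟨fun x y => (x ⊠ y) ≫ μ[A]⟩
instance pointOne : One (K ⟶ A) := ⟨ε[K] ≫ η[A]⟩

lemma point_mul_def (x y : K ⟶ A) : x * y = (x ⊠ y) ≫ μ[A] := rfl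
lemma point_one_def : (1 : K ⟶ A) = ε[K] ≫ η[A] := rfl

lemma pair_mul (x y : K ⟶ A) : (x ⊠ y) ≫ μ[A] = x * y := rfl

lemma pair_mul_assoc {Z : C} (x y : K ⟶ A) (h : A ⟶ Z) :
    (x ⊠ y) ≫ μ[A] ≫ h = (x * y) ≫ h := by
  rw [point_mul_def, Category.assoc]

lemma point_mul_comm (x y : K ⟶ A) : x * y = y * x := by
  rw [point_mul_def, point_mul_def, ← pair_braiding, Category.assoc, IsCommMonObj.mul_comm]

lemma point_one_mul (x : K ⟶ A) : 1 * x = x := by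
  rw [point_mul_def, point_one_def, ← pair_whiskerRight, Category.assoc, MonObj.one_mul]
  simp

instance : CommRing (K ⟶ A) where
  __ := Preadditive.homGroup K A
  mul_assoc x y z := by
    simp only [point_mul_def]
    rw [← pair_whiskerRight, Category.assoc, MonObj.mul_assoc]
    simp
  one_mul := point_one_mul
  mul_one x := by rw [point_mul_comm, point_one_mul]
  mul_comm := point_mul_comm
  left_distrib x y z := by simp [point_mul_def]
  right_distrib x y z := by simp [point_mul_def]
  zero_mul x := by simp [point_mul_def]
  mul_zero x := by simp [point_mul_def]

/-- Pullback of points along a map of comonoids. -/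
def pull {K' : C} [ComonObj K'] [IsCommComonObj K'] (r : K' ⟶ K) [IsComonHom r] :
    (K ⟶ A) →+* (K' ⟶ A) where
  toFun x := r ≫ x
  map_one' := by rw [point_one_def, point_one_def, IsComonHom.hom_counit_assoc]
  map_mul' x y := by rw [point_mul_def, point_mul_def, comp_pair_assoc]
  map_zero' := comp_zero
  map_add' x y := Preadditive.comp_add _ _ _ _ _ _

/-- A monoid homomorphism induces a ring homomorphism on points. -/
lemma mul_comp {B : C} [MonObj B] [IsCommMonObj B] (g : A ⟶ B) [IsMonHom g] (x y : K ⟶ A) :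
    (x * y) ≫ g = (x ≫ g) * (y ≫ g) := by
  simp [point_mul_def, IsMonHom.mul_hom]

lemma one_comp {B : C} [MonObj B] [IsCommMonObj B] (g : A ⟶ B) [IsMonHom g] :
    (1 : K ⟶ A) ≫ g = 1 := by
  simp [point_one_def, IsMonHom.one_hom]

lemma scal_eq_mul (s : K ⟶ 𝟙_ C) (x : K ⟶ A) : scal s x = (s ≫ η[A]) * x := by
  rw [point_mul_def, ← pair_whiskerRight, Category.assoc, MonObj.one_mul]
  rfl

end PointRing

/-! ### Maps out of colimits preserved by a functor. -/

section Preserves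

variable {C : Type*} [Category C] {D : Type*} [Category D] (F : C ⥤ D)

lemma exists_map_coequalizer_desc {X Y : C} (f g : X ⟶ Y) [HasCoequalizer f g]
    [PreservesColimit (parallelPair f g) F] {Z : D} (k : F.obj Y ⟶ Z)
    (h : F.map f ≫ k = F.map g ≫ k) : ∃ l, F.map (coequalizer.π f g) ≫ l = k :=
  ⟨_, (Cofork.IsColimit.desc' (isColimitOfHasCoequalizerOfPreservesColimit F f g) k h).2⟩

lemma epi_map_coequalizer {X Y : C} (f g : X ⟶ Y) [HasCoequalizer f g]
    [PreservesColimit (parallelPair f g) F] : Epi (F.map (coequalizer.π f g)) :=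
  ⟨fun _ _ h => Cofork.IsColimit.hom_ext (isColimitOfHasCoequalizerOfPreservesColimit F f g) h⟩

lemma exists_map_sigma_desc {J : Type*} (f : J → C) [HasCoproduct f]
    [PreservesColimit (Discrete.functor f) F] {Z : D} (k : ∀ j, F.obj (f j) ⟶ Z) :
    ∃ l, ∀ j, F.map (Sigma.ι f j) ≫ l = k j :=
  ⟨Cofan.IsColimit.desc (isColimitOfHasCoproductOfPreservesColimit F f) k,
    fun j => Cofan.IsColimit.fac (isColimitOfHasCoproductOfPreservesColimit F f) k j⟩

lemma map_sigma_hom_ext {J : Type*} (f : J → C) [HasCoproduct f]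
    [PreservesColimit (Discrete.functor f) F] {Z : D} {k l : F.obj (∐ f) ⟶ Z}
    (h : ∀ j, F.map (Sigma.ι f j) ≫ k = F.map (Sigma.ι f j) ≫ l) : k = l :=
  Cofan.IsColimit.hom_ext (isColimitOfHasCoproductOfPreservesColimit F f) _ _ h

end Preserves

/-! ### Symmetric powers by iterated coequalisers. -/

section SymModel

open scoped ComonObj

variable {C : Type u} [Category.{v} C] [MonoidalCategory C] [SymmetricCategory C]

/-- The exchange of the first two factors. -/
def exch (X Y Z : C) : X ⊗ Y ⊗ Z ⟶ Y ⊗ X ⊗ Z :=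
  (α_ X Y Z).inv ≫ (β_ X Y).hom ▷ Z ≫ (α_ Y X Z).hom

@[simp] lemma pair_exch {K X Y Z : C} [ComonObj K] [IsCommComonObj K] (x : K ⟶ X) (y : K ⟶ Y)
    (z : K ⟶ Z) : (x ⊠ (y ⊠ z)) ≫ exch X Y Z = y ⊠ (x ⊠ z) := by
  simp [exch]

@[simp] lemma pair_exch_assoc {K X Y Z W : C} [ComonObj K] [IsCommComonObj K] (x : K ⟶ X)
    (y : K ⟶ Y) (z : K ⟶ Z) (h : Y ⊗ X ⊗ Z ⟶ W) :
    (x ⊠ (y ⊠ z)) ≫ exch X Y Z ≫ h = (y ⊠ (x ⊠ z)) ≫ h := by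
  rw [← Category.assoc, pair_exch]

/-- Commuting actions on `N` of the points of `x`. -/
structure SymAction (x N : C) where
  /-- the action -/
  act : x ⊗ N ⟶ N
  comm : ∀ (K : C) [ComonObj K] [IsCommComonObj K] (y y' : K ⟶ x) (n : K ⟶ N),
    (y ⊠ ((y' ⊠ n) ≫ act)) ≫ act = (y' ⊠ ((y ⊠ n) ≫ act)) ≫ act

section Span

variable [Preadditive C] [MonoidalPreadditive C] [HasBinaryBiproducts C]

lemma hom_ext₁ {X Y : C} {f g : X ⟶ Y}
    (h : ∀ (K : C) [ComonObj K] [IsCommComonObj K] (x : K ⟶ X), x ≫ f = x ≫ g) : f = g :=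
  (spans_top X).ext fun K _ _ z _ => h K z

lemma hom_ext₂ {X Y Z : C} {f g : X ⊗ Y ⟶ Z}
    (h : ∀ (K : C) [ComonObj K] [IsCommComonObj K] (x : K ⟶ X) (y : K ⟶ Y),
      (x ⊠ y) ≫ f = (x ⊠ y) ≫ g) : f = g :=
  ((spans_top X).purePts (spans_top Y) (stable_top X) (stable_top Y)).ext
    fun K _ _ _ ⟨x, y, _, _, hz⟩ => hz ▸ h K x y

lemma hom_ext₃ {X Y Z V : C} {f g : X ⊗ Y ⊗ Z ⟶ V}
    (h : ∀ (K : C) [ComonObj K] [IsCommComonObj K] (x : K ⟶ X) (y : K ⟶ Y) (z : K ⟶ Z),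
      (x ⊠ (y ⊠ z)) ≫ f = (x ⊠ (y ⊠ z)) ≫ g) : f = g :=
  ((spans_top X).purePts ((spans_top Y).purePts (spans_top Z) (stable_top Y) (stable_top Z))
    (stable_top X) ((stable_top Y).purePts (stable_top Z))).ext
    fun K _ _ _ ⟨x, _, _, ⟨y, z, _, _, hyz⟩, hz⟩ => hz ▸ hyz ▸ h K x y z

lemma hom_ext₄ {X Y Z V U : C} {f g : X ⊗ Y ⊗ Z ⊗ V ⟶ U}
    (h : ∀ (K : C) [ComonObj K] [IsCommComonObj K] (x : K ⟶ X) (y : K ⟶ Y) (z : K ⟶ Z)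
      (v : K ⟶ V), (x ⊠ (y ⊠ (z ⊠ v))) ≫ f = (x ⊠ (y ⊠ (z ⊠ v))) ≫ g) : f = g := by
  have sZV := (stable_top Z).purePts (stable_top V)
  have hZV := (spans_top Z).purePts (spans_top V) (stable_top Z) (stable_top V)
  have hYZV := (spans_top Y).purePts hZV (stable_top Y) sZV
  refine ((spans_top X).purePts hYZV (stable_top X) ((stable_top Y).purePts sZV)).ext ?_
  rintro K _ _ _ ⟨x, _, -, ⟨y, _, -, ⟨z, v, -, -, rfl⟩, rfl⟩, rfl⟩
  exact h K x y z v

variable [HasColimitsOfSize.{0, 0} C] [∀ x : C, PreservesColimitsOfSize.{0, 0} (tensorLeft x)]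

variable (x : C)

/-- Two consecutive symmetric powers. -/
structure SymStage where
  /-- the `n`-th power -/
  A : C
  /-- the `n + 1`-st power -/
  B : C
  /-- the multiplication -/
  q : x ⊗ A ⟶ B

variable {x} in
/-- The next two consecutive symmetric powers. -/
def SymStage.next (s : SymStage x) : SymStage x where
  A := s.B
  B := coequalizer (x ◁ s.q) (exch x x s.A ≫ x ◁ s.q)
  q := coequalizer.π _ _

/-- The symmetric powers of `x`, by recursion. -/
def symStage : ℕ → SymStage x
  | 0 => ⟨𝟙_ C, x ⊗ 𝟙_ C, 𝟙 _⟩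
  | n + 1 => (symStage n).next

/-- The `n`-th symmetric power of `x`. -/
def symPow (n : ℕ) : C := (symStage x n).A

/-- The multiplication from the `n`-th to the `n + 1`-st symmetric power. -/
def symMul (n : ℕ) : x ⊗ symPow x n ⟶ symPow x (n + 1) := (symStage x n).q

/-- The unit of the symmetric algebra in degree zero. -/
def symOne : 𝟙_ C ⟶ symPow x 0 := 𝟙 (𝟙_ C)

/-- The inverse of `symOne`. -/
def symOneInv : symPow x 0 ⟶ 𝟙_ C := 𝟙 (𝟙_ C)

/-- The inverse of the multiplication in lowest degree. -/
def symMulZeroInv : symPow x 1 ⟶ x ⊗ symPow x 0 := 𝟙 (x ⊗ 𝟙_ C)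

@[simp] lemma symOne_symOneInv : symOne x ≫ symOneInv x = 𝟙 _ := Category.comp_id _
@[simp] lemma symOneInv_symOne : symOneInv x ≫ symOne x = 𝟙 _ := Category.comp_id _
@[simp] lemma symMul_zero_inv : symMul x 0 ≫ symMulZeroInv x = 𝟙 _ := Category.comp_id _
@[simp] lemma symMul_zero_inv' : symMulZeroInv x ≫ symMul x 0 = 𝟙 _ := Category.comp_id _

lemma symMul_comm (n : ℕ) : x ◁ symMul x n ≫ symMul x (n + 1) =
    exch x x (symPow x n) ≫ x ◁ symMul x n ≫ symMul x (n + 1) :=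
  (coequalizer.condition (x ◁ (symStage x n).q)
    (exch x x (symStage x n).A ≫ x ◁ (symStage x n).q)).trans (Category.assoc _ _ _)

variable {x}

lemma epi_whiskerLeft_symMul (W : C) (n : ℕ) : Epi (W ◁ symMul x n) := by
  cases n with
  | zero =>
    have : IsIso (symMul x 0) := ⟨symMulZeroInv x, by simp, by simp⟩
    infer_instance
  | succ n =>
    exact epi_map_coequalizer (tensorLeft W) (x ◁ (symStage x n).q)
      (exch x x (symStage x n).A ≫ x ◁ (symStage x n).q)

lemma exists_symPow_desc (W : C) (n : ℕ) {Y : C} (k : W ⊗ x ⊗ symPow x (n + 1) ⟶ Y)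
    (h : W ◁ x ◁ symMul x n ≫ k = W ◁ (exch x x (symPow x n) ≫ x ◁ symMul x n) ≫ k) :
    ∃ l, W ◁ symMul x (n + 1) ≫ l = k :=
  exists_map_coequalizer_desc (tensorLeft W) (x ◁ (symStage x n).q)
      (exch x x (symStage x n).A ≫ x ◁ (symStage x n).q) k h

/-- The rule `G (w, y·b) = y · G (w, b)` respects the coequaliser that exchanges two generators
precisely because the action is commutative. -/
lemma exists_symPow_rec {W N : C} (a : SymAction x N) (n0 : W ⟶ N) :
    ∃ G : ∀ n, W ⊗ symPow x n ⟶ N, W ◁ symOne x ≫ G 0 = (ρ_ W).hom ≫ n0 ∧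
      ∀ n, W ◁ symMul x n ≫ G (n + 1) = exch W x _ ≫ x ◁ G n ≫ a.act := by
  -- Two consecutive degrees are carried along, since the relations in degree `n + 2` involve
  -- degrees `n` and `n + 1`.
  have step : ∀ n (p : {p : (W ⊗ symPow x n ⟶ N) × (W ⊗ symPow x (n + 1) ⟶ N) //
      W ◁ symMul x n ≫ p.2 = exch W x _ ≫ x ◁ p.1 ≫ a.act}),
      ∃ g : W ⊗ symPow x (n + 2) ⟶ N,
        W ◁ symMul x (n + 1) ≫ g = exch W x _ ≫ x ◁ p.1.2 ≫ a.act := by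
    rintro n ⟨⟨g, g'⟩, hg⟩
    refine exists_symPow_desc W n _ ?_
    refine hom_ext₄ fun K _ _ w y y' b => ?_
    have key : ∀ (y : K ⟶ x), (w ⊠ ((y ⊠ b) ≫ symMul x n)) ≫ g' =
        (y ⊠ ((w ⊠ b) ≫ g)) ≫ a.act := by
      intro y
      have := whisker_eq (w ⊠ (y ⊠ b)) hg
      simpa using this
    simp [key, a.comm K y y']
  choose next hnext using step
  let H : ∀ n, {p : (W ⊗ symPow x n ⟶ N) × (W ⊗ symPow x (n + 1) ⟶ N) //
      W ◁ symMul x n ≫ p.2 = exch W x _ ≫ x ◁ p.1 ≫ a.act} := fun n =>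
    Nat.rec ⟨⟨W ◁ symOneInv x ≫ (ρ_ W).hom ≫ n0, W ◁ symMulZeroInv x ≫ exch W x _ ≫
        x ◁ (W ◁ symOneInv x ≫ (ρ_ W).hom ≫ n0) ≫ a.act⟩, by
          simp only [← MonoidalCategory.whiskerLeft_comp_assoc, symMul_zero_inv]; simp⟩
      (fun n p => ⟨⟨p.1.2, next n p⟩, hnext n p⟩) n
  exact ⟨fun n => (H n).1.1, by
    change W ◁ symOne x ≫ W ◁ symOneInv x ≫ (ρ_ W).hom ≫ n0 = _
    simp only [← MonoidalCategory.whiskerLeft_comp_assoc, symOne_symOneInv]; simp, fun n => (H n).2⟩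

variable (x) in
/-- The underlying object of the free commutative monoid. -/
def symObj : C := ∐ fun n => symPow x n

variable (x) in
/-- The inclusion of the `n`-th symmetric power. -/
def symι (n : ℕ) : symPow x n ⟶ symObj x := Sigma.ι (fun n => symPow x n) n

lemma symObj_hom_ext {W Y : C} {f g : W ⊗ symObj x ⟶ Y}
    (h : ∀ n, W ◁ symι x n ≫ f = W ◁ symι x n ≫ g) : f = g :=
  map_sigma_hom_ext (tensorLeft W) (fun n => symPow x n) h

lemma exists_symObj_desc {W Y : C} (k : ∀ n, W ⊗ symPow x n ⟶ Y) :
    ∃ l : W ⊗ symObj x ⟶ Y, ∀ n, W ◁ symι x n ≫ l = k n :=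
  exists_map_sigma_desc (tensorLeft W) (fun n => symPow x n) k

variable (x) in
lemma exists_symAct : ∃ l : x ⊗ symObj x ⟶ symObj x,
    ∀ n, x ◁ symι x n ≫ l = symMul x n ≫ symι x (n + 1) :=
  exists_symObj_desc _

variable (x) in
/-- The points of the symmetric powers which are monomials in a given family of points. -/
def SymMonomial (G : ∀ (K : C) [ComonObj K] [IsCommComonObj K], (K ⟶ x) → Prop) :
    ∀ (n : ℕ) (K : C) [ComonObj K] [IsCommComonObj K], (K ⟶ symPow x n) → Prop
  | 0, K, _, _, z => z = ε[K] ≫ symOne x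
  | n + 1, K, _, _, z => ∃ y a, G K y ∧ SymMonomial G n K a ∧ z = (y ⊠ a) ≫ symMul x n

variable {G : ∀ (K : C) [ComonObj K] [IsCommComonObj K], (K ⟶ x) → Prop}

lemma stable_symMonomial (sG : Stable G) (n : ℕ) : Stable (SymMonomial x G n) := by
  induction n with
  | zero =>
    rintro K K' _ _ _ _ r _ z rfl
    exact IsComonHom.hom_counit_assoc r _
  | succ n ih =>
    rintro K K' _ _ _ _ r _ z ⟨y, a, hy, ha, rfl⟩
    exact ⟨r ≫ y, r ≫ a, sG _ _ _ _ hy, ih _ _ _ _ ha, by rw [comp_pair_assoc]⟩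

lemma spans_symMonomial (hG : Spans G) (sG : Stable G) (n : ℕ) : Spans (SymMonomial x G n) := by
  induction n with
  | zero =>
    intro W Y f g h
    -- The counit of `Gen (𝟙_ C)` is split by `genOne`, so the single monomial of degree zero is
    -- already epimorphic over this comonoid.
    have e : (symOneInv x ≫ genOne (𝟙_ C)) ≫ ε[Gen (𝟙_ C)] ≫ symOne x = 𝟙 _ := by
      rw [Category.assoc, show genOne (𝟙_ C) ≫ ε[Gen (𝟙_ C)] ≫ symOne x = symOne x by
        rw [← Category.assoc]
        exact (congrArg (· ≫ symOne x) (genOne_genCounit _)).trans (Category.id_comp _)]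
      simp
    have := whisker_eq (W ◁ (symOneInv x ≫ genOne (𝟙_ C)))
      (h (Gen (𝟙_ C)) (ε[Gen (𝟙_ C)] ≫ symOne x) rfl)
    rwa [← MonoidalCategory.whiskerLeft_comp_assoc, ← MonoidalCategory.whiskerLeft_comp_assoc, e,
      MonoidalCategory.whiskerLeft_id, Category.id_comp, Category.id_comp] at this
  | succ n ih =>
    intro W Y f g h
    have := epi_whiskerLeft_symMul (x := x) W n
    rw [← cancel_epi (W ◁ symMul x n)]
    refine hG.purePts ih sG (stable_symMonomial sG n) W Y _ _ ?_
    rintro K _ _ z ⟨y, a, hy, ha, rfl⟩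
    rw [← MonoidalCategory.whiskerLeft_comp_assoc, ← MonoidalCategory.whiskerLeft_comp_assoc]
    exact h K _ ⟨y, a, hy, ha, rfl⟩

end Span

end SymModel

/-! ### The free commutative monoid and its recursion principle. -/

section SymMonoid

open scoped ComonObj

variable {C : Type u} [Category.{v} C] [MonoidalCategory C] [SymmetricCategory C]
  [Preadditive C] [MonoidalPreadditive C] [HasBinaryBiproducts C]
  [HasColimitsOfSize.{0, 0} C] [∀ x : C, PreservesColimitsOfSize.{0, 0} (tensorLeft x)]
  {x : C}

variable (x) in
/-- The action of `x` on the free commutative monoid. -/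
def symAct : x ⊗ symObj x ⟶ symObj x := (exists_symAct x).choose

lemma symι_symAct (n : ℕ) : x ◁ symι x n ≫ symAct x = symMul x n ≫ symι x (n + 1) :=
  (exists_symAct x).choose_spec n

lemma pair_symι_symAct {K : C} [ComonObj K] (y : K ⟶ x) {n : ℕ} (a : K ⟶ symPow x n) :
    (y ⊠ (a ≫ symι x n)) ≫ symAct x = (y ⊠ a) ≫ symMul x n ≫ symι x (n + 1) := by
  rw [← symι_symAct, pair_whiskerLeft_assoc]

variable (x) in
/-- The unit of the free commutative monoid. -/
def symUnit : 𝟙_ C ⟶ symObj x := symOne x ≫ symι x 0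

/-- The points of the free commutative monoid which are monomials in a family of points. -/
def SymMon (G : ∀ (K : C) [ComonObj K] [IsCommComonObj K], (K ⟶ x) → Prop)
    (K : C) [ComonObj K] [IsCommComonObj K] (z : K ⟶ symObj x) : Prop :=
  ∃ (n : ℕ) (a : K ⟶ symPow x n), SymMonomial x G n K a ∧ z = a ≫ symι x n

variable {G : ∀ (K : C) [ComonObj K] [IsCommComonObj K], (K ⟶ x) → Prop}

lemma stable_symMon (sG : Stable G) : Stable (SymMon G) := by
  rintro K K' _ _ _ _ r _ z ⟨n, a, ha, rfl⟩
  exact ⟨n, r ≫ a, stable_symMonomial sG n K K' r a ha, (Category.assoc _ _ _).symm⟩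

lemma spans_symMon (hG : Spans G) (sG : Stable G) : Spans (SymMon G) := by
  intro W Y f g h
  refine symObj_hom_ext fun n => spans_symMonomial hG sG n _ _ _ _ fun K _ _ a ha => ?_
  simpa using h K _ ⟨n, a, ha, rfl⟩

/-- Monomials in arbitrary points. -/
abbrev SymMonTop (x : C) (K : C) [ComonObj K] [IsCommComonObj K] (z : K ⟶ symObj x) : Prop :=
  SymMon (fun _ _ _ (_ : _ ⟶ x) => True) K z

lemma stable_symMonTop : Stable (SymMonTop x) := stable_symMon (stable_top x)

lemma spans_symMonTop : Spans (SymMonTop x) := spans_symMon (spans_top x) (stable_top x)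

lemma SymMon.induction {K : C} [ComonObj K] [IsCommComonObj K] {P : (K ⟶ symObj x) → Prop}
    (h1 : P (ε[K] ≫ symUnit x))
    (h2 : ∀ (y : K ⟶ x) s, G K y → SymMon G K s → P s → P ((y ⊠ s) ≫ symAct x))
    (z : K ⟶ symObj x) (hz : SymMon G K z) : P z := by
  obtain ⟨n, a, ha, rfl⟩ := hz
  induction n with
  | zero => obtain rfl : a = ε[K] ≫ symOne x := ha; rw [Category.assoc]; exact h1
  | succ n ih =>
    obtain ⟨y, a, hy, ha, rfl⟩ := ha
    rw [Category.assoc, ← pair_symι_symAct]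
    exact h2 y _ hy ⟨n, a, ha, rfl⟩ (ih a ha)

variable (x) in
/-- The action of `x` on the free commutative monoid, as a commutative action. -/
def symActM : SymAction x (symObj x) where
  act := symAct x
  comm K _ _ y y' s := by
    have h : x ◁ symAct x ≫ symAct x = exch x x _ ≫ x ◁ symAct x ≫ symAct x := by
      refine ((spans_top x).purePts ((spans_top x).purePts (spans_symMonTop (x := x))
        (stable_top x) stable_symMonTop) (stable_top x)
        ((stable_top x).purePts stable_symMonTop)).ext ?_
      rintro K _ _ _ ⟨y, _, -, ⟨y', _, -, ⟨n, a, -, rfl⟩, rfl⟩, rfl⟩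
      have h' := whisker_eq (y ⊠ (y' ⊠ a)) (eq_whisker (symMul_comm x n) (symι x (n + 2)))
      simp only [Category.assoc, pair_whiskerLeft_assoc, pair_exch_assoc] at h' ⊢
      rw [pair_symι_symAct, pair_symι_symAct, ← Category.assoc (_ ⊠ _), ← Category.assoc (_ ⊠ _),
        pair_symι_symAct, pair_symι_symAct, h']
    simpa using whisker_eq (y ⊠ (y' ⊠ s)) h

/-- Monomials span, so two solutions of one recursion agree. The family `H` allows `W` to be a
tensor product that is tested on pure tensors only. -/
lemma symObj_rec_unique {W N : C} {H : ∀ (K : C) [ComonObj K] [IsCommComonObj K], (K ⟶ W) → Prop}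
    (hH : Spans H) (sH : Stable H) (a : x ⊗ N ⟶ N) {F F' : W ⊗ symObj x ⟶ N}
    (h0 : ∀ (K : C) [ComonObj K] [IsCommComonObj K] (w : K ⟶ W), H K w →
      (w ⊠ (ε[K] ≫ symUnit x)) ≫ F = (w ⊠ (ε[K] ≫ symUnit x)) ≫ F')
    (h : ∀ (K : C) [ComonObj K] [IsCommComonObj K] (w : K ⟶ W) (y : K ⟶ x) (s : K ⟶ symObj x),
      H K w → (w ⊠ ((y ⊠ s) ≫ symAct x)) ≫ F = (y ⊠ ((w ⊠ s) ≫ F)) ≫ a)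
    (h' : ∀ (K : C) [ComonObj K] [IsCommComonObj K] (w : K ⟶ W) (y : K ⟶ x) (s : K ⟶ symObj x),
      H K w → (w ⊠ ((y ⊠ s) ≫ symAct x)) ≫ F' = (y ⊠ ((w ⊠ s) ≫ F')) ≫ a) : F = F' := by
  refine (hH.purePts (spans_symMonTop (x := x)) sH stable_symMonTop).ext ?_
  rintro K _ _ _ ⟨w, s, hw, hs, rfl⟩
  refine SymMon.induction (P := fun s => (w ⊠ s) ≫ F = (w ⊠ s) ≫ F') (h0 K w hw) ?_ s hs
  intro y s _ _ hs
  rw [h K w y s hw, h' K w y s hw, hs]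

lemma symObj_rec {W N : C} (a : SymAction x N) (n0 : W ⟶ N) :
    ∃ F : W ⊗ symObj x ⟶ N,
      (∀ (K : C) [ComonObj K] (w : K ⟶ W),
        (w ⊠ (ε[K] ≫ symUnit x)) ≫ F = w ≫ n0) ∧
      ∀ (K : C) [ComonObj K] [IsCommComonObj K] (w : K ⟶ W) (y : K ⟶ x) (s : K ⟶ symObj x),
        (w ⊠ ((y ⊠ s) ≫ symAct x)) ≫ F = (y ⊠ ((w ⊠ s) ≫ F)) ≫ a.act := by
  obtain ⟨f, hf0, hf⟩ := exists_symPow_rec a n0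
  obtain ⟨F, hF⟩ := exists_symObj_desc f
  refine ⟨F, fun K _ w => ?_, fun K _ _ w y s => ?_⟩
  · have h := whisker_eq (w ⊠ ε[K]) hf0
    rw [← hF] at h
    simpa [symUnit] using h
  · have h : W ◁ symAct x ≫ F = exch W x _ ≫ x ◁ F ≫ a.act := by
      refine ((spans_top W).purePts ((spans_top x).purePts (spans_symMonTop (x := x))
        (stable_top x) stable_symMonTop) (stable_top W)
        ((stable_top x).purePts stable_symMonTop)).ext ?_
      rintro K _ _ _ ⟨w, _, -, ⟨y, _, -, ⟨n, b, -, rfl⟩, rfl⟩, rfl⟩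
      have h' := whisker_eq (w ⊠ (y ⊠ b)) (hf n)
      rw [← hF, ← hF] at h'
      simp only [pair_whiskerLeft_assoc, pair_exch_assoc, Category.assoc] at h' ⊢
      rw [pair_symι_symAct, h']
    simpa using whisker_eq (w ⊠ (y ⊠ s)) h

variable (x) in
/-- The multiplication of the free commutative monoid. -/
def symObjMul : symObj x ⊗ symObj x ⟶ symObj x := (symObj_rec (symActM x) (𝟙 _)).choose

lemma symObjMul_unit {K : C} [ComonObj K] (w : K ⟶ symObj x) :
    (w ⊠ (ε[K] ≫ symUnit x)) ≫ symObjMul x = w :=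
  ((symObj_rec (symActM x) (𝟙 _)).choose_spec.1 K w).trans (Category.comp_id w)

lemma symObjMul_act {K : C} [ComonObj K] [IsCommComonObj K] (w : K ⟶ symObj x) (y : K ⟶ x)
    (s : K ⟶ symObj x) : (w ⊠ ((y ⊠ s) ≫ symAct x)) ≫ symObjMul x =
      (y ⊠ ((w ⊠ s) ≫ symObjMul x)) ≫ symAct x :=
  (symObj_rec (symActM x) (𝟙 _)).choose_spec.2 K w y s

/-- The product is defined by recursion in its second factor. Linearity in the first follows from
uniqueness: both sides obey the same recursion, because the actions of two generators commute. -/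
lemma act_symObjMul {K : C} [ComonObj K] [IsCommComonObj K] (w : K ⟶ symObj x) (y : K ⟶ x)
    (s : K ⟶ symObj x) : (((y ⊠ s) ≫ symAct x) ⊠ w) ≫ symObjMul x =
      (y ⊠ ((s ⊠ w) ≫ symObjMul x)) ≫ symAct x := by
  have h : symAct x ▷ symObj x ≫ symObjMul x =
      (α_ _ _ _).hom ≫ x ◁ symObjMul x ≫ symAct x := by
    refine symObj_rec_unique ((spans_top x).purePts (spans_top (symObj x)) (stable_top _)
      (stable_top _)) ((stable_top _).purePts (stable_top _)) (symAct x) ?_ ?_ ?_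
    · rintro K _ _ _ ⟨y, s, -, -, rfl⟩
      simp [symObjMul_unit]
    · rintro K _ _ _ y' s' ⟨y, s, -, -, rfl⟩
      simp [symObjMul_act]
    · rintro K _ _ _ y' s' ⟨y, s, -, -, rfl⟩
      simp [symObjMul_act]
      exact (symActM x).comm K _ _ _
  simpa using whisker_eq ((y ⊠ s) ⊠ w) h

lemma symObjMul_comm {K : C} [ComonObj K] [IsCommComonObj K] (w s : K ⟶ symObj x) :
    (w ⊠ s) ≫ symObjMul x = (s ⊠ w) ≫ symObjMul x := by
  have h : symObjMul x = (β_ _ _).hom ≫ symObjMul x := by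
    refine symObj_rec_unique spans_symMonTop stable_symMonTop (symAct x) ?_ ?_ ?_
    · intro K _ _ w hw
      rw [symObjMul_unit, pair_braiding_assoc]
      refine SymMon.induction (P := fun w => w = _ ≫ symObjMul x) ?_ (fun y s _ _ ih => ?_) w hw
      · rw [symObjMul_unit]
      · rw [symObjMul_act, ← ih]
    · intro K _ _ w y s _
      rw [symObjMul_act]
    · intro K _ _ w y s _
      simp [act_symObjMul]
  have := whisker_eq (w ⊠ s) h
  rwa [pair_braiding_assoc] at this

instance : MonObj (symObj x) where
  one := symUnit x
  mul := symObjMul x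
  -- A point `a` of the unit object is the scalar `a` times the counit, which reduces the unit laws
  -- to the recursion at `1`.
  one_mul := (hom_ext₂ fun K _ _ a s => by
    rw [pair_whiskerRight_assoc, symObjMul_comm, pair_leftUnitor,
      show a ≫ symUnit x = scal a (ε[K] ≫ symUnit x) by
        rw [← scal_comp, scal, unitors_equal, counit_pair_rightUnitor], pair_scal, scal_comp,
      symObjMul_unit])
  mul_one := (hom_ext₂ fun K _ _ s a => by
    rw [pair_whiskerLeft_assoc, pair_rightUnitor,
      show a ≫ symUnit x = scal a (ε[K] ≫ symUnit x) by
        rw [← scal_comp, scal, unitors_equal, counit_pair_rightUnitor], pair_scal, scal_comp,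
      symObjMul_unit])
  mul_assoc := by
    refine symObj_rec_unique ((spans_top (symObj x)).purePts (spans_top (symObj x)) (stable_top _)
      (stable_top _)) ((stable_top _).purePts (stable_top _)) (symAct x) ?_ ?_ ?_
    · rintro K _ _ _ ⟨y, s, -, -, rfl⟩
      simp [symObjMul_unit]
    · rintro K _ _ _ y' s' ⟨y, s, -, -, rfl⟩
      simp [symObjMul_act]
    · rintro K _ _ _ y' s' ⟨y, s, -, -, rfl⟩
      simp [symObjMul_act]

instance : IsCommMonObj (symObj x) where
  mul_comm := (hom_ext₂ fun K _ _ s t => by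
    rw [pair_braiding_assoc]; exact symObjMul_comm t s)

variable (x) in
/-- The inclusion of the generators in the free commutative monoid. -/
def symIncl : x ⟶ symObj x := (ρ_ x).inv ≫ x ◁ symUnit x ≫ symAct x

lemma symAct_eq_mul {K : C} [ComonObj K] [IsCommComonObj K] (y : K ⟶ x) (s : K ⟶ symObj x) :
    (y ⊠ s) ≫ symAct x = (y ≫ symIncl x) * s := by
  have h : (y ≫ symIncl x) = (y ⊠ (ε[K] ≫ symUnit x)) ≫ symAct x := by simp [symIncl]
  rw [h, point_mul_def]
  change _ = _ ≫ symObjMul x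
  rw [act_symObjMul, symObjMul_comm, symObjMul_unit]

lemma comp_symUnit {K : C} [ComonObj K] [IsCommComonObj K] :
    ε[K] ≫ symUnit x = (1 : K ⟶ symObj x) := rfl

/-- A map to a commutative monoid defines a commutative action. -/
def actionOfHom {b : C} [MonObj b] [IsCommMonObj b] (f : x ⟶ b) : SymAction x b where
  act := f ▷ b ≫ μ[b]
  comm K _ _ y y' n := by
    simp only [pair_whiskerRight_assoc, pair_mul]
    ring

/-- The lift is the recursion with `W = 𝟙`, started at the unit of `b`, for the action of generators
through `f`. -/
lemma symObj_existsUnique_lift (b : C) [MonObj b] [IsCommMonObj b] (f : x ⟶ b) :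
    ∃! g : symObj x ⟶ b, IsMonHom g ∧ symIncl x ≫ g = f := by
  obtain ⟨F, hF0, hF⟩ := symObj_rec (actionOfHom f) (W := 𝟙_ C) η[b]
  have hg : ∀ (K : C) [ComonObj K] [IsCommComonObj K] (y : K ⟶ x) (s : K ⟶ symObj x),
      ((y ≫ symIncl x) * s) ≫ (λ_ _).inv ≫ F = (y ≫ f) * (s ≫ (λ_ _).inv ≫ F) := by
    intro K _ _ y s
    have := hF K ε[K] y s
    rw [symAct_eq_mul] at this
    simpa [actionOfHom, pair_mul] using this
  have hg1 : ∀ (K : C) [ComonObj K] [IsCommComonObj K],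
      (1 : K ⟶ symObj x) ≫ (λ_ _).inv ≫ F = 1 := by
    intro K _ _
    have := hF0 K ε[K]
    rw [comp_symUnit] at this
    rw [comp_leftUnitor_inv_assoc, this]
    rfl
  refine ⟨(λ_ _).inv ≫ F, ⟨⟨?_, ?_⟩, ?_⟩, ?_⟩
  · refine hom_ext₁ fun K _ _ a => ?_
    have h := congrArg (scal a) (hg1 K)
    simp only [point_one_def] at h
    rw [← scal_comp, ← scal_comp, ← scal_comp, scal, unitors_equal, counit_pair_rightUnitor] at h
    rwa [Category.assoc] at h
  · refine (spans_symMonTop.purePts (spans_top _) stable_symMonTop (stable_top _)).ext ?_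
    rintro K _ _ _ ⟨w, s, hw, -, rfl⟩
    rw [pair_mul_assoc, pair_tensorHom_assoc, pair_mul]
    refine SymMon.induction (P := fun w => (w * s) ≫ _ = (w ≫ _) * _) ?_
      (fun y t _ _ ih => ?_) w hw
    · rw [comp_symUnit, hg1, one_mul, one_mul]
    · rw [symAct_eq_mul, mul_assoc, hg, hg, ih, mul_assoc]
  · refine hom_ext₁ fun K _ _ y => ?_
    have := hg K y 1
    rw [hg1, mul_one, mul_one] at this
    rw [← this, Category.assoc]
  · rintro g ⟨hgm, hgi⟩
    refine spans_symMonTop.ext fun K _ _ w hw => ?_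
    refine SymMon.induction (P := fun w => w ≫ g = w ≫ _) ?_ (fun y t _ _ ih => ?_) w hw
    · rw [comp_symUnit, hg1, one_comp]
    · rw [symAct_eq_mul, mul_comp, hg, ih, Category.assoc, hgi]

variable (x) in
/-- The free commutative monoid. -/
def symFree : FreeCommMon x where
  obj := symObj x
  incl := symIncl x
  existsUnique_lift := symObj_existsUnique_lift

/-- The points of a free commutative monoid which are monomials in a family of points. -/
def Monomials (S : FreeCommMon x)
    (G : ∀ (K : C) [ComonObj K] [IsCommComonObj K], (K ⟶ x) → Prop)
    (K : C) [ComonObj K] [IsCommComonObj K] (z : K ⟶ S.obj) : Prop :=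
  ∃ l : List (K ⟶ x), (∀ y ∈ l, G K y) ∧ z = (l.map (· ≫ S.incl)).prod

lemma SymMon.exists_list {K : C} [ComonObj K] [IsCommComonObj K] {z : K ⟶ symObj x}
    (hz : SymMon G K z) :
    ∃ l : List (K ⟶ x), (∀ y ∈ l, G K y) ∧ z = (l.map (· ≫ symIncl x)).prod := by
  refine SymMon.induction (G := G) (P := fun z => ∃ l : List (K ⟶ x), (∀ y ∈ l, G K y) ∧
    z = (l.map (· ≫ symIncl x)).prod) ⟨[], by simp, by rw [comp_symUnit]; rfl⟩ ?_ z hz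
  rintro y _ hy _ ⟨l, hl, rfl⟩
  exact ⟨y :: l, by simpa [hy] using hl, by rw [symAct_eq_mul, List.map_cons, List.prod_cons]⟩

lemma list_prod_comp {A B : C} [MonObj A] [IsCommMonObj A] [MonObj B] [IsCommMonObj B]
    (g : A ⟶ B) [IsMonHom g] {K : C} [ComonObj K] [IsCommComonObj K] (l : List (K ⟶ A)) :
    l.prod ≫ g = (l.map (· ≫ g)).prod := by
  induction l with
  | nil => exact one_comp g
  | cons a l ih => rw [List.prod_cons, mul_comp, ih, List.map_cons, List.prod_cons]

/-- Only the universal property of `S` is given; this isomorphism transports spanning by monomials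
and the recursion principle to `S`. -/
lemma FreeCommMon.exists_iso (S : FreeCommMon x) :
    ∃ (f : S.obj ⟶ symObj x) (g : symObj x ⟶ S.obj), IsMonHom f ∧ IsMonHom g ∧
      S.incl ≫ f = symIncl x ∧ symIncl x ≫ g = S.incl ∧ f ≫ g = 𝟙 _ ∧ g ≫ f = 𝟙 _ := by
  obtain ⟨f, ⟨hf, hf'⟩, -⟩ := S.existsUnique_lift (symObj x) (symIncl x)
  obtain ⟨g, ⟨hg, hg'⟩, -⟩ := symObj_existsUnique_lift S.obj S.incl
  refine ⟨f, g, hf, hg, hf', hg', ?_, ?_⟩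
  · exact (S.existsUnique_lift S.obj S.incl).unique
      ⟨inferInstance, by rw [← Category.assoc, hf', hg']⟩ ⟨inferInstance, Category.comp_id _⟩
  · exact (symObj_existsUnique_lift (symObj x) (symIncl x)).unique
      ⟨inferInstance, by rw [← Category.assoc, hg', hf']⟩ ⟨inferInstance, Category.comp_id _⟩

lemma stable_monomials (S : FreeCommMon x) (sG : Stable G) : Stable (Monomials S G) := by
  rintro K K' _ _ _ _ r _ z ⟨l, hl, rfl⟩
  refine ⟨l.map (r ≫ ·), ?_, ?_⟩
  · simp only [List.mem_map]
    rintro _ ⟨y, hy, rfl⟩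
    exact sG _ _ _ _ (hl y hy)
  · change pull r _ = _
    rw [map_list_prod, List.map_map, List.map_map]
    congr 2
    ext y
    exact (Category.assoc _ _ _).symm

lemma spans_monomials (S : FreeCommMon x) (hG : Spans G) (sG : Stable G) :
    Spans (Monomials S G) := by
  obtain ⟨f, g, hf, hg, hfi, hgi, hfg, hgf⟩ := S.exists_iso
  intro W Y h k H
  have : IsIso g := ⟨f, hgf, hfg⟩
  rw [← cancel_epi (W ◁ g)]
  refine spans_symMon hG sG W Y _ _ fun K _ _ z hz => ?_
  obtain ⟨l, hl, rfl⟩ := hz.exists_list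
  rw [← MonoidalCategory.whiskerLeft_comp_assoc, ← MonoidalCategory.whiskerLeft_comp_assoc,
    list_prod_comp g]
  refine H K _ ⟨l, hl, ?_⟩
  rw [List.map_map]
  congr 2
  ext y
  change (y ≫ symIncl x) ≫ g = _
  rw [Category.assoc, hgi]

/-- Maps out of `W ⊗ S` into an object with a commutative action, by recursion. -/
lemma FreeCommMon.exists_rec (S : FreeCommMon x) {W N : C} (a : SymAction x N) (n0 : W ⟶ N) :
    ∃ F : W ⊗ S.obj ⟶ N,
      (∀ (K : C) [ComonObj K] [IsCommComonObj K] (w : K ⟶ W), (w ⊠ 1) ≫ F = w ≫ n0) ∧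
      ∀ (K : C) [ComonObj K] [IsCommComonObj K] (w : K ⟶ W) (y : K ⟶ x) (s : K ⟶ S.obj),
        (w ⊠ ((y ≫ S.incl) * s)) ≫ F = (y ⊠ ((w ⊠ s) ≫ F)) ≫ a.act := by
  obtain ⟨f, g, hf, hg, hfi, hgi, hfg, hgf⟩ := S.exists_iso
  obtain ⟨F, hF0, hF⟩ := symObj_rec a n0
  refine ⟨W ◁ f ≫ F, fun K _ _ w => ?_, fun K _ _ w y s => ?_⟩
  · rw [pair_whiskerLeft_assoc, one_comp, ← hF0 K w, comp_symUnit]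
  · rw [pair_whiskerLeft_assoc, mul_comp, Category.assoc, hfi, pair_whiskerLeft_assoc]
    refine Eq.trans ?_ (hF K w y (s ≫ f))
    rw [symAct_eq_mul]

end SymMonoid

/-! ### Odd operators as families of additive operators. -/

section OddOperator

open scoped ComonObj

variable {C : Type u} [Category.{v} C] [MonoidalCategory C] [SymmetricCategory C]
  [Preadditive C] [MonoidalPreadditive C] {P : ParityStructure C}

/-- The additive operator on points defined by an odd endomorphism and a point of `π`. -/
def oddOp {a K : C} [ComonObj K] (D : OddHom P a a) (θ : K ⟶ P.pi) : (K ⟶ a) →+ (K ⟶ a) :=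
  AddMonoidHom.mk' (fun s => (θ ⊠ s) ≫ D) (fun s t => by
    rw [pair_add, Preadditive.add_comp])

lemma oddOp_apply {a K : C} [ComonObj K] (D : OddHom P a a) (θ : K ⟶ P.pi) (s : K ⟶ a) :
    oddOp D θ s = (θ ⊠ s) ≫ D := rfl

/-- This is the one source of Koszul signs: the symmetry of `π` is `-id`, while pure tensors of
points commute. -/
lemma pair_pi_comm {K : C} [ComonObj K] [IsCommComonObj K] (θ θ' : K ⟶ P.pi) :
    θ ⊠ θ' = -(θ' ⊠ θ) := by
  rw [← pair_braiding θ' θ, P.braiding_pi, Preadditive.comp_neg, Category.comp_id]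

lemma oddOp_anticomm {a K : C} [ComonObj K] [IsCommComonObj K] (D : OddHom P a a)
    (θ θ' : K ⟶ P.pi) (s : K ⟶ a) :
    oddOp D θ (oddOp D θ' s) = -oddOp D θ' (oddOp D θ s) := by
  have h : ∀ θ θ' : K ⟶ P.pi, oddOp D θ (oddOp D θ' s) =
      ((θ ⊠ θ') ⊠ s) ≫ (α_ _ _ _).hom ≫ P.pi ◁ D ≫ D := fun θ θ' => by simp [oddOp_apply]
  rw [h, h, pair_pi_comm, neg_pair, Preadditive.neg_comp]

section

variable {a K : C} [MonObj a] [IsCommMonObj a] [ComonObj K] [IsCommComonObj K]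

/-- A point of a tensor power, from its first component and the remaining ones. -/
def consPt {m : ℕ} (x : K ⟶ a) (y : K ⟶ tensorPow a m) : K ⟶ tensorPow a (m + 1) :=
  show K ⟶ a ⊗ tensorPow a m from x ⊠ y

/-- A point of the zeroth tensor power. -/
def singlePt (x : K ⟶ a) : K ⟶ tensorPow a 0 := x

lemma pair_oddT (m : ℕ) (f : OddHom P (tensorPow a m) a) (θ : K ⟶ P.pi) (x : K ⟶ a)
    (y : K ⟶ tensorPow a m) :
    (θ ⊠ consPt x y) ≫ oddT P a m f =
      (θ ⊠ ((x ⊠ y) ≫ mulLast a m)) ≫ f - x * ((θ ⊠ y) ≫ f) := by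
  change (θ ⊠ (x ⊠ y)) ≫ (P.pi ◁ mulLast a m ≫ f - oddWhiskerLeft P a f ≫ μ[a]) = _
  simp [oddWhiskerLeft, point_mul_def]

lemma pair_mulLast (m : ℕ) (x y : K ⟶ a) (z : K ⟶ tensorPow a m) :
    (x ⊠ consPt y z) ≫ mulLast a (m + 1) = consPt y ((x ⊠ z) ≫ mulLast a m) := by
  change (x ⊠ (y ⊠ z)) ≫ ((α_ a a (tensorPow a m)).inv ≫ (β_ a a).hom ▷ tensorPow a m ≫
      (α_ a a (tensorPow a m)).hom ≫ a ◁ mulLast a m) = y ⊠ ((x ⊠ z) ≫ mulLast a m)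
  simp

lemma pair_mulLast_zero (x y : K ⟶ a) :
    (x ⊠ singlePt y) ≫ mulLast a 0 = singlePt (x * y) := rfl

/-- At points, each application of `T` is a commutator with multiplication by the new variable. This
links the categorical order to `DiffOpOn`. -/
lemma pair_oddTIter_three (D : OddHom P a a) (θ : K ⟶ P.pi) (f g h k : K ⟶ a) :
    (θ ⊠ consPt f (consPt g (consPt h (singlePt k)))) ≫ oddTIter P a D 3 =
      adj (adj (adj (oddOp D θ) h) g) f k := by
  have h0 : ∀ k : K ⟶ a, (θ ⊠ singlePt k) ≫ oddTIter P a D 0 = oddOp D θ k := fun k => rfl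
  rw [show oddTIter P a D 3 = oddT P a 2 (oddT P a 1 (oddT P a 0 (oddTIter P a D 0))) from rfl]
  simp only [pair_oddT, pair_mulLast, pair_mulLast_zero, adj_apply, h0]

lemma IsOddDiffOp.diffOpOn {D : OddHom P a a} (hD : IsOddDiffOp P a 2 D) (θ : K ⟶ P.pi) :
    DiffOpOn Set.univ 3 (oddOp D θ) := by
  intro h _ g _ f _
  change _ = _
  ext k
  rw [← pair_oddTIter_three, show oddTIter P a D 3 = 0 from hD]
  exact comp_zero

end

/-- Since `T³ D` is a morphism out of a tensor power, it may be tested on pure tensors of a spanning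
family. -/
lemma isOddDiffOp_of_diffOpOn {a : C} [MonObj a] [IsCommMonObj a] [HasBinaryBiproducts C]
    {H : ∀ (K : C) [ComonObj K] [IsCommComonObj K], (K ⟶ a) → Prop} (hH : Spans H)
    (sH : Stable H) {D : OddHom P a a}
    (h : ∀ (K : C) [ComonObj K] [IsCommComonObj K] (θ : K ⟶ P.pi),
      DiffOpOn {z | H K z} 3 (oddOp D θ)) : IsOddDiffOp P a 2 D := by
  have s2 := sH.purePts sH
  have s3 := sH.purePts s2
  have s4 := sH.purePts s3
  have h2 := hH.purePts hH sH sH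
  have h3 := hH.purePts h2 sH s2
  have h4 := hH.purePts h3 sH s3
  refine ((spans_top P.pi).purePts h4 (stable_top _) s4).ext ?_
  rintro K _ _ _ ⟨θ, _, -, ⟨f, _, hf, ⟨g, _, hg, ⟨b, k, hb, hk, rfl⟩, rfl⟩, rfl⟩, rfl⟩
  refine (pair_oddTIter_three D θ f g b k).trans ?_
  rw [show adj (adj (adj (oddOp D θ) b) g) f = 0 from h K θ b hb g hg f hf]
  exact comp_zero.symm

end OddOperator

/-! ### Integrating a symmetric form to an operator of order two. -/

section Extension

open scoped ComonObj

variable {C : Type u} [Category.{v} C] [MonoidalCategory C] [SymmetricCategory C]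
  [Preadditive C] [MonoidalPreadditive C] [HasBinaryBiproducts C]
  [HasColimitsOfSize.{0, 0} C] [∀ x : C, PreservesColimitsOfSize.{0, 0} (tensorLeft x)]
  {x : C} (S : FreeCommMon x)

variable {S} in
lemma Monomials.mem_closure {K : C} [ComonObj K] [IsCommComonObj K]
    {G : ∀ (K : C) [ComonObj K] [IsCommComonObj K], (K ⟶ x) → Prop} {z : K ⟶ S.obj}
    (hz : Monomials S G K z) :
    z ∈ Submonoid.closure (Set.range fun y : K ⟶ x => y ≫ S.incl) := by
  obtain ⟨l, -, rfl⟩ := hz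
  refine Submonoid.list_prod_mem _ ?_
  simp only [List.mem_map]
  rintro _ ⟨y, -, rfl⟩
  exact Submonoid.subset_closure ⟨y, rfl⟩

/-- The product with a generator. -/
def genMul : x ⊗ S.obj ⟶ S.obj := S.incl ▷ S.obj ≫ μ[S.obj]

@[simp] lemma pair_genMul {K : C} [ComonObj K] [IsCommComonObj K] (y : K ⟶ x) (s : K ⟶ S.obj) :
    (y ⊠ s) ≫ genMul S = (y ≫ S.incl) * s := by
  simp [genMul, point_mul_def]

/-- The commutative action of generators on `S ⊞ (W ⊗ S)` twisted by a cocycle. -/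
def twistedAction {W : C} {H : ∀ (K : C) [ComonObj K] [IsCommComonObj K], (K ⟶ W) → Prop}
    (hH : Spans H) (sH : Stable H) (c : x ⊗ W ⊗ S.obj ⟶ S.obj)
    (hc : ∀ (K : C) [ComonObj K] [IsCommComonObj K] (y y' : K ⟶ x) (w : K ⟶ W) (s : K ⟶ S.obj),
      H K w → (y ≫ S.incl) * ((y' ⊠ (w ⊠ s)) ≫ c) + (y ⊠ (w ⊠ ((y' ≫ S.incl) * s))) ≫ c =
      (y' ≫ S.incl) * ((y ⊠ (w ⊠ s)) ≫ c) + (y' ⊠ (w ⊠ ((y ≫ S.incl) * s))) ≫ c) :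
    SymAction x (S.obj ⊞ (W ⊗ S.obj)) where
  act := biprod.lift (x ◁ biprod.fst ≫ genMul S + x ◁ biprod.snd ≫ c)
    (x ◁ biprod.snd ≫ exch x W S.obj ≫ W ◁ genMul S)
  comm K _ _ y y' n := by
    have sHS := sH.purePts (stable_top S.obj)
    have hHS := hH.purePts (spans_top S.obj) sH (stable_top _)
    have hxHS := (spans_top x).purePts hHS (stable_top x) sHS
    have hxx := (spans_top x).purePts hxHS (stable_top x) ((stable_top x).purePts sHS)
    -- The hypothesis `hc` concerns pure tensors; here it becomes an equation of morphisms, valid at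
    -- every point of `W ⊗ S`.
    have h : x ◁ c ≫ genMul S + x ◁ (exch x W S.obj ≫ W ◁ genMul S) ≫ c = exch x x _ ≫
        (x ◁ c ≫ genMul S + x ◁ (exch x W S.obj ≫ W ◁ genMul S) ≫ c) := by
      refine hxx.ext ?_
      rintro K _ _ _ ⟨y, _, -, ⟨y', _, -, ⟨w, s, hw, -, rfl⟩, rfl⟩, rfl⟩
      simpa using hc K y y' w s hw
    have h' : x ◁ (exch x W S.obj ≫ W ◁ genMul S) ≫ (exch x W S.obj ≫ W ◁ genMul S) =
        exch x x _ ≫ x ◁ (exch x W S.obj ≫ W ◁ genMul S) ≫ (exch x W S.obj ≫ W ◁ genMul S) := by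
      refine hom_ext₄ fun K _ _ y y' w s => ?_
      simp [mul_left_comm]
    have e := whisker_eq (y ⊠ (y' ⊠ (n ≫ biprod.snd))) h
    have e' := whisker_eq (y ⊠ (y' ⊠ (n ≫ biprod.snd))) h'
    simp at e e'
    apply biprod.hom_ext
    · simp
      linear_combination e
    · simpa using e'

/-- The operator determined by a cocycle. -/
lemma exists_of_cocycle {W : C} {H : ∀ (K : C) [ComonObj K] [IsCommComonObj K], (K ⟶ W) → Prop}
    (hH : Spans H) (sH : Stable H) (c : x ⊗ W ⊗ S.obj ⟶ S.obj)
    (hc : ∀ (K : C) [ComonObj K] [IsCommComonObj K] (y y' : K ⟶ x) (w : K ⟶ W) (s : K ⟶ S.obj),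
      H K w → (y ≫ S.incl) * ((y' ⊠ (w ⊠ s)) ≫ c) + (y ⊠ (w ⊠ ((y' ≫ S.incl) * s))) ≫ c =
      (y' ≫ S.incl) * ((y ⊠ (w ⊠ s)) ≫ c) + (y' ⊠ (w ⊠ ((y ≫ S.incl) * s))) ≫ c) :
    ∃ D : W ⊗ S.obj ⟶ S.obj,
      (∀ (K : C) [ComonObj K] [IsCommComonObj K] (w : K ⟶ W), (w ⊠ 1) ≫ D = 0) ∧
      ∀ (K : C) [ComonObj K] [IsCommComonObj K] (w : K ⟶ W) (y : K ⟶ x) (s : K ⟶ S.obj),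
        (w ⊠ ((y ≫ S.incl) * s)) ≫ D =
          (y ≫ S.incl) * ((w ⊠ s) ≫ D) + (y ⊠ (w ⊠ s)) ≫ c := by
  -- A generator acts by `y · (u, w ⊗ s) = (y u + c(y, w, s), w ⊗ y s)`. Started at `(0, w ⊗ 1)`,
  -- the recursion yields `F (w, s) = (D (w, s), w ⊗ s)`; `hs` verifies the second component.
  obtain ⟨F, hF0, hF⟩ := S.exists_rec (twistedAction S hH sH c hc)
    (biprod.lift 0 ((ρ_ W).inv ≫ W ◁ η[S.obj]))
  have hs : F ≫ biprod.snd = 𝟙 _ := by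
    refine ((spans_top W).purePts (spans_monomials S (spans_top x) (stable_top x)) (stable_top W)
      (stable_monomials S (stable_top x))).ext ?_
    rintro K _ _ _ ⟨w, _, -, ⟨l, -, rfl⟩, rfl⟩
    induction l with
    | nil =>
      rw [List.map_nil, List.prod_nil, ← Category.assoc, hF0]
      simp [point_one_def]
    | cons y l ih =>
      rw [List.map_cons, List.prod_cons, ← Category.assoc, hF]
      rw [Category.comp_id] at ih ⊢
      simp [twistedAction, ih]
  refine ⟨F ≫ biprod.fst, fun K _ _ w => ?_, fun K _ _ w y s => ?_⟩
  · rw [← Category.assoc, hF0]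
    simp
  · have hws : (w ⊠ s) ≫ F ≫ biprod.snd = w ⊠ s := by rw [hs, Category.comp_id]
    rw [← Category.assoc, hF]
    simp [twistedAction, hws]

variable {S} {P : ParityStructure C}

/-- The operator is found by integrating twice: prescribe `[d_y, y'] = φ(y, y')` to get `d`, then
`[D, y] = d_y` to get `D`. -/
lemma exists_oddDiffOp (φ : P.pi ⊗ x ⊗ x ⟶ S.obj)
    (hφ : ∀ (K : C) [ComonObj K] [IsCommComonObj K] (θ : K ⟶ P.pi) (y y' : K ⟶ x),
      (θ ⊠ (y ⊠ y')) ≫ φ = (θ ⊠ (y' ⊠ y)) ≫ φ) :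
    ∃ D : OddHom P S.obj S.obj, IsOddDiffOp P S.obj 2 D ∧ P.pi ◁ η[S.obj] ≫ D = 0 ∧
      P.pi ◁ S.incl ≫ D = 0 ∧ P.pi ◁ ((S.incl ⊗ₘ S.incl) ≫ μ[S.obj]) ≫ D = φ := by
  let c : x ⊗ (P.pi ⊗ x) ⊗ S.obj ⟶ S.obj :=
    (α_ _ _ _).inv ≫ ((β_ _ _).hom ≫ (α_ _ _ _).hom ≫ φ) ▷ S.obj ≫ μ[S.obj]
  have hc : ∀ (K : C) [ComonObj K] [IsCommComonObj K] (θ : K ⟶ P.pi) (y y' : K ⟶ x)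
      (s : K ⟶ S.obj), (y' ⊠ ((θ ⊠ y) ⊠ s)) ≫ c = ((θ ⊠ (y ⊠ y')) ≫ φ) * s := by
    intro K _ _ θ y y' s
    simp [c, point_mul_def]
  have sW := (stable_top P.pi).purePts (stable_top x)
  have hW := (spans_top P.pi).purePts (spans_top x) (stable_top _) (stable_top _)
  -- Here `W = π ⊗ x`, so `d` is a derivation depending on `θ` and on a generator.
  obtain ⟨d, hd1, hd⟩ := exists_of_cocycle S hW sW c (by
    rintro K _ _ y y' _ s ⟨θ, z, -, -, rfl⟩
    rw [hc, hc, hc, hc]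
    ring)
  -- Now `W = π` and `d` is the cocycle. Its cocycle identity is the symmetry of `φ`.
  obtain ⟨D, hD1, hD⟩ := exists_of_cocycle S (spans_top _) (stable_top _)
    ((α_ _ _ _).inv ≫ (β_ _ _).hom ▷ S.obj ≫ d : x ⊗ P.pi ⊗ S.obj ⟶ S.obj)
    (fun K _ _ y y' θ s _ => by
      simp [hd, hc, hφ K θ y y']
      ring)
  have hX : ∀ (K : C) [ComonObj K] [IsCommComonObj K] (θ : K ⟶ P.pi) (y : K ⟶ x),
      (θ ⊠ (y ≫ S.incl)) ≫ D = 0 := fun K _ _ θ y => by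
    have := hD K θ y 1
    rw [mul_one, hD1, mul_zero, zero_add] at this
    rw [this]
    simp [hd1]
  refine ⟨D, ?_, ?_, ?_, ?_⟩
  · refine isOddDiffOp_of_diffOpOn (spans_monomials S (spans_top x) (stable_top x))
      (stable_monomials S (stable_top x)) fun K _ _ θ => ?_
    have h : DiffOpOn (Set.range fun y : K ⟶ x => y ≫ S.incl) 3 (oddOp D θ) := by
      rintro _ ⟨y, rfl⟩ _ ⟨y', rfl⟩ _ ⟨y'', rfl⟩
      change _ = _
      ext s
      simp [oddOp_apply, hD, hd, hc]
      ring
    have hm : ∀ f : K ⟶ S.obj, Monomials S (fun _ _ _ _ => True) K f →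
        f ∈ Submonoid.closure (Set.range fun y : K ⟶ x => y ≫ S.incl) :=
      fun f hf => hf.mem_closure
    exact fun f hf g hg k hk => h.closure f (hm f hf) g (hm g hg) k (hm k hk)
  · refine hom_ext₂ fun K _ _ θ s => ?_
    have h := congrArg (scal s) (hD1 K θ)
    rw [pair_whiskerLeft_assoc, comp_zero]
    rw [← scal_comp, ← pair_scal, point_one_def, ← scal_comp] at h
    rw [show scal s ε[K] = s by rw [scal, unitors_equal, counit_pair_rightUnitor]] at h
    rw [h]
    simp [scal]
  · refine hom_ext₂ fun K _ _ θ y => ?_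
    rw [pair_whiskerLeft_assoc, hX, comp_zero]
  · refine hom_ext₃ fun K _ _ θ y y' => ?_
    rw [pair_whiskerLeft_assoc, pair_tensorHom_assoc, pair_mul, hD, hX]
    have := hd K (θ ⊠ y) y' 1
    rw [mul_one, hd1, mul_zero, zero_add, hc, mul_one] at this
    simp [this]

end Extension

/-! ### Whiskered odd maps at points. -/

section Odd

variable {C : Type u} [Category.{v} C] [MonoidalCategory C] [SymmetricCategory C]
  {K : C} [ComonObj K] [IsCommComonObj K] [Preadditive C] {P : ParityStructure C}

@[simp] lemma pair_oddWhiskerRight {x x' y : C} (f : OddHom P x x') (θ : K ⟶ P.pi) (p : K ⟶ x)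
    (q : K ⟶ y) : (θ ⊠ (p ⊠ q)) ≫ oddWhiskerRight P f y = ((θ ⊠ p) ≫ f) ⊠ q := by
  simp [oddWhiskerRight]

@[simp] lemma pair_oddWhiskerLeft {x y y' : C} (f : OddHom P y y') (θ : K ⟶ P.pi) (p : K ⟶ x)
    (q : K ⟶ y) : (θ ⊠ (p ⊠ q)) ≫ oddWhiskerLeft P x f = p ⊠ ((θ ⊠ q) ≫ f) := by
  simp [oddWhiskerLeft]

@[simp] lemma pair_oddWhiskerRight_assoc {x x' y Z : C} (f : OddHom P x x') (θ : K ⟶ P.pi)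
    (p : K ⟶ x) (q : K ⟶ y) (h : x' ⊗ y ⟶ Z) :
    (θ ⊠ (p ⊠ q)) ≫ oddWhiskerRight P f y ≫ h = (((θ ⊠ p) ≫ f) ⊠ q) ≫ h := by
  rw [← pair_oddWhiskerRight, Category.assoc]

@[simp] lemma pair_oddWhiskerLeft_assoc {x y y' Z : C} (f : OddHom P y y') (θ : K ⟶ P.pi)
    (p : K ⟶ x) (q : K ⟶ y) (h : x ⊗ y' ⟶ Z) :
    (θ ⊠ (p ⊠ q)) ≫ oddWhiskerLeft P x f ≫ h = (p ⊠ ((θ ⊠ q) ≫ f)) ≫ h := by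
  rw [← pair_oddWhiskerLeft, Category.assoc]

end Odd

/-! ### Descent to the coequalisers, and extension from generators. -/

section Descent

open scoped ComonObj

variable {C : Type u} [Category.{v} C] [MonoidalCategory C] [SymmetricCategory C]
  [Preadditive C] [MonoidalPreadditive C] [HasBinaryBiproducts C]
  [HasColimits C] [∀ x : C, PreservesColimitsOfSize.{0, 0} (tensorLeft x)]
  {P : ParityStructure C} {V : Type w} {E : Type w'} [Finite E] {s t : E → V}
  {c : V → C} [∀ i, HasRightDual (c i)] {J : ∀ i, OddHom P (c i) (c i)}

variable (P J) in
/-- The projection `h_a^∨ ⟶ h̃_a^∨`. -/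
def toTildeAt (a : E ⊕ E) : hDual s t c a ⟶ hTildeDualAt P s t c J a :=
  coequalizer.π _ _

variable (P s t c J) in
/-- The inclusion `h̃_a^∨ ⟶ h̃^∨`. -/
def tildeIncl (a : E ⊕ E) : hTildeDualAt P s t c J a ⟶ hTildeDual P s t c J :=
  haveI : HasFiniteCoproducts C := ⟨fun _ => inferInstance⟩
  Sigma.ι (fun a : E ⊕ E => hTildeDualAt P s t c J a) a

lemma toTilde_eq (a : E ⊕ E) :
    toTilde P s t c J a = toTildeAt P J a ≫ tildeIncl P s t c J a := rfl

lemma toTildeAt_condition (a : E ⊕ E) :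
    oddWhiskerRight P (J (src s t a)) (c (tgt s t a))ᘁ ≫ toTildeAt P J a =
      oddWhiskerLeft P (c (src s t a)) (oddDual P (c (tgt s t a)) (J (tgt s t a))) ≫
        toTildeAt P J a :=
  coequalizer.condition _ _

lemma toTilde_condition (a : E ⊕ E) :
    oddWhiskerRight P (J (src s t a)) (c (tgt s t a))ᘁ ≫ toTilde P s t c J a =
      oddWhiskerLeft P (c (src s t a)) (oddDual P (c (tgt s t a)) (J (tgt s t a))) ≫
        toTilde P s t c J a := by
  rw [toTilde_eq, ← Category.assoc, toTildeAt_condition, Category.assoc]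

lemma pair_toTilde (a : E ⊕ E) {K : C} [ComonObj K] [IsCommComonObj K] (θ : K ⟶ P.pi)
    (p : K ⟶ c (src s t a)) (q : K ⟶ (c (tgt s t a))ᘁ) :
    (((θ ⊠ p) ≫ J (src s t a)) ⊠ q) ≫ toTilde P s t c J a =
      (p ⊠ ((θ ⊠ q) ≫ oddDual P (c (tgt s t a)) (J (tgt s t a)))) ≫ toTilde P s t c J a := by
  have := whisker_eq (θ ⊠ (p ⊠ q)) (toTilde_condition (P := P) (J := J) a)
  simpa using this

/-- The arrows may live in any universe, so the finite index type is replaced by `Fin n`. -/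
lemma preservesColimitsOfShape_discrete_finite {D : Type*} [Category D] (F : C ⥤ D)
    [PreservesColimitsOfSize.{0, 0} F] (I : Type*) [Finite I] :
    PreservesColimitsOfShape (Discrete I) F := by
  obtain ⟨n, ⟨e⟩⟩ := Finite.exists_equiv_fin I
  exact preservesColimitsOfShape_of_equiv (Discrete.equivalence e.symm) F

lemma epi_whiskerLeft_toTildeAt (W : C) (a : E ⊕ E) : Epi (W ◁ toTildeAt P J (s := s) (t := t) a) :=
  epi_map_coequalizer (tensorLeft W)
    (oddWhiskerRight P (J (src s t a)) (c (tgt s t a))ᘁ)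
    (oddWhiskerLeft P (c (src s t a)) (oddDual P (c (tgt s t a)) (J (tgt s t a))))

lemma tildeIncl_hom_ext {W Y : C} {f g : W ⊗ hTildeDual P s t c J ⟶ Y}
    (h : ∀ a, W ◁ tildeIncl P s t c J a ≫ f = W ◁ tildeIncl P s t c J a ≫ g) : f = g :=
  haveI : HasFiniteCoproducts C := ⟨fun _ => inferInstance⟩
  haveI := preservesColimitsOfShape_discrete_finite (tensorLeft W) (E ⊕ E)
  map_sigma_hom_ext (tensorLeft W) (fun a : E ⊕ E => hTildeDualAt P s t c J a) h

lemma toTilde_hom_ext {W Y : C} {f g : W ⊗ hTildeDual P s t c J ⟶ Y}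
    (h : ∀ a, W ◁ toTilde P s t c J a ≫ f = W ◁ toTilde P s t c J a ≫ g) : f = g := by
  refine tildeIncl_hom_ext fun a => ?_
  have := epi_whiskerLeft_toTildeAt (P := P) (J := J) (s := s) (t := t) W a
  refine this.left_cancellation _ _ ?_
  simpa only [toTilde_eq, MonoidalCategory.whiskerLeft_comp, Category.assoc] using h a

lemma exists_toTildeAt_desc {W Y : C} (a : E ⊕ E) (k : W ⊗ hDual s t c a ⟶ Y)
    (h : W ◁ oddWhiskerRight P (J (src s t a)) (c (tgt s t a))ᘁ ≫ k =
      W ◁ oddWhiskerLeft P (c (src s t a)) (oddDual P (c (tgt s t a)) (J (tgt s t a))) ≫ k) :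
    ∃ l : W ⊗ hTildeDualAt P s t c J a ⟶ Y, W ◁ toTildeAt P J a ≫ l = k :=
  exists_map_coequalizer_desc (tensorLeft W) _ _ k h

lemma exists_tildeIncl_desc {W Y : C} (k : ∀ a, W ⊗ hTildeDualAt P s t c J a ⟶ Y) :
    ∃ l : W ⊗ hTildeDual P s t c J ⟶ Y, ∀ a, W ◁ tildeIncl P s t c J a ≫ l = k a :=
  haveI : HasFiniteCoproducts C := ⟨fun _ => inferInstance⟩
  haveI := preservesColimitsOfShape_discrete_finite (tensorLeft W) (E ⊕ E)
  exists_map_sigma_desc (tensorLeft W) (fun a : E ⊕ E => hTildeDualAt P s t c J a) k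

lemma exists_toTilde_desc {W Y : C} (k : ∀ a, W ⊗ hDual s t c a ⟶ Y)
    (h : ∀ a, W ◁ oddWhiskerRight P (J (src s t a)) (c (tgt s t a))ᘁ ≫ k a =
      W ◁ oddWhiskerLeft P (c (src s t a)) (oddDual P (c (tgt s t a)) (J (tgt s t a))) ≫ k a) :
    ∃ l : W ⊗ hTildeDual P s t c J ⟶ Y, ∀ a, W ◁ toTilde P s t c J a ≫ l = k a := by
  choose l hl using fun a => exists_toTildeAt_desc a (k a) (h a)
  obtain ⟨m, hm⟩ := exists_tildeIncl_desc l
  exact ⟨m, fun a => by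
    rw [toTilde_eq, MonoidalCategory.whiskerLeft_comp, Category.assoc, hm, hl]⟩

variable (P s t c J) in
/-- The points of `h̃^∨` which come from pairs of a vector and a covector. -/
def PureGen (K : C) [ComonObj K] [IsCommComonObj K] (z : K ⟶ hTildeDual P s t c J) : Prop :=
  ∃ (a : E ⊕ E) (p : K ⟶ c (src s t a)) (q : K ⟶ (c (tgt s t a))ᘁ),
    z = (p ⊠ q) ≫ toTilde P s t c J a

lemma stable_pureGen : Stable (PureGen P s t c J) := by
  rintro K K' _ _ _ _ r _ z ⟨a, p, q, rfl⟩
  exact ⟨a, r ≫ p, r ≫ q, by rw [comp_pair_assoc]⟩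

lemma spans_pureGen : Spans (PureGen P s t c J) := by
  intro W Y f g h
  refine toTilde_hom_ext fun a => ?_
  refine ((spans_top (c (src s t a))).purePts (spans_top (c (tgt s t a))ᘁ) (stable_top _)
    (stable_top _)) W Y _ _ ?_
  rintro K _ _ _ ⟨p, q, -, -, rfl⟩
  rw [← MonoidalCategory.whiskerLeft_comp_assoc, ← MonoidalCategory.whiskerLeft_comp_assoc]
  exact h K _ ⟨a, p, q, rfl⟩

/-- Compatibility of a family of odd maps with the relations of `h̃^∨` in the first argument. -/
def FirstDescends {Y : C} (φ : ∀ a b : E ⊕ E, OddHom P (hDual s t c a ⊗ hDual s t c b) Y)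
    (J : ∀ i, OddHom P (c i) (c i)) : Prop :=
  ∀ (a b : E ⊕ E) (K : C) [ComonObj K] [IsCommComonObj K] (θ θ' : K ⟶ P.pi)
    (p : K ⟶ c (src s t a)) (q : K ⟶ (c (tgt s t a))ᘁ)
    (p' : K ⟶ c (src s t b)) (q' : K ⟶ (c (tgt s t b))ᘁ),
    (θ ⊠ ((((θ' ⊠ p) ≫ J (src s t a)) ⊠ q) ⊠ (p' ⊠ q'))) ≫ φ a b =
      (θ ⊠ ((p ⊠ ((θ' ⊠ q) ≫ oddDual P (c (tgt s t a)) (J (tgt s t a)))) ⊠ (p' ⊠ q'))) ≫ φ a b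

/-- Symmetry of a family of odd maps. -/
def IsSymmFamily {Y : C} (φ : ∀ a b : E ⊕ E, OddHom P (hDual s t c a ⊗ hDual s t c b) Y) : Prop :=
  ∀ (a b : E ⊕ E) (K : C) [ComonObj K] [IsCommComonObj K] (θ : K ⟶ P.pi)
    (p : K ⟶ c (src s t a)) (q : K ⟶ (c (tgt s t a))ᘁ)
    (p' : K ⟶ c (src s t b)) (q' : K ⟶ (c (tgt s t b))ᘁ),
    (θ ⊠ ((p ⊠ q) ⊠ (p' ⊠ q'))) ≫ φ a b = (θ ⊠ ((p' ⊠ q') ⊠ (p ⊠ q))) ≫ φ b a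

lemma spans_hDual (a : E ⊕ E) : Spans (PurePts (X := c (src s t a)) (Y := (c (tgt s t a))ᘁ)
    (fun _ _ _ _ => True) (fun _ _ _ _ => True)) :=
  (spans_top _).purePts (spans_top _) (stable_top _) (stable_top _)

lemma stable_hDual (a : E ⊕ E) : Stable (PurePts (X := c (src s t a)) (Y := (c (tgt s t a))ᘁ)
    (fun _ _ _ _ => True) (fun _ _ _ _ => True)) :=
  (stable_top _).purePts (stable_top _)

/-- The second argument descends first, then the first; symmetry turns the given relation in the
first argument into one in the second. -/
lemma exists_tilde_bilinear {Y : C}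
    (φ : ∀ a b : E ⊕ E, OddHom P (hDual s t c a ⊗ hDual s t c b) Y)
    (h1 : FirstDescends φ J) (hs : IsSymmFamily φ) :
    ∃ ψ : P.pi ⊗ hTildeDual P s t c J ⊗ hTildeDual P s t c J ⟶ Y,
      ∀ a b, P.pi ◁ (toTilde P s t c J a ⊗ₘ toTilde P s t c J b) ≫ ψ = φ a b := by
  have step : ∀ a, ∃ l : (P.pi ⊗ hDual s t c a) ⊗ hTildeDual P s t c J ⟶ Y,
      ∀ b, (P.pi ⊗ hDual s t c a) ◁ toTilde P s t c J b ≫ l =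
        (α_ _ _ _).hom ≫ φ a b := by
    intro a
    refine exists_toTilde_desc _ fun b => ?_
    refine ((((spans_top P.pi).purePts (spans_hDual a) (stable_top _) (stable_hDual a)).purePts
      ((spans_top P.pi).purePts (spans_hDual b) (stable_top _) (stable_hDual b))
      ((stable_top _).purePts (stable_hDual a)) ((stable_top _).purePts (stable_hDual b)))).ext ?_
    rintro K _ _ _ ⟨_, _, ⟨θ, _, -, ⟨p, q, -, -, rfl⟩, rfl⟩, ⟨θ', _, -, ⟨p', q', -, -, rfl⟩, rfl⟩,
      rfl⟩
    rw [pair_whiskerLeft_assoc, pair_whiskerLeft_assoc, pair_associator_assoc,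
      pair_associator_assoc, pair_oddWhiskerLeft, pair_oddWhiskerRight, hs a b, hs a b K θ p q p', h1]
  choose l hl using step
  have step2 : ∃ m : (P.pi ⊗ hTildeDual P s t c J) ⊗ hTildeDual P s t c J ⟶ Y,
      ∀ a, (P.pi ⊗ hTildeDual P s t c J) ◁ toTilde P s t c J a ≫ m =
        (α_ _ _ _).hom ≫ P.pi ◁ (β_ _ _).hom ≫ (α_ _ _ _).inv ≫ l a := by
    refine exists_toTilde_desc _ fun a => ?_
    refine (((spans_top P.pi).purePts (spans_pureGen (P := P) (J := J)) (stable_top _)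
      stable_pureGen).purePts
      ((spans_top P.pi).purePts (spans_hDual a) (stable_top _) (stable_hDual a))
      ((stable_top _).purePts stable_pureGen) ((stable_top _).purePts (stable_hDual a))).ext ?_
    rintro K _ _ _ ⟨_, _, ⟨θ, _, -, ⟨b, p', q', rfl⟩, rfl⟩, ⟨θ', _, -, ⟨p, q, -, -, rfl⟩, rfl⟩,
      rfl⟩
    have key : ∀ z : K ⟶ hDual s t c a, (((θ ⊠ z) ⊠ ((p' ⊠ q') ≫ toTilde P s t c J b)) ≫ l a) =
        (θ ⊠ (z ⊠ (p' ⊠ q'))) ≫ φ a b := fun z => by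
      rw [← pair_whiskerLeft_assoc, hl, pair_associator_assoc]
    simp only [pair_whiskerLeft_assoc, pair_associator_assoc, pair_braiding,
      pair_associator_inv_assoc, pair_oddWhiskerLeft, pair_oddWhiskerRight, key, h1 a b]
  obtain ⟨m, hm⟩ := step2
  refine ⟨P.pi ◁ (β_ _ _).hom ≫ (α_ _ _ _).inv ≫ m, fun a b => ?_⟩
  refine ((spans_top P.pi).purePts ((spans_hDual a).purePts (spans_hDual b) (stable_hDual a)
    (stable_hDual b)) (stable_top _) ((stable_hDual a).purePts (stable_hDual b))).ext ?_
  rintro K _ _ _ ⟨θ, _, -, ⟨_, _, ⟨p, q, -, -, rfl⟩, ⟨p', q', -, -, rfl⟩, rfl⟩, rfl⟩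
  have key2 : ∀ (z : K ⟶ hTildeDual P s t c J),
      ((θ ⊠ z) ⊠ ((p ⊠ q) ≫ toTilde P s t c J a)) ≫ m =
        ((θ ⊠ (p ⊠ q)) ⊠ z) ≫ l a := fun z => by
    rw [← pair_whiskerLeft_assoc, hm]
    simp
  simp only [pair_whiskerLeft_assoc, pair_tensorHom, pair_braiding, pair_associator_inv_assoc, key2]
  rw [← pair_whiskerLeft_assoc, hl, pair_associator_assoc]

variable {S : FreeCommMon (hTildeDual P s t c J)}

lemma exists_isExtension (φ : ∀ a b : E ⊕ E, OddHom P (hDual s t c a ⊗ hDual s t c b) S.obj)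
    (h1 : FirstDescends φ J) (hs : IsSymmFamily φ) : ∃ D, IsExtension S φ D := by
  obtain ⟨ψ, hψ⟩ := exists_tilde_bilinear φ h1 hs
  have sG := stable_pureGen (P := P) (s := s) (t := t) (c := c) (J := J)
  have hG := spans_pureGen (P := P) (s := s) (t := t) (c := c) (J := J)
  -- Symmetry need only be checked on points coming from vectors and covectors, where it is `hs`.
  have hψs : ψ = P.pi ◁ (β_ _ _).hom ≫ ψ := by
    refine ((spans_top P.pi).purePts (hG.purePts hG sG sG) (stable_top _) (sG.purePts sG)).ext ?_
    rintro K _ _ _ ⟨θ, _, -, ⟨_, _, ⟨a, p, q, rfl⟩, ⟨b, p', q', rfl⟩, rfl⟩, rfl⟩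
    have key : ∀ a b (x : K ⟶ hDual s t c a) (y : K ⟶ hDual s t c b),
        (θ ⊠ ((x ≫ toTilde P s t c J a) ⊠ (y ≫ toTilde P s t c J b))) ≫ ψ =
        (θ ⊠ (x ⊠ y)) ≫ φ a b := fun a b x y => by
      rw [← hψ, pair_whiskerLeft_assoc, pair_tensorHom]
    rw [pair_whiskerLeft_assoc, pair_braiding, key, key, hs]
  obtain ⟨D, hD, hD0, hD1, hD2⟩ := exists_oddDiffOp (S := S) (P := P) ψ (fun K _ _ θ y y' => by
    conv_lhs => rw [hψs]
    simp)
  refine ⟨D, hD, hD0, hD1, fun a b => ?_⟩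
  rw [← hψ, ← hD2, ← MonoidalCategory.whiskerLeft_comp_assoc, tensorHom_comp_tensorHom_assoc]
  rfl

namespace IsExtension

variable {φ : ∀ a b : E ⊕ E, OddHom P (hDual s t c a ⊗ hDual s t c b) S.obj}
  {D D' : OddHom P S.obj S.obj} {K : C} [ComonObj K] [IsCommComonObj K]

lemma oddOp_one (h : IsExtension S φ D) (θ : K ⟶ P.pi) : oddOp D θ 1 = 0 := by
  have := whisker_eq (θ ⊠ ε[K]) (h.on_zero)
  rw [pair_whiskerLeft_assoc, comp_zero] at this
  exact this

lemma oddOp_incl (h : IsExtension S φ D) (θ : K ⟶ P.pi) (y : K ⟶ hTildeDual P s t c J) :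
    oddOp D θ (y ≫ S.incl) = 0 := by
  have := whisker_eq (θ ⊠ y) (h.on_one)
  rw [pair_whiskerLeft_assoc, comp_zero] at this
  exact this

lemma oddOp_gen (h : IsExtension S φ D) (θ : K ⟶ P.pi) {a : E ⊕ E} (y : K ⟶ hDual s t c a) :
    oddOp D θ (y ≫ gen S a) = 0 := by
  rw [gen, ← Category.assoc, h.oddOp_incl]

lemma oddOp_gen_mul_gen (h : IsExtension S φ D) (θ : K ⟶ P.pi) {a b : E ⊕ E}
    (y : K ⟶ hDual s t c a) (z : K ⟶ hDual s t c b) :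
    oddOp D θ ((y ≫ gen S a) * (z ≫ gen S b)) = (θ ⊠ (y ⊠ z)) ≫ φ a b := by
  rw [← h.on_two, pair_whiskerLeft_assoc, pair_tensorHom_assoc]
  rfl

/-- The difference has order `≤ 2` and kills products of at most two generators, so
`DiffOpOn.vanish` applies with `k = 2`. -/
lemma unique (h : IsExtension S φ D) (h' : IsExtension S φ D') : D = D' := by
  refine ((spans_top P.pi).purePts (spans_monomials S spans_pureGen stable_pureGen) (stable_top _)
    (stable_monomials S stable_pureGen)).ext ?_
  rintro K _ _ _ ⟨θ, _, -, ⟨l, hl, rfl⟩, rfl⟩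
  have := DiffOpOn.vanish (Z := oddOp D θ - oddOp D' θ)
    (G := {z | ∃ (a : E ⊕ E) (y : K ⟶ hDual s t c a), z = y ≫ gen S a}) 2
    ?_ ?_ (l.map (· ≫ S.incl)) ?_
  · exact sub_eq_zero.1 this
  · have := (h.order_two.diffOpOn θ).sub (h'.order_two.diffOpOn θ)
    exact fun f _ g _ k _ => this f trivial g trivial k trivial
  · intro l hl hk
    match l with
    | [] => simp [h.oddOp_one, h'.oddOp_one]
    | [x] =>
      obtain ⟨a, y, rfl⟩ := hl x (by simp)
      simp [h.oddOp_gen, h'.oddOp_gen]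
    | [x, x'] =>
      obtain ⟨a, y, rfl⟩ := hl x (by simp)
      obtain ⟨b, y', rfl⟩ := hl x' (by simp)
      simp [h.oddOp_gen_mul_gen, h'.oddOp_gen_mul_gen]
    | _ :: _ :: _ :: l => simp at hk
  · simp only [List.mem_map]
    rintro _ ⟨z, hz, rfl⟩
    obtain ⟨a, p, q, rfl⟩ := hl z hz
    exact ⟨a, p ⊠ q, by rw [gen, Category.assoc]⟩

end IsExtension

end Descent

/-! ### Contraction of points along an element, with a Fubini rule. -/

section Integral

open scoped ComonObj

variable {C : Type u} [Category.{v} C] [MonoidalCategory C] [SymmetricCategory C]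
  {K L X Y Z W A B : C}

@[simp] lemma pair_tensorμ [ComonObj K] [IsCommComonObj K] (x : K ⟶ X) (y : K ⟶ Y) (z : K ⟶ Z)
    (w : K ⟶ W) : ((x ⊠ y) ⊠ (z ⊠ w)) ≫ tensorμ X Y Z W = (x ⊠ z) ⊠ (y ⊠ w) := by
  simp [tensorμ]

@[simp] lemma pair_tensorμ_assoc [ComonObj K] [IsCommComonObj K] (x : K ⟶ X) (y : K ⟶ Y)
    (z : K ⟶ Z) (w : K ⟶ W) (h : (X ⊗ Z) ⊗ Y ⊗ W ⟶ L) :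
    ((x ⊠ y) ⊠ (z ⊠ w)) ≫ tensorμ X Y Z W ≫ h = ((x ⊠ z) ⊠ (y ⊠ w)) ≫ h := by
  rw [← Category.assoc, pair_tensorμ]

lemma comp_comul_eq_pair [ComonObj K] [ComonObj A] (r : K ⟶ A) [IsComonHom r] :
    r ≫ Δ[A] = r ⊠ r := by
  rw [IsComonHom.hom_comul, pair]

lemma isComonHom_pair [ComonObj K] [IsCommComonObj K] [ComonObj A] [ComonObj B] (r : K ⟶ A)
    (r' : K ⟶ B) [IsComonHom r] [IsComonHom r'] : IsComonHom (r ⊠ r') where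
  hom_counit := by
    rw [Comon.tensorObj_counit, pair_tensorHom_assoc, IsComonHom.hom_counit,
      IsComonHom.hom_counit, pair_leftUnitor, scal_counit]
  hom_comul := by
    rw [Comon.tensorObj_comul, pair_tensorHom_assoc, comp_comul_eq_pair, comp_comul_eq_pair,
      pair_tensorμ]
    rfl

section

variable [ComonObj K] [ComonObj A] [ComonObj B]

lemma projLeft_pair_id (X : C) (x : K ⊗ A ⟶ X) (a : K ⟶ Y) :
    (projLeft K A ≫ a) ⊠ x = Δ[K] ▷ A ≫ (α_ K K A).hom ≫ (a ⊗ₘ x) := by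
  have h1 : projLeft K A ⊠ projRight K A = 𝟙 _ := by
    simpa using projLeft_pair_projRight (𝟙 K) (𝟙 A)
  have h2 : projLeft K A ⊠ 𝟙 _ = Δ[K] ▷ A ≫ (α_ K K A).hom := by
    rw [← h1, ← pair_associator, ← comp_comul_eq_pair]
    have := projLeft_pair_projRight (Δ[K]) (𝟙 A)
    rw [Category.comp_id] at this
    rw [this, tensorHom_id]
  rw [← Category.id_comp x, ← pair_tensorHom, h2]
  simp

@[simp] lemma pair_projLeft (x : L ⟶ K) (y : L ⟶ A) [ComonObj L] [IsCommComonObj L] :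
    (x ⊠ y) ≫ projLeft K A = scal (y ≫ ε[A]) x := by
  rw [projLeft, pair_whiskerLeft_assoc, pair_rightUnitor]

@[simp] lemma pair_projRight (x : L ⟶ K) (y : L ⟶ A) [ComonObj L] :
    (x ⊠ y) ≫ projRight K A = scal (x ≫ ε[K]) y := by
  rw [projRight, pair_whiskerRight_assoc, pair_leftUnitor]

/-- Integration of points along a comonoid with respect to an element. -/
def integ (w : 𝟙_ C ⟶ A) (x : K ⊗ A ⟶ X) : K ⟶ X := (𝟙 K ⊠ (ε[K] ≫ w)) ≫ x

variable (w : 𝟙_ C ⟶ A) (w' : 𝟙_ C ⟶ B)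

lemma integ_comp (x : K ⊗ A ⟶ X) (f : X ⟶ Y) : integ w (x ≫ f) = integ w x ≫ f := by
  simp [integ]

lemma integ_pair_left (a : K ⟶ Y) (x : K ⊗ A ⟶ X) :
    integ w ((projLeft K A ≫ a) ⊠ x) = a ⊠ integ w x := by
  rw [projLeft_pair_id, integ, pair_whiskerRight_assoc, Category.id_comp,
    show Δ[K] = 𝟙 K ⊠ 𝟙 K by simp [pair], pair_associator_assoc, pair_tensorHom]
  simp [integ]

lemma integ_pair_right [IsCommComonObj K] [IsCommComonObj A] (a : K ⟶ Y) (x : K ⊗ A ⟶ X) :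
    integ w (x ⊠ (projLeft K A ≫ a)) = integ w x ⊠ a := by
  rw [← pair_braiding, integ_comp, integ_pair_left, pair_braiding]

lemma integ_projRight (y : A ⟶ Y) :
    integ w (projRight K A ≫ y) = ε[K] ≫ w ≫ y := by
  rw [integ, ← Category.assoc, pair_projRight, Category.id_comp, scal_counit, Category.assoc]

/-- The exchange of two integration variables. -/
def integSwap (K A B : C) [ComonObj K] [ComonObj A] [ComonObj B] : (K ⊗ B) ⊗ A ⟶ (K ⊗ A) ⊗ B :=
  ((projLeft _ A ≫ projLeft K B) ⊠ projRight _ A) ⊠ (projLeft _ A ≫ projRight K B)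

variable [IsCommComonObj K] [IsCommComonObj A] [IsCommComonObj B]

instance : IsComonHom (integSwap K A B) :=
  haveI : IsComonHom ((projLeft (K ⊗ B) A ≫ projLeft K B) ⊠ projRight (K ⊗ B) A) :=
    isComonHom_pair _ _
  isComonHom_pair _ _

lemma integSwap_eq : integSwap K A B = (α_ _ _ _).hom ≫ K ◁ (β_ B A).hom ≫ (α_ _ _ _).inv := by
  have h1 : (projLeft K B ⊠ projRight K B) = 𝟙 _ := by
    simpa using projLeft_pair_projRight (𝟙 K) (𝟙 B)
  have h2 : (projLeft (K ⊗ B) A ⊠ projRight (K ⊗ B) A) = 𝟙 _ := by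
    simpa using projLeft_pair_projRight (𝟙 (K ⊗ B)) (𝟙 A)
  rw [← Category.id_comp ((α_ K B A).hom ≫ _), ← h2,
    ← Category.comp_id (projLeft (K ⊗ B) A), ← h1, comp_pair]
  simp [integSwap]

lemma pair_projLeft_of_isComonHom [ComonObj L] [IsCommComonObj L] (x : L ⟶ K) (y : L ⟶ A)
    [IsComonHom y] : (x ⊠ y) ≫ projLeft K A = x := by
  rw [pair_projLeft, IsComonHom.hom_counit, scal_counit]

lemma pair_projRight_of_isComonHom [ComonObj L] (x : L ⟶ K) (y : L ⟶ A)
    [IsComonHom x] : (x ⊠ y) ≫ projRight K A = y := by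
  rw [pair_projRight, IsComonHom.hom_counit, scal_counit]

lemma integSwap_projLeft : integSwap K A B ≫ projLeft (K ⊗ A) B =
    (projLeft _ A ≫ projLeft K B) ⊠ projRight _ A :=
  pair_projLeft_of_isComonHom _ _

lemma integSwap_projRight : integSwap K A B ≫ projRight (K ⊗ A) B =
    projLeft _ A ≫ projRight K B :=
  haveI : IsComonHom ((projLeft (K ⊗ B) A ≫ projLeft K B) ⊠ projRight (K ⊗ B) A) :=
    isComonHom_pair _ _
  pair_projRight_of_isComonHom _ _

lemma integSwap_projLeft_projLeft : integSwap K A B ≫ projLeft (K ⊗ A) B ≫ projLeft K A =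
    projLeft _ A ≫ projLeft K B := by
  rw [← Category.assoc, integSwap_projLeft, pair_projLeft_of_isComonHom]

lemma integSwap_projLeft_projRight : integSwap K A B ≫ projLeft (K ⊗ A) B ≫ projRight K A =
    projRight _ A := by
  rw [← Category.assoc, integSwap_projLeft, pair_projRight_of_isComonHom]

lemma comp_id_pair [ComonObj L] (z : L ⟶ K) :
    z ≫ (𝟙 K ⊠ (ε[K] ≫ w)) = z ⊠ (ε[L] ≫ w) := by
  have h : ∀ {L : C} [ComonObj L] (z : L ⟶ K), z ⊠ (ε[L] ≫ w) = z ≫ (ρ_ K).inv ≫ K ◁ w := by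
    intro L _ z
    simp
  rw [h, h, Category.id_comp]

/-- Fubini: by cocommutativity `integSwap` is a comonoid map that just permutes the factors, so it
can be pushed through every expression in points. -/
lemma integ_integ_swap (x : (K ⊗ A) ⊗ B ⟶ X) :
    integ w' (integ w (integSwap K A B ≫ x)) = integ w (integ w' x) := by
  simp only [integ, integSwap_eq, ← Category.assoc, comp_id_pair]
  simp only [pair_associator, pair_whiskerLeft, pair_braiding, pair_associator_inv]

end

end Integral

/-! ### Values of maps at points. -/

section Values

open scoped ComonObj

variable {C : Type u} [Category.{v} C] [MonoidalCategory C] [SymmetricCategory C]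

/-- The value of a map from a tensor product at two points. -/
def val {K X Y Z : C} [ComonObj K] (F : X ⊗ Y ⟶ Z) (x : K ⟶ X) (y : K ⟶ Y) : K ⟶ Z := (x ⊠ y) ≫ F

lemma comp_val {K L X Y Z : C} [ComonObj K] [ComonObj L] (r : L ⟶ K) [IsComonHom r] (F : X ⊗ Y ⟶ Z)
    (x : K ⟶ X) (y : K ⟶ Y) : r ≫ val F x y = val F (r ≫ x) (r ≫ y) :=
  comp_pair_assoc r x y F

lemma val_scal_left {K X Y Z : C} [ComonObj K] (F : X ⊗ Y ⟶ Z) (s : K ⟶ 𝟙_ C) (x : K ⟶ X)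
    (y : K ⟶ Y) : val F (scal s x) y = scal s (val F x y) := by
  rw [val, scal_pair, scal_comp, val]

lemma val_scal_right {K X Y Z : C} [ComonObj K] [IsCommComonObj K] (F : X ⊗ Y ⟶ Z) (s : K ⟶ 𝟙_ C)
    (x : K ⟶ X) (y : K ⟶ Y) : val F x (scal s y) = scal s (val F x y) := by
  rw [val, pair_scal, scal_comp, val]

lemma comp_scal {K L Y : C} [ComonObj K] [ComonObj L] (r : L ⟶ K) [IsComonHom r] (s : K ⟶ 𝟙_ C)
    (y : K ⟶ Y) : r ≫ scal s y = scal (r ≫ s) (r ≫ y) :=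
  comp_pair_assoc r s y _

lemma scal_comm {K : C} [ComonObj K] [IsCommComonObj K] (s t : K ⟶ 𝟙_ C) : scal s t = scal t s := by
  rw [← pair_rightUnitor t s, ← unitors_equal, pair_leftUnitor]

lemma comp_mul {K L A : C} [ComonObj K] [IsCommComonObj K] [ComonObj L] [IsCommComonObj L]
    [Preadditive C] [MonoidalPreadditive C] [MonObj A] [IsCommMonObj A] (r : L ⟶ K) [IsComonHom r]
    (x y : K ⟶ A) : r ≫ (x * y) = (r ≫ x) * (r ≫ y) :=
  comp_pair_assoc r x y _

end Values

/-! ### Sums over dual bases, odd duals and matrix products. -/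

section Cup

open scoped ComonObj

variable {C : Type u} [Category.{v} C] [MonoidalCategory C] [SymmetricCategory C]
  [Preadditive C] [MonoidalPreadditive C] [HasBinaryBiproducts C]

/-- The comonoid on which a dualisable object and its dual have generic points. -/
abbrev CupObj (c : C) [HasRightDual c] : C := Gen c ⊗ Gen cᘁ

/-- The coevaluation as an element of `CupObj c`. -/
def cupElt (c : C) [HasRightDual c] : 𝟙_ C ⟶ CupObj c := η_ c cᘁ ≫ (genIncl c ⊗ₘ genIncl cᘁ)

variable (K : C) [ComonObj K] [IsCommComonObj K] (c d : C) [HasRightDual c] [HasRightDual d]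

/-- The projection forgetting a generic point of a dualisable object and its dual. -/
def res : K ⊗ CupObj c ⟶ K := projLeft K (CupObj c)

/-- The generic point of a dualisable object. -/
def vec : K ⊗ CupObj c ⟶ c := projRight K (CupObj c) ≫ projLeft _ _ ≫ genPt c

/-- The generic point of the dual of a dualisable object. -/
def cov : K ⊗ CupObj c ⟶ cᘁ := projRight K (CupObj c) ≫ projRight _ _ ≫ genPt cᘁ

instance : IsComonHom (res K c) := inferInstanceAs (IsComonHom (projLeft K (CupObj c)))

variable {K}

/-- The contraction of a generic point of a dualisable object with that of its dual. -/
def cupSum {X : C} (x : K ⊗ CupObj c ⟶ X) : K ⟶ X := integ (cupElt c) x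

variable {X Y Z W : C}

lemma cupSum_sub (x y : K ⊗ CupObj c ⟶ X) : cupSum c (x - y) = cupSum c x - cupSum c y :=
  Preadditive.comp_sub _ _ _

lemma cupSum_add (x y : K ⊗ CupObj c ⟶ X) : cupSum c (x + y) = cupSum c x + cupSum c y :=
  Preadditive.comp_add _ _ _ _ _ _

lemma cupSum_zero : cupSum c (0 : K ⊗ CupObj c ⟶ X) = 0 := comp_zero

lemma cupSum_comp (x : K ⊗ CupObj c ⟶ X) (f : X ⟶ Y) : cupSum c (x ≫ f) = cupSum c x ≫ f :=
  integ_comp _ _ _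

lemma cupSum_res_pair (a : K ⟶ Y) (x : K ⊗ CupObj c ⟶ X) :
    cupSum c ((res K c ≫ a) ⊠ x) = a ⊠ cupSum c x :=
  integ_pair_left _ _ _

lemma cupSum_pair_res (a : K ⟶ Y) (x : K ⊗ CupObj c ⟶ X) :
    cupSum c (x ⊠ (res K c ≫ a)) = cupSum c x ⊠ a :=
  integ_pair_right _ _ _

lemma cupSum_val_left (F : Y ⊗ X ⟶ Z) (a : K ⟶ Y) (x : K ⊗ CupObj c ⟶ X) :
    cupSum c (val F (res K c ≫ a) x) = val F a (cupSum c x) := by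
  rw [val, cupSum_comp, cupSum_res_pair, val]

lemma cupSum_val_right (F : X ⊗ Y ⟶ Z) (a : K ⟶ Y) (x : K ⊗ CupObj c ⟶ X) :
    cupSum c (val F x (res K c ≫ a)) = val F (cupSum c x) a := by
  rw [val, cupSum_comp, cupSum_pair_res, val]

/-- Thus `vec` and `cov` act as dual bases `e_i`, `e^i`, and `cupSum` as the sum over `i`. -/
lemma cupSum_vec_cov : cupSum c (vec K c ⊠ cov K c) = ε[K] ≫ η_ c cᘁ := by
  have h : genPt c ⊗ₘ genPt cᘁ = (projLeft _ _ ≫ genPt c) ⊠ (projRight _ _ ≫ genPt cᘁ) :=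
    (projLeft_pair_projRight _ _).symm
  rw [vec, cov, ← comp_pair, ← h, cupSum, integ_projRight, cupElt]
  simp

lemma cupSum_eval (z : K ⟶ Z) (G : Z ⊗ c ⊗ cᘁ ⟶ Y) :
    cupSum c (((res K c ≫ z) ⊠ (vec K c ⊠ cov K c)) ≫ G) = (z ⊠ (ε[K] ≫ η_ c cᘁ)) ≫ G := by
  rw [cupSum_comp, cupSum_res_pair, cupSum_vec_cov]

section Mul

variable {S : C} [MonObj S] [IsCommMonObj S]

lemma cupSum_res_mul (a : K ⟶ S) (x : K ⊗ CupObj c ⟶ S) :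
    cupSum c ((res K c ≫ a) * x) = a * cupSum c x :=
  cupSum_val_left c _ a x

lemma cupSum_mul_res (a : K ⟶ S) (x : K ⊗ CupObj c ⟶ S) :
    cupSum c (x * (res K c ≫ a)) = cupSum c x * a :=
  cupSum_val_right c _ a x

end Mul

/-- The exchange of two cups. -/
def cupSwap (K c d : C) [ComonObj K] [HasRightDual c] [HasRightDual d] :
    (K ⊗ CupObj d) ⊗ CupObj c ⟶ (K ⊗ CupObj c) ⊗ CupObj d := integSwap K (CupObj c) (CupObj d)

instance : IsComonHom (cupSwap K c d) :=
  inferInstanceAs (IsComonHom (integSwap K (CupObj c) (CupObj d)))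

lemma cupSum_cupSum_swap (x : (K ⊗ CupObj c) ⊗ CupObj d ⟶ X) :
    cupSum d (cupSum c (cupSwap K c d ≫ x)) = cupSum c (cupSum d x) :=
  integ_integ_swap _ _ _

lemma cupSwap_res_res (z : K ⟶ Z) :
    cupSwap K c d ≫ res _ d ≫ res _ c ≫ z = res _ c ≫ res _ d ≫ z := by
  have := integSwap_projLeft_projLeft (K := K) (A := CupObj c) (B := CupObj d)
  simp only [cupSwap, res, reassoc_of% this]

lemma cupSwap_vec : cupSwap K c d ≫ vec _ d = res _ c ≫ vec _ d := by
  have := integSwap_projRight (K := K) (A := CupObj c) (B := CupObj d)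
  simp only [cupSwap, res, vec, reassoc_of% this]

lemma cupSwap_cov : cupSwap K c d ≫ cov _ d = res _ c ≫ cov _ d := by
  have := integSwap_projRight (K := K) (A := CupObj c) (B := CupObj d)
  simp only [cupSwap, res, cov, reassoc_of% this]

lemma cupSwap_res_vec : cupSwap K c d ≫ res _ d ≫ vec _ c = vec _ c := by
  have := integSwap_projLeft_projRight (K := K) (A := CupObj c) (B := CupObj d)
  simp only [cupSwap, res, vec, reassoc_of% this]

lemma cupSwap_res_cov : cupSwap K c d ≫ res _ d ≫ cov _ c = cov _ c := by
  have := integSwap_projLeft_projRight (K := K) (A := CupObj c) (B := CupObj d)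
  simp only [cupSwap, res, cov, reassoc_of% this]

/-- The zigzag identity, read as the expansion `p = ∑ e^i(p) e_i`. -/
lemma cupSum_zigzag (p : K ⟶ c) :
    cupSum c (scal (val (ε_ c cᘁ) (cov K c) (res K c ≫ p)) (vec K c)) = p := by
  have h1 : scal (val (ε_ c cᘁ) (cov K c) (res K c ≫ p)) (vec K c) =
      ((res K c ≫ p) ⊠ (vec K c ⊠ cov K c)) ≫ (β_ _ _).hom ≫ (α_ _ _ _).hom ≫
        c ◁ ε_ c cᘁ ≫ (ρ_ c).hom := by
    rw [← Category.assoc, pair_braiding, pair_associator_assoc, pair_whiskerLeft_assoc,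
      pair_rightUnitor, val]
  rw [h1, cupSum_eval, ← Category.assoc, pair_braiding, ← pair_whiskerRight_assoc,
    ExactPairing.evaluation_coevaluation_assoc]
  simp

variable {P : ParityStructure C} {c} (f : OddHom P c c)

/-- In coordinates the dual is `q ↦ ∑ q(f e_i) e^i`; moving `π` past `c^∨` costs no sign at points.
-/
lemma val_oddDual_eq_cupSum (θ : K ⟶ P.pi) (q : K ⟶ cᘁ) :
    val (oddDual P c f) θ q =
      cupSum c (scal (val (ε_ c cᘁ) (res K c ≫ q) (val f (res K c ≫ θ) (vec K c))) (cov K c)) := by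
  have h1 : scal (val (ε_ c cᘁ) (res K c ≫ q) (val f (res K c ≫ θ) (vec K c))) (cov K c) =
      ((res K c ≫ (q ⊠ θ)) ⊠ (vec K c ⊠ cov K c)) ≫
    (α_ cᘁ P.pi (c ⊗ cᘁ)).hom ≫ cᘁ ◁ (α_ P.pi c cᘁ).inv ≫ cᘁ ◁ (f ▷ cᘁ) ≫
      (α_ cᘁ c cᘁ).inv ≫ ε_ c cᘁ ▷ cᘁ ≫ (λ_ cᘁ).hom := by
    simp [comp_pair, val]
  rw [h1, cupSum_eval, val, oddDual]
  simp

lemma val_ev_oddDual (θ : K ⟶ P.pi) (q : K ⟶ cᘁ) (p : K ⟶ c) :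
    val (ε_ c cᘁ) (val (oddDual P c f) θ q) p = val (ε_ c cᘁ) q (val f θ p) := by
  rw [val_oddDual_eq_cupSum, ← cupSum_val_right]
  conv_rhs => rw [← cupSum_zigzag c p, ← cupSum_val_left, ← cupSum_val_left]
  rw [val_scal_left, val_scal_right, val_scal_right, scal_comm]

/-- An odd endomorphism slides through a cup: `∑ e_i ⊗ f^∨ e^i = ∑ f e_i ⊗ e^i`. -/
lemma cupSum_vec_oddDual (θ : K ⟶ P.pi) :
    cupSum c (vec K c ⊠ val (oddDual P c f) (res K c ≫ θ) (cov K c)) =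
      cupSum c (val f (res K c ≫ θ) (vec K c) ⊠ cov K c) := by
  rw [val_oddDual_eq_cupSum]
  simp only [← cupSum_res_pair]
  -- Expanding `f^∨` creates a second sum; after the exchange the inner sum is the zigzag expansion
  -- of `f e_i`.
  rw [← cupSum_cupSum_swap]
  simp only [comp_pair, comp_scal, comp_val, cupSwap_res_vec, cupSwap_res_cov, cupSwap_vec,
    cupSwap_cov, cupSwap_res_res]
  have h : ∀ (s : (K ⊗ CupObj c) ⊗ CupObj c ⟶ 𝟙_ C) (a : (K ⊗ CupObj c) ⊗ CupObj c ⟶ c)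
    (b : (K ⊗ CupObj c) ⊗ CupObj c ⟶ cᘁ), a ⊠ scal s b = scal s a ⊠ b := fun s a b => by
      rw [scal_pair, pair_scal]
  simp only [h, cupSum_pair_res]
  have key := cupSum_zigzag c (val f (res K c ≫ θ) (vec K c))
  rw [comp_val] at key
  rw [key]

lemma cupSum_oddDual (θ : K ⟶ P.pi) (z : K ⟶ Z) (G : Z ⊗ c ⊗ cᘁ ⟶ Y) :
    cupSum c (((res K c ≫ z) ⊠ (vec K c ⊠ val (oddDual P c f) (res K c ≫ θ) (cov K c))) ≫ G) =
      cupSum c (((res K c ≫ z) ⊠ (val f (res K c ≫ θ) (vec K c) ⊠ cov K c)) ≫ G) := by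
  rw [cupSum_comp, cupSum_res_pair, cupSum_vec_oddDual, ← cupSum_res_pair, ← cupSum_comp]

section Star

variable {a b S : C} [MonObj S] (F : a ⊗ cᘁ ⟶ S) (G : c ⊗ b ⟶ S)

/-- The product of the values of two maps before contraction. -/
def starAux : (a ⊗ b) ⊗ c ⊗ cᘁ ⟶ S :=
  (a ⊗ b) ◁ (β_ _ _).hom ≫ tensorμ a b cᘁ c ≫ (a ⊗ cᘁ) ◁ (β_ _ _).hom ≫ (F ⊗ₘ G) ≫ μ[S]

/-- The contraction of two maps along a dualisable object. -/
def star : a ⊗ b ⟶ S := (ρ_ _).inv ≫ (a ⊗ b) ◁ η_ c cᘁ ≫ starAux F G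

variable [IsCommMonObj S]

lemma pair_starAux (x : K ⟶ a) (y : K ⟶ b) (p : K ⟶ c) (q : K ⟶ cᘁ) :
    ((x ⊠ y) ⊠ (p ⊠ q)) ≫ starAux F G = val F x q * val G p y := by
  simp [starAux, val, point_mul_def]

lemma val_star (x : K ⟶ a) (y : K ⟶ b) :
    val (star F G) x y =
      cupSum c (val F (res K c ≫ x) (cov K c) * val G (vec K c) (res K c ≫ y)) := by
  rw [← pair_starAux, ← comp_pair, cupSum_eval, val, star]
  simp

lemma cupSum_mul_oddDual (θ : K ⟶ P.pi) (x : K ⟶ a) (y : K ⟶ b) :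
    cupSum c (val F (res K c ≫ x) (val (oddDual P c f) (res K c ≫ θ) (cov K c)) *
        val G (vec K c) (res K c ≫ y)) =
      cupSum c (val F (res K c ≫ x) (cov K c) *
        val G (val f (res K c ≫ θ) (vec K c)) (res K c ≫ y)) := by
  rw [← pair_starAux, ← pair_starAux, ← comp_pair, cupSum_oddDual]

/-- Associativity of matrix multiplication over the ring of points, by exchanging the two sums. -/
lemma star_assoc {d : C} [HasRightDual d] (F : a ⊗ cᘁ ⟶ S) (G : c ⊗ dᘁ ⟶ S) (H : d ⊗ b ⟶ S) :
    star (star F G) H = star F (star G H) := by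
  refine hom_ext₂ fun K _ _ x y => ?_
  change val _ x y = val _ x y
  rw [val_star, val_star]
  simp only [val_star, ← cupSum_mul_res, ← cupSum_res_mul]
  rw [← cupSum_cupSum_swap]
  simp only [comp_mul, comp_val, cupSwap_res_vec, cupSwap_res_cov, cupSwap_vec,
    cupSwap_cov, cupSwap_res_res, mul_assoc]

/-- A map is balanced if it is compatible with odd endomorphisms of its arguments. -/
def Balanced {a b : C} [HasRightDual b] (ja : OddHom P a a) (jb : OddHom P b b)
    (F : a ⊗ bᘁ ⟶ Y) : Prop :=
  ∀ (K : C) [ComonObj K] [IsCommComonObj K] (θ : K ⟶ P.pi) (p : K ⟶ a) (q : K ⟶ bᘁ),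
    val F (val ja θ p) q = val F p (val (oddDual P b jb) θ q)

/-- `Balanced` says that a matrix intertwines the odd endomorphisms, a property stable under
products. -/
lemma Balanced.star {a b : C} [HasRightDual b] {ja : OddHom P a a} {jc : OddHom P c c}
    {jb : OddHom P b b} {F : a ⊗ cᘁ ⟶ S} {G : c ⊗ bᘁ ⟶ S} (hF : Balanced ja jc F)
    (hG : Balanced jc jb G) : Balanced ja jb (star F G) := by
  intro K _ _ θ p q
  rw [val_star, comp_val, hF, cupSum_mul_oddDual, hG, ← comp_val, ← val_star]

lemma val_val_of_oddComp (hf : oddComp P f f = 𝟙 c) (θ θ' : K ⟶ P.pi) (p : K ⟶ c) :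
    val f θ (val f θ' p) = scal (val P.xi.hom θ θ') p := by
  have h : (α_ P.pi P.pi c).hom ≫ P.pi ◁ f ≫ f = P.xi.hom ▷ c ≫ (λ_ c).hom := by
    rw [oddComp, Iso.inv_comp_eq, Category.comp_id] at hf
    rw [← hf, ← comp_whiskerRight_assoc]
    simp
  have := whisker_eq ((θ ⊠ θ') ⊠ p) h
  simpa [val] using this

lemma val_xi_comm (θ θ' : K ⟶ P.pi) : val P.xi.hom θ θ' = -val P.xi.hom θ' θ := by
  rw [val, pair_pi_comm, Preadditive.neg_comp, val]

lemma neg_scal (s : K ⟶ 𝟙_ C) (y : K ⟶ Y) : scal (-s) y = -scal s y := by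
  rw [scal, neg_pair, Preadditive.neg_comp, scal]

lemma scal_counit_comp (s : K ⟶ 𝟙_ C) (g : 𝟙_ C ⟶ Y) : scal s (ε[K] ≫ g) = s ≫ g := by
  rw [← scal_comp, scal_comm, scal_counit]

/-- The trace of a balanced map vanishes. -/
lemma coev_comp_eq_zero (h2 : ∀ {X Y : C} (g : X ⟶ Y), g + g = 0 → g = 0)
    (hf : oddComp P f f = 𝟙 c) {B : c ⊗ cᘁ ⟶ S} (hB : Balanced f f B) :
    η_ c cᘁ ≫ B = 0 := by
  -- As `ξ` is invertible, it suffices to kill `ξ(θ, θ') tr B = tr(B f_θ f_θ')`.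
  suffices P.xi.hom ≫ η_ c cᘁ ≫ B = 0 by
    rwa [← Iso.eq_inv_comp, comp_zero] at this
  have tr : ∀ {K : C} [ComonObj K] [IsCommComonObj K], cupSum c (val B (vec K c) (cov K c)) =
      ε[K] ≫ η_ c cᘁ ≫ B := by
    intro K _ _
    rw [val, cupSum_comp, cupSum_vec_cov, Category.assoc]
  refine h2 _ (hom_ext₂ fun K _ _ θ θ' => ?_)
  have key : ∀ θ θ' : K ⟶ P.pi,
      cupSum c (val B (val f (res K c ≫ θ) (val f (res K c ≫ θ') (vec K c))) (cov K c)) =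
      (θ ⊠ θ') ≫ P.xi.hom ≫ η_ c cᘁ ≫ B := by
    intro θ θ'
    rw [val_val_of_oddComp f hf, val_scal_left, ← comp_val, scal, cupSum_comp, cupSum_res_pair, tr,
      pair_leftUnitor, scal_counit_comp, val, Category.assoc]
  -- Cyclicity of the trace gives symmetry in `θ, θ'`, whereas `key` shows antisymmetry; hence twice
  -- the trace is zero.
  have comm : ∀ θ θ' : K ⟶ P.pi,
      cupSum c (val B (val f (res K c ≫ θ) (val f (res K c ≫ θ') (vec K c))) (cov K c)) =
      cupSum c (val B (val f (res K c ≫ θ') (val f (res K c ≫ θ) (vec K c))) (cov K c)) := by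
    intro θ θ'
    have h : ∀ (p : K ⊗ CupObj c ⟶ c) (q : K ⊗ CupObj c ⟶ cᘁ),
        val B (val f (res K c ≫ θ') p) q =
          ((res K c ≫ θ') ⊠ (p ⊠ q)) ≫ oddWhiskerRight P f _ ≫ B := by
      intro p q
      simp [val]
    rw [hB, h, cupSum_oddDual, ← h]
  rw [comp_zero, Preadditive.comp_add]
  nth_rw 1 [← key]
  rw [comm, key, pair_pi_comm θ' θ, Preadditive.neg_comp, neg_add_cancel]

end Star

end Cup

/-! ### The bracket generated by an operator of order two. -/

section Bracket

variable {A : Type*} [CommRing A]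

/-- The bracket of an additive operator, its failure to be a derivation. -/
def brk (Z : A →+ A) (u v : A) : A := Z (u * v) - Z u * v - u * Z v

variable {Z : A →+ A}

lemma apply_mul_eq (u v : A) : Z (u * v) = Z u * v + u * Z v + brk Z u v := by
  rw [brk]; ring

lemma brk_comm (u v : A) : brk Z u v = brk Z v u := by
  rw [brk, brk, mul_comm u v]; ring

lemma brk_sub_right (u v w : A) : brk Z u (v - w) = brk Z u v - brk Z u w := by
  simp only [brk, mul_sub, map_sub]; ring

/-- The Leibniz rule is the vanishing of the triple commutator, evaluated at `1`. -/
lemma brk_mul_right (h : DiffOpOn Set.univ 3 Z) (h1 : Z 1 = 0) (u v w : A) :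
    brk Z u (v * w) = brk Z u v * w + v * brk Z u w := by
  have h3 : adj (adj (adj Z u) v) w = 0 := h u trivial v trivial w trivial
  have h4 := DFunLike.congr_fun h3 1
  simp only [adj_apply, mul_one, AddMonoidHom.zero_apply, h1, mul_zero, sub_zero] at h4
  simp only [brk]
  linear_combination h4

lemma brk_mul_left (h : DiffOpOn Set.univ 3 Z) (h1 : Z 1 = 0) (u v w : A) :
    brk Z (v * w) u = brk Z v u * w + v * brk Z w u := by
  rw [brk_comm, brk_mul_right h h1, brk_comm u v, brk_comm u w]

end Bracket

/-! ### Bracket calculus for the two matrices over one edge. -/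

section Chord

open scoped ComonObj

variable {C : Type u} [Category.{v} C] [MonoidalCategory C] [SymmetricCategory C]
  [Preadditive C] [MonoidalPreadditive C] [HasBinaryBiproducts C]
  {P : ParityStructure C} {c d S : C} [HasRightDual c] [HasRightDual d] [MonObj S] [IsCommMonObj S]
  {K : C} [ComonObj K] [IsCommComonObj K]

section

variable (D : OddHom P S S)

lemma comp_oddOp {L : C} [ComonObj L] [IsCommComonObj L] (r : L ⟶ K) [IsComonHom r] (θ : K ⟶ P.pi)
    (x : K ⟶ S) : r ≫ oddOp D θ x = oddOp D (r ≫ θ) (r ≫ x) := comp_pair_assoc r _ _ _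

lemma cupSum_oddOp (θ : K ⟶ P.pi) (x : K ⊗ CupObj c ⟶ S) :
    cupSum c (oddOp D (res K c ≫ θ) x) = oddOp D θ (cupSum c x) :=
  cupSum_val_left c D θ x

lemma cupSum_brk_right (θ : K ⟶ P.pi) (a : K ⟶ S) (x : K ⊗ CupObj c ⟶ S) :
    cupSum c (brk (oddOp D (res K c ≫ θ)) (res K c ≫ a) x) = brk (oddOp D θ) a (cupSum c x) := by
  simp only [brk, cupSum_sub, cupSum_oddOp, cupSum_res_mul, ← comp_oddOp]

lemma cupSum_brk_left (θ : K ⟶ P.pi) (a : K ⟶ S) (x : K ⊗ CupObj c ⟶ S) :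
    cupSum c (brk (oddOp D (res K c ≫ θ)) x (res K c ≫ a)) = brk (oddOp D θ) (cupSum c x) a :=
  (congrArg (cupSum c) (brk_comm _ _)).trans ((cupSum_brk_right D θ a x).trans (brk_comm _ _))

end

/-- The difference of the two ways to insert odd endomorphisms in a product. -/
def chord (jc : OddHom P c c) (jd : OddHom P d d) (N : c ⊗ cᘁ ⟶ S) (B : d ⊗ dᘁ ⟶ S)
    (θ : K ⟶ P.pi) (p : K ⟶ c) (p' : K ⟶ dᘁ) (q : K ⟶ d) (q' : K ⟶ cᘁ) : K ⟶ S :=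
  val N (val jc θ p) q' * val B q p' - val N p q' * val B (val jd θ q) p'

/-- An operator of order two on functions of two matrices, given by chords. -/
structure ChordOp (jc : OddHom P c c) (jd : OddHom P d d) (X : c ⊗ dᘁ ⟶ S) (Y : d ⊗ cᘁ ⟶ S)
    (D : OddHom P S S) : Prop where
  balanced_left : Balanced jc jd X
  balanced_right : Balanced jd jc Y
  order_two : ∀ (K : C) [ComonObj K] [IsCommComonObj K] (θ : K ⟶ P.pi),
    DiffOpOn Set.univ 3 (oddOp D θ)
  apply_one : ∀ (K : C) [ComonObj K] [IsCommComonObj K] (θ : K ⟶ P.pi), oddOp D θ 1 = 0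
  apply_left : ∀ (K : C) [ComonObj K] [IsCommComonObj K] (θ : K ⟶ P.pi) (p : K ⟶ c) (p' : K ⟶ dᘁ),
    oddOp D θ (val X p p') = 0
  apply_right : ∀ (K : C) [ComonObj K] [IsCommComonObj K] (θ : K ⟶ P.pi) (q : K ⟶ d) (q' : K ⟶ cᘁ),
    oddOp D θ (val Y q q') = 0
  apply_left_left : ∀ (K : C) [ComonObj K] [IsCommComonObj K] (θ : K ⟶ P.pi) (p r : K ⟶ c)
    (p' r' : K ⟶ dᘁ), oddOp D θ (val X p p' * val X r r') = 0
  apply_right_right : ∀ (K : C) [ComonObj K] [IsCommComonObj K] (θ : K ⟶ P.pi) (p r : K ⟶ d)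
    (p' r' : K ⟶ cᘁ), oddOp D θ (val Y p p' * val Y r r') = 0
  apply_left_right : ∀ (K : C) [ComonObj K] [IsCommComonObj K] (θ : K ⟶ P.pi) (p : K ⟶ c)
    (p' : K ⟶ dᘁ) (q : K ⟶ d) (q' : K ⟶ cᘁ), oddOp D θ (val X p p' * val Y q q') =
      chord jc jd (star X Y) (star Y X) θ p p' q q'

namespace ChordOp

variable {jc : OddHom P c c} {jd : OddHom P d d} {X : c ⊗ dᘁ ⟶ S} {Y : d ⊗ cᘁ ⟶ S}
    {D : OddHom P S S} (h : ChordOp jc jd X Y D)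

lemma neg_oddOp (θ : K ⟶ P.pi) (x : K ⟶ S) : oddOp (-D) θ x = -oddOp D θ x :=
  Preadditive.comp_neg _ _

lemma brk_neg (θ : K ⟶ P.pi) (x y : K ⟶ S) :
    brk (oddOp (-D) θ) x y = -brk (oddOp D θ) x y := by
  simp only [brk, neg_oddOp]; ring

include h

/-- The operator with the roles of the two matrices exchanged. -/
lemma symm : ChordOp jd jc Y X (-D) where
  balanced_left := h.balanced_right
  balanced_right := h.balanced_left
  order_two := fun K _ _ θ => by
    rw [show oddOp (-D) θ = -oddOp D θ from AddMonoidHom.ext (neg_oddOp θ)]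
    exact (h.order_two K θ).neg
  apply_one K _ _ θ := by rw [neg_oddOp, h.apply_one, neg_zero]
  apply_left K _ _ θ p p' := by rw [neg_oddOp, h.apply_right, neg_zero]
  apply_right K _ _ θ p p' := by rw [neg_oddOp, h.apply_left, neg_zero]
  apply_left_left K _ _ θ p r p' r' := by rw [neg_oddOp, h.apply_right_right, neg_zero]
  apply_right_right K _ _ θ p r p' r' := by rw [neg_oddOp, h.apply_left_left, neg_zero]
  apply_left_right K _ _ θ p p' q q' := by
    rw [neg_oddOp, mul_comm, h.apply_left_right, chord, chord]; ring

lemma brk_left_right (θ : K ⟶ P.pi) (p : K ⟶ c) (p' : K ⟶ dᘁ) (q : K ⟶ d) (q' : K ⟶ cᘁ) :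
    brk (oddOp D θ) (val X p p') (val Y q q') = chord jc jd (star X Y) (star Y X) θ p p' q q' := by
  simp [brk, h.apply_left_right, h.apply_left, h.apply_right]

lemma brk_left_left (θ : K ⟶ P.pi) (p r : K ⟶ c) (p' r' : K ⟶ dᘁ) :
    brk (oddOp D θ) (val X p p') (val X r r') = 0 := by
  simp [brk, h.apply_left_left, h.apply_left]

lemma brk_mul (θ : K ⟶ P.pi) (x y z : K ⟶ S) :
    brk (oddOp D θ) x (y * z) = brk (oddOp D θ) x y * z + y * brk (oddOp D θ) x z :=
  brk_mul_right (h.order_two K θ) (h.apply_one K θ) x y z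

lemma mul_brk (θ : K ⟶ P.pi) (x y z : K ⟶ S) :
    brk (oddOp D θ) (y * z) x = brk (oddOp D θ) y x * z + y * brk (oddOp D θ) z x :=
  brk_mul_left (h.order_two K θ) (h.apply_one K θ) x y z

lemma balanced_star : Balanced jc jc (star X Y) := h.balanced_left.star h.balanced_right

/-- Leibniz on `N = XY`: only `{X, Y}` contributes, and the odd endomorphism it leaves on the summed
index slides through the cup and across `X` onto `p`. -/
lemma brk_left_star (θ : K ⟶ P.pi) (p r : K ⟶ c) (r' : K ⟶ dᘁ) (q' : K ⟶ cᘁ) :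
    brk (oddOp D θ) (val X r r') (val (star X Y) p q') =
      val (star X Y) (val jc θ r) q' * val (star X (star Y X)) p r' -
        val (star X Y) r q' * val (star X (star Y X)) (val jc θ p) r' := by
  rw [val_star X Y p, ← cupSum_brk_right]
  simp only [h.brk_mul, comp_val, h.brk_left_left, h.brk_left_right, chord, zero_mul, zero_add,
    mul_sub, cupSum_sub]
  simp only [← comp_val, mul_left_comm _ (res K d ≫ _), cupSum_res_mul]
  rw [← cupSum_mul_oddDual]
  simp only [← h.balanced_left _ _ _, ← comp_val, ← val_star]

/-- The same for `B = YX`; here the sum produces `(XY)X`, rewritten as `X(YX)`. -/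
lemma brk_left_star_symm (θ : K ⟶ P.pi) (r : K ⟶ c) (q : K ⟶ d) (r' p' : K ⟶ dᘁ) :
    brk (oddOp D θ) (val X r r') (val (star Y X) q p') =
      val (star X (star Y X)) (val jc θ r) p' * val (star Y X) q r' -
        val (star X (star Y X)) r p' * val (star Y X) (val jd θ q) r' := by
  rw [val_star Y X q, ← cupSum_brk_right]
  simp only [h.brk_mul, comp_val, h.brk_left_left, h.brk_left_right, chord, mul_zero, add_zero,
    sub_mul, cupSum_sub]
  simp only [← comp_val, mul_right_comm _ (res K c ≫ _), cupSum_mul_res]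
  simp only [comp_val]
  simp only [← comp_val, ← val_star, star_assoc]

lemma brk_right_star (θ : K ⟶ P.pi) (p r : K ⟶ d) (r' : K ⟶ cᘁ) (q' : K ⟶ dᘁ) :
    brk (oddOp D θ) (val Y r r') (val (star Y X) p q') =
      val (star Y X) r q' * val (star Y (star X Y)) (val jd θ p) r' -
        val (star Y X) (val jd θ r) q' * val (star Y (star X Y)) p r' := by
  have := h.symm.brk_left_star θ p r r' q'
  rw [brk_neg] at this
  linear_combination -this

/-- Expanding `N = XY` by Leibniz gives four products of an entry of `XYX` with an entry of `YXY`,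
which cancel in pairs once `(YX)Y = Y(XY)`. -/
lemma brk_star_star (θ : K ⟶ P.pi) (p : K ⟶ c) (p' : K ⟶ dᘁ) (q : K ⟶ d) (q' : K ⟶ cᘁ) :
    brk (oddOp D θ) (val (star X Y) p q') (val (star Y X) q p') = 0 := by
  have h1 : star (star Y X) Y = star Y (star X Y) := star_assoc _ _ _
  rw [val_star X Y p, ← cupSum_brk_left]
  simp only [h.mul_brk, comp_val, h.brk_left_star_symm, h.brk_right_star]
  simp only [mul_sub, sub_mul, cupSum_sub, cupSum_add]
  have e1 : ∀ (a b : K ⊗ CupObj d ⟶ S) (w : K ⟶ S),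
      cupSum d (a * (b * (res K d ≫ w))) = cupSum d (a * b) * w := fun a b w => by
    rw [← mul_assoc, cupSum_mul_res]
  have e2 : ∀ (a b : K ⊗ CupObj d ⟶ S) (w : K ⟶ S),
      cupSum d ((res K d ≫ w) * a * b) = w * cupSum d (a * b) := fun a b w => by
    rw [mul_assoc, cupSum_res_mul]
  simp only [← comp_val, e1, e2]
  rw [← cupSum_mul_oddDual]
  simp only [← h.balanced_left _ _ _, ← comp_val, ← val_star, h1]
  ring

/-- Summing the chord over the inner index leaves `N(jp, q') tr B - N(p, q') tr(jB)`, and `hB`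
removes the first term. -/
lemma apply_star (hB : η_ d dᘁ ≫ star Y X = 0) (θ : K ⟶ P.pi) (p : K ⟶ c) (q' : K ⟶ cᘁ) :
    oddOp D θ (val (star X Y) p q') = -(val (star X Y) p q' *
      cupSum d (val (star Y X) (val jd (res K d ≫ θ) (vec K d)) (cov K d))) := by
  have tr : cupSum d (val (star Y X) (vec K d) (cov K d)) = 0 := by
    rw [val, cupSum_comp, cupSum_vec_cov, Category.assoc, hB, comp_zero]
  rw [val_star X Y p, ← cupSum_oddOp]
  simp only [h.apply_left_right, chord, cupSum_sub]
  simp only [← comp_val, cupSum_res_mul, tr, ← val_star]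
  ring

/-- Cyclicity `tr(jYX) = tr(jXY)`, using that `X` intertwines the two odd endomorphisms. -/
lemma cupSum_star_comm (θ : K ⟶ P.pi) :
    cupSum d (val (star Y X) (val jd (res K d ≫ θ) (vec K d)) (cov K d)) =
      cupSum c (val (star X Y) (val jc (res K c ≫ θ) (vec K c)) (cov K c)) := by
  have h1 : ∀ (x : K ⊗ CupObj d ⟶ d) (y : K ⊗ CupObj d ⟶ dᘁ), val (star Y X) x y =
    cupSum c (val Y (res _ c ≫ x) (cov _ c) * val X (vec _ c) (res _ c ≫ y)) := val_star Y X
  have h2 : ∀ (x : K ⊗ CupObj c ⟶ c) (y : K ⊗ CupObj c ⟶ cᘁ), val (star X Y) x y =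
    cupSum d (val X (res _ d ≫ x) (cov _ d) * val Y (vec _ d) (res _ d ≫ y)) := val_star X Y
  simp only [h1, h2]
  simp only [comp_val, h.balanced_left _ _ _]
  simp only [cupSum_mul_oddDual]
  rw [← cupSum_cupSum_swap c d]
  simp only [comp_mul, comp_val, cupSwap_res_vec, cupSwap_res_cov, cupSwap_vec,
    cupSwap_cov, cupSwap_res_res, mul_comm]

end ChordOp

/-- The product depends on `θ, θ'` only through `θ ⊠ θ'`, which is antisymmetric. -/
lemma val_mul_val_anticomm {a b : C} (F : P.pi ⊗ a ⟶ S) (G : P.pi ⊗ b ⟶ S) (θ θ' : K ⟶ P.pi)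
    (x : K ⟶ a) (y : K ⟶ b) : val F θ x * val G θ' y = -(val F θ' x * val G θ y) := by
  have key : ∀ θ θ' : K ⟶ P.pi, val F θ x * val G θ' y =
      ((θ ⊠ θ') ⊠ (x ⊠ y)) ≫ tensorμ _ _ _ _ ≫ (F ⊗ₘ G) ≫ μ[S] := by
    intro θ θ'
    simp [val, point_mul_def]
  rw [key, key, pair_pi_comm, neg_pair, Preadditive.neg_comp]

lemma val_val_mul_anticomm {a a' b b' : C} (f : OddHom P a a) (g : OddHom P b b) (F : a ⊗ a' ⟶ S)
    (G : b ⊗ b' ⟶ S) (θ θ' : K ⟶ P.pi) (x : K ⟶ a) (x' : K ⟶ a') (y : K ⟶ b) (y' : K ⟶ b') :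
    val F (val f θ x) x' * val G (val g θ' y) y' =
      -(val F (val f θ' x) x' * val G (val g θ y) y') := by
  have key : ∀ {a a' : C} (f : OddHom P a a) (F : a ⊗ a' ⟶ S) (θ : K ⟶ P.pi) (x : K ⟶ a)
      (x' : K ⟶ a'), val F (val f θ x) x' = val (oddWhiskerRight P f a' ≫ F) θ (x ⊠ x') := by
    intro a a' f F θ x x'
    simp [val]
  rw [key, key, val_mul_val_anticomm, key, key]

namespace ChordOp

variable {jc : OddHom P c c} {jd : OddHom P d d} {X : c ⊗ dᘁ ⟶ S} {Y : d ⊗ cᘁ ⟶ S}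
    {D : OddHom P S S} (h : ChordOp jc jd X Y D) (h2 : ∀ {X Y : C} (g : X ⟶ Y), g + g = 0 → g = 0)
    (hc : oddComp P jc jc = 𝟙 c) (hd : oddComp P jd jd = 𝟙 d)
include h h2 hc hd

/-- On a product of entries of `N` and `B` the bracket term vanishes, and `ΔN = -N tr(jB)` cancels
against `ΔB = B tr(jN)` because the two traces agree. -/
lemma apply_apply_left_right (θ θ' : K ⟶ P.pi) (p : K ⟶ c) (p' : K ⟶ dᘁ) (q : K ⟶ d)
    (q' : K ⟶ cᘁ) : oddOp D θ (oddOp D θ' (val X p p' * val Y q q')) = 0 := by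
  have hB := coev_comp_eq_zero jd h2 hd h.symm.balanced_star
  have hN := coev_comp_eq_zero jc h2 hc h.balanced_star
  have e1 := fun (p : K ⟶ c) (q' : K ⟶ cᘁ) => h.apply_star hB θ p q'
  have e2 := fun (p : K ⟶ d) (q' : K ⟶ dᘁ) => h.symm.apply_star hN θ p q'
  simp only [neg_oddOp, neg_inj] at e2
  rw [h.apply_left_right, chord, map_sub, apply_mul_eq, apply_mul_eq]
  simp only [h.brk_star_star, e1, e2, h.cupSum_star_comm]
  ring

/-- The terms with two odd endomorphisms on one vector reduce to scalars `ξ(θ, θ')` and cancel; the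
remaining ones pair off under exchange of `θ` and `θ'`. -/
lemma brk_brk_left_right_left (θ θ' : K ⟶ P.pi) (p r : K ⟶ c) (p' r' : K ⟶ dᘁ) (q : K ⟶ d)
    (q' : K ⟶ cᘁ) :
    brk (oddOp D θ) (val X r r') (brk (oddOp D θ') (val X p p') (val Y q q')) +
      brk (oddOp D θ) (val X p p') (brk (oddOp D θ') (val X r r') (val Y q q')) = 0 := by
  simp only [h.brk_left_right, chord, brk_sub_right, h.brk_mul, h.brk_left_star,
    h.brk_left_star_symm, val_val_of_oddComp _ hc, val_val_of_oddComp _ hd, val_scal_left,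
    scal_eq_mul]
  linear_combination
    val (star Y X) q p' *
      val_val_mul_anticomm jc jc (star X Y) (star X (star Y X)) θ θ' r q' p r' +
    val (star Y X) q r' *
      val_val_mul_anticomm jc jc (star X Y) (star X (star Y X)) θ θ' p q' r p' -
    val (star X (star Y X)) p r' *
      val_val_mul_anticomm jc jd (star X Y) (star Y X) θ θ' r q' q p' -
    val (star X (star Y X)) r p' *
      val_val_mul_anticomm jc jd (star X Y) (star Y X) θ θ' p q' q r'

end ChordOp

section

variable {jc : OddHom P c c} {jd : OddHom P d d} {N : c ⊗ cᘁ ⟶ S} {B : d ⊗ dᘁ ⟶ S}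

/-- Descent of a chord: on each side one term becomes `±ξ(θ, θ') N B` and the other carries one odd
endomorphism on each matrix. They match since both `ξ` and such mixed products are antisymmetric. -/
lemma chord_oddDual_left (hB : Balanced jd jd B) (hc : oddComp P jc jc = 𝟙 c)
    (hd : oddComp P jd jd = 𝟙 d) (θ θ' : K ⟶ P.pi) (p : K ⟶ c) (p' : K ⟶ dᘁ) (q : K ⟶ d)
    (q' : K ⟶ cᘁ) :
    chord jc jd N B θ (val jc θ' p) p' q q' =
      chord jc jd N B θ p (val (oddDual P d jd) θ' p') q q' := by
  have e1 := val_val_mul_anticomm jc jd N B θ' θ p q' q p'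
  rw [chord, chord, ← hB, ← hB, val_val_of_oddComp jc hc, val_val_of_oddComp jd hd,
    val_scal_left, val_scal_left, val_xi_comm θ θ', neg_scal, scal_eq_mul, scal_eq_mul]
  linear_combination -e1

lemma chord_oddDual_right (hN : Balanced jc jc N) (hc : oddComp P jc jc = 𝟙 c)
    (hd : oddComp P jd jd = 𝟙 d) (θ θ' : K ⟶ P.pi) (p : K ⟶ c) (p' : K ⟶ dᘁ) (q : K ⟶ d)
    (q' : K ⟶ cᘁ) :
    chord jc jd N B θ p p' (val jd θ' q) q' =
      chord jc jd N B θ p p' q (val (oddDual P c jc) θ' q') := by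
  have e1 := val_val_mul_anticomm jc jd N B θ θ' p q' q p'
  rw [chord, chord, ← hN, ← hN, val_val_of_oddComp jc hc, val_val_of_oddComp jd hd,
    val_scal_left, val_scal_left, val_xi_comm θ θ', neg_scal, scal_eq_mul, scal_eq_mul]
  linear_combination e1

end

end Chord

/-! ### The families `φ⁻` and `φ⁺` as chords. -/

section Family

open scoped ComonObj

variable {C : Type u} [Category.{v} C] [MonoidalCategory C] [SymmetricCategory C]
  [Preadditive C] [MonoidalPreadditive C] [HasBinaryBiproducts C]
  [HasColimits C] [∀ x : C, PreservesColimitsOfSize.{0, 0} (tensorLeft x)]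
  {P : ParityStructure C} {V : Type w} {E : Type w'} [Finite E] {s t : E → V}
  {c : V → C} [∀ i, HasRightDual (c i)] {J : ∀ i, OddHom P (c i) (c i)}

variable (J) in
/-- A family of odd maps given by chords. -/
structure ChordFamily {Y : C} [MonObj Y] [IsCommMonObj Y]
    (φ : ∀ a b : E ⊕ E, OddHom P (hDual s t c a ⊗ hDual s t c b) Y)
    (N : ∀ e, c (s e) ⊗ (c (s e))ᘁ ⟶ Y) (B : ∀ e, c (t e) ⊗ (c (t e))ᘁ ⟶ Y) : Prop where
  balanced_src : ∀ e, Balanced (J (s e)) (J (s e)) (N e)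
  balanced_tgt : ∀ e, Balanced (J (t e)) (J (t e)) (B e)
  inl_inr : ∀ (e : E) (K : C) [ComonObj K] [IsCommComonObj K] (θ : K ⟶ P.pi) (p : K ⟶ c (s e))
    (p' : K ⟶ (c (t e))ᘁ) (q : K ⟶ c (t e)) (q' : K ⟶ (c (s e))ᘁ),
    (θ ⊠ ((p ⊠ p') ⊠ (q ⊠ q'))) ≫ φ (.inl e) (.inr e) =
      chord (J (s e)) (J (t e)) (N e) (B e) θ p p' q q'
  inr_inl : ∀ (e : E) (K : C) [ComonObj K] [IsCommComonObj K] (θ : K ⟶ P.pi) (p : K ⟶ c (s e))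
    (p' : K ⟶ (c (t e))ᘁ) (q : K ⟶ c (t e)) (q' : K ⟶ (c (s e))ᘁ),
    (θ ⊠ ((q ⊠ q') ⊠ (p ⊠ p'))) ≫ φ (.inr e) (.inl e) =
      chord (J (s e)) (J (t e)) (N e) (B e) θ p p' q q'
  eq_zero : ∀ a b, b ≠ bar a → φ a b = 0

lemma bar_bar (a : E ⊕ E) : bar (bar a) = a := by cases a <;> rfl

namespace ChordFamily

variable {Y : C} [MonObj Y] [IsCommMonObj Y]
  {φ : ∀ a b : E ⊕ E, OddHom P (hDual s t c a ⊗ hDual s t c b) Y}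
  {N : ∀ e, c (s e) ⊗ (c (s e))ᘁ ⟶ Y} {B : ∀ e, c (t e) ⊗ (c (t e))ᘁ ⟶ Y}
  (h : ChordFamily J φ N B)
include h

lemma isSymmFamily : IsSymmFamily φ := by
  intro a b K _ _ θ p q p' q'
  by_cases hab : b = bar a
  · subst hab
    cases a with
    | inl e => exact (h.inl_inr e K θ p q p' q').trans (h.inr_inl e K θ p q p' q').symm
    | inr e => exact (h.inr_inl e K θ p' q' p q).trans (h.inl_inr e K θ p' q' p q).symm
  · rw [h.eq_zero a b hab, h.eq_zero b a fun h => hab (by rw [h, bar_bar]), comp_zero, comp_zero]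

lemma firstDescends (hJ : ∀ i, oddComp P (J i) (J i) = 𝟙 (c i)) : FirstDescends φ J := by
  intro a b K _ _ θ θ' p q p' q'
  by_cases hab : b = bar a
  · subst hab
    cases a with
    | inl e =>
      exact (h.inl_inr e K θ _ q p' q').trans ((chord_oddDual_left (h.balanced_tgt e) (hJ _) (hJ _)
        θ θ' p q p' q').trans (h.inl_inr e K θ p _ p' q').symm)
    | inr e =>
      exact (h.inr_inl e K θ p' q' _ q).trans ((chord_oddDual_right (h.balanced_src e) (hJ _) (hJ _)
        θ θ' p' q' p q).trans (h.inr_inl e K θ p' q' p _).symm)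
  · rw [h.eq_zero a b hab, comp_zero, comp_zero]

end ChordFamily

variable {S : FreeCommMon (hTildeDual P s t c J)}

lemma ChordFamily.existsUnique
    {φ : ∀ a b : E ⊕ E, OddHom P (hDual s t c a ⊗ hDual s t c b) S.obj}
    {N : ∀ e, c (s e) ⊗ (c (s e))ᘁ ⟶ S.obj} {B : ∀ e, c (t e) ⊗ (c (t e))ᘁ ⟶ S.obj}
    (h : ChordFamily J φ N B) (hJ : ∀ i, oddComp P (J i) (J i) = 𝟙 (c i)) :
    ∃! D, IsExtension S φ D := by
  obtain ⟨D, hD⟩ := exists_isExtension φ (h.firstDescends hJ) h.isSymmFamily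
  exact ⟨D, hD, fun D' hD' => hD'.unique hD⟩

lemma val_evPair {K : C} [ComonObj K] [IsCommComonObj K] (i j : V) (p : K ⟶ c i)
    (p' : K ⟶ (c j)ᘁ) (q : K ⟶ c j) (q' : K ⟶ (c i)ᘁ) :
    ((p ⊠ p') ⊠ (q ⊠ q')) ≫ evPair c i j ≫ η[S.obj] =
      val ((β_ _ _).hom ≫ ε_ (c i) (c i)ᘁ ≫ η[S.obj]) p q' *
        val ((β_ _ _).hom ≫ ε_ (c j) (c j)ᘁ ≫ η[S.obj]) q p' := by
  have h1 : ∀ s s' : K ⟶ 𝟙_ C, (s ≫ η[S.obj]) * (s' ≫ η[S.obj]) = scal s s' ≫ η[S.obj] :=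
    fun s s' => by rw [← scal_eq_mul, scal_comp]
  simp only [val, ← Category.assoc, pair_braiding]
  rw [h1, scal_comm]
  simp only [evPair, Category.assoc, pair_associator_assoc, pair_whiskerLeft_assoc,
    pair_whiskerRight, pair_braiding_assoc, pair_associator_inv, pair_leftUnitor, pair_scal,
    scal_comp]

lemma balanced_ev (i : V) :
    Balanced (J i) (J i) ((β_ _ _).hom ≫ ε_ (c i) (c i)ᘁ ≫ η[S.obj]) := by
  intro K _ _ θ p q
  have := val_ev_oddDual (J i) θ q p
  simp only [val] at this ⊢
  simp only [← Category.assoc, pair_braiding, this]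

lemma chordFamily_phiMinus : ChordFamily J (phiMinus S)
    (fun e => (β_ _ _).hom ≫ ε_ (c (s e)) (c (s e))ᘁ ≫ η[S.obj])
    (fun e => (β_ _ _).hom ≫ ε_ (c (t e)) (c (t e))ᘁ ≫ η[S.obj]) where
  balanced_src e := balanced_ev _
  balanced_tgt e := balanced_ev _
  inl_inr e K _ _ θ p p' q q' := by
    have : phiMinus S (.inl e) (.inr e) = evChord P c J (s e) (t e) ≫ η[S.obj] := by
      have : phiMinus S (.inl e) (.inr e) =
          pairing (.inl e) (.inr e) • (evChord P c J (s e) (t e) ≫ η[S.obj]) := dif_pos rfl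
      rw [this, pairing, if_pos rfl, one_smul]
    rw [this, evChord]
    simp only [Preadditive.sub_comp, Preadditive.comp_sub, Category.assoc]
    erw [pair_oddWhiskerRight_assoc, pair_oddWhiskerLeft_assoc]
    rw [pair_oddWhiskerRight, pair_oddWhiskerRight, val_evPair, val_evPair]
    rfl
  inr_inl e K _ _ θ p p' q q' := by
    have : phiMinus S (.inr e) (.inl e) = -(evChord P c J (t e) (s e) ≫ η[S.obj]) := by
      have : phiMinus S (.inr e) (.inl e) =
          pairing (.inr e) (.inl e) • (evChord P c J (t e) (s e) ≫ η[S.obj]) := dif_pos rfl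
      rw [this, pairing, if_pos rfl, neg_one_smul]
    rw [this, evChord]
    simp only [Preadditive.sub_comp, Preadditive.comp_sub, Preadditive.comp_neg, Category.assoc]
    erw [pair_oddWhiskerRight_assoc, pair_oddWhiskerLeft_assoc]
    rw [pair_oddWhiskerRight, pair_oddWhiskerRight, val_evPair, val_evPair, neg_sub, chord]
    -- Exchanging the two matrices reverses the chord; the sign is absorbed by `⟨ā, a⟩ = -1`.
    exact congrArg₂ _ (mul_comm _ _) (mul_comm _ _)
  eq_zero a b hab := dif_neg hab

section Quartic

variable {K : C} [ComonObj K] [IsCommComonObj K]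

lemma comp_oddCoev (θ : K ⟶ P.pi) (i : V) :
    θ ≫ oddCoev P c J i =
      cupSum (c i) (val (J i) (res K (c i) ≫ θ) (vec K (c i)) ⊠ cov K (c i)) := by
  have h : ∀ {L : C} [ComonObj L] [IsCommComonObj L] (θ : L ⟶ P.pi) (p : L ⟶ c i)
      (q : L ⟶ (c i)ᘁ), val (J i) θ p ⊠ q = (θ ⊠ (p ⊠ q)) ≫ oddWhiskerRight P (J i) _ :=
    fun θ p q => (pair_oddWhiskerRight _ _ _ _).symm
  rw [h, cupSum_eval, oddCoev, comp_rightUnitor_inv_assoc, pair_whiskerLeft_assoc]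

lemma pair_shuffle {A : C} [MonObj A] [IsCommMonObj A] {p₁ p₂ p₃ p₄ q₁ q₂ q₃ q₄ : C}
    (x₁ : K ⟶ p₁) (x₂ : K ⟶ p₂) (x₃ : K ⟶ p₃) (x₄ : K ⟶ p₄) (y₁ : K ⟶ q₁) (y₂ : K ⟶ q₂)
    (y₃ : K ⟶ q₃) (y₄ : K ⟶ q₄) (f : p₁ ⊗ q₂ ⟶ A) (g : q₃ ⊗ p₂ ⟶ A) (h : p₃ ⊗ q₄ ⟶ A)
    (k : q₁ ⊗ p₄ ⟶ A) :
    (((x₁ ⊠ x₂) ⊠ (x₃ ⊠ x₄)) ⊠ ((y₁ ⊠ y₂) ⊠ (y₃ ⊠ y₄))) ≫ shuffle p₁ p₂ p₃ p₄ q₁ q₂ q₃ q₄ ≫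
        ((f ⊗ₘ g) ⊗ₘ (h ⊗ₘ k)) ≫ (μ[A] ⊗ₘ μ[A]) ≫ μ[A] =
      (val f x₁ y₂ * val g y₃ x₂) * (val h x₃ y₄ * val k y₁ x₄) := by
  simp only [shuffle, Category.assoc, pair_whiskerLeft_assoc, pair_tensorμ_assoc,
    pair_tensorHom_assoc, pair_associator_assoc, pair_braiding_assoc, pair_associator_inv,
    pair_associator,
    pair_tensorμ, pair_whiskerLeft, pair_braiding, pair_tensorHom]
  rfl

lemma cupSum_val_mul_val {A : C} [MonObj A] [IsCommMonObj A] {i j : V} {f : c i ⊗ (c j)ᘁ ⟶ A}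
    {g : c j ⊗ (c i)ᘁ ⟶ A} (hf : Balanced (J i) (J j) f)
    (θ : K ⟶ P.pi) (p : K ⟶ c i) (q' : K ⟶ (c i)ᘁ) :
    cupSum (c j) (val g (val (J j) (res K (c j) ≫ θ) (vec K (c j))) (res K (c j) ≫ q') *
      val f (res K (c j) ≫ p) (cov K (c j))) = val (star f g) (val (J i) θ p) q' := by
  rw [mul_comm, ← cupSum_mul_oddDual, ← hf, ← comp_val, ← val_star]

/-- Each cup is a sum over dual bases, so the `j`-cup forms the product `fg` and the `i`-cup the
product `gf`. The odd endomorphism sits on a summed strand and is moved by balancedness to an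
incoming vector: `J_j` on the `j`-cup becomes `J_i` on `p`, and `J_i` on the `i`-cup becomes `J_j`
on `q`. -/
lemma pair_quarticChord {A : C} [MonObj A] [IsCommMonObj A] {i j : V} {f : c i ⊗ (c j)ᘁ ⟶ A}
    {g : c j ⊗ (c i)ᘁ ⟶ A} (hf : Balanced (J i) (J j) f) (hg : Balanced (J j) (J i) g)
    (θ : K ⟶ P.pi) (p : K ⟶ c i) (p' : K ⟶ (c j)ᘁ) (q : K ⟶ c j) (q' : K ⟶ (c i)ᘁ) :
    (θ ⊠ ((p ⊠ p') ⊠ (q ⊠ q'))) ≫ quarticChord P c J A i j f g =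
      chord (J i) (J j) (star f g) (star g f) θ p p' q q' := by
  rw [quarticChord, pair_whiskerRight_assoc, coevChord, Preadditive.comp_sub,
    comp_leftUnitor_inv_assoc, comp_rightUnitor_inv_assoc, pair_tensorHom, pair_tensorHom,
    sub_pair, Preadditive.sub_comp, chord]
  congr 1
  · rw [← cupSum_vec_cov, ← cupSum_pair_res, ← cupSum_pair_res, ← cupSum_comp,
      ← Category.assoc (res K (c i)) θ, comp_oddCoev, ← cupSum_res_pair, ← cupSum_pair_res,
      ← cupSum_comp]
    simp only [comp_pair, pair_shuffle]
    rw [← comp_val, ← comp_val, ← comp_mul, cupSum_res_mul, cupSum_val_mul_val hf, ← comp_val,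
      ← comp_val, cupSum_mul_res, mul_comm (val f _ _), ← val_star, mul_comm]
  · rw [comp_oddCoev, ← cupSum_pair_res, ← cupSum_pair_res, ← cupSum_comp,
      IsComonHom.hom_counit_assoc, ← cupSum_vec_cov, ← cupSum_res_pair, ← cupSum_pair_res,
      ← cupSum_comp]
    simp only [comp_pair, pair_shuffle]
    rw [← comp_val, ← comp_val, ← comp_mul, cupSum_res_mul, mul_comm (val g (vec _ _) _),
      ← val_star, ← comp_val, cupSum_mul_res, cupSum_val_mul_val hg, mul_comm]

end Quartic

lemma balanced_gen (a : E ⊕ E) :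
    Balanced (J (src s t a)) (J (tgt s t a)) (gen S a) := by
  intro K _ _ θ p q
  have := eq_whisker (pair_toTilde (P := P) (J := J) a θ p q) S.incl
  simpa only [val, gen, Category.assoc] using this

variable (S) in
/-- The generators for an arrow of the quiver. -/
def genInl (e : E) : c (s e) ⊗ (c (t e))ᘁ ⟶ S.obj := gen S (.inl e)

variable (S) in
/-- The generators for the reverse of an arrow of the quiver. -/
def genInr (e : E) : c (t e) ⊗ (c (s e))ᘁ ⟶ S.obj := gen S (.inr e)

lemma balanced_genInl (e : E) : Balanced (J (s e)) (J (t e)) (genInl S e) := balanced_gen (.inl e)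

lemma balanced_genInr (e : E) : Balanced (J (t e)) (J (s e)) (genInr S e) := balanced_gen (.inr e)

lemma chordFamily_phiPlus : ChordFamily J (phiPlus S)
    (fun e => star (genInl S e) (genInr S e)) (fun e => star (genInr S e) (genInl S e)) where
  balanced_src e := (balanced_genInl e).star (balanced_genInr e)
  balanced_tgt e := (balanced_genInr e).star (balanced_genInl e)
  inl_inr e K _ _ θ p p' q q' := by
    have : phiPlus S (.inl e) (.inr e) =
        quarticChord P c J S.obj (s e) (t e) (genInl S e) (genInr S e) := by
      have : phiPlus S (.inl e) (.inr e) = pairing (.inl e) (.inr e) •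
          quarticChord P c J S.obj (s e) (t e) (genInl S e) (genInr S e) := dif_pos rfl
      rw [this, pairing, if_pos rfl, one_smul]
    rw [this]
    exact pair_quarticChord (balanced_genInl e) (balanced_genInr e) θ p p' q q'
  inr_inl e K _ _ θ p p' q q' := by
    have : phiPlus S (.inr e) (.inl e) =
        -quarticChord P c J S.obj (t e) (s e) (genInr S e) (genInl S e) := by
      have : phiPlus S (.inr e) (.inl e) = pairing (.inr e) (.inl e) •
          quarticChord P c J S.obj (t e) (s e) (genInr S e) (genInl S e) := dif_pos rfl
      rw [this, pairing, if_pos rfl, neg_one_smul]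
    rw [this, Preadditive.comp_neg]
    refine (congrArg Neg.neg
      (pair_quarticChord (balanced_genInr e) (balanced_genInl e) θ q q' p p')).trans ?_
    rw [chord, chord]
    ring
  eq_zero a b hab := dif_neg hab

end Family

/-! ### The Jacobiator of two brackets. -/

section Jacobiator

variable {A : Type*} [CommRing A]

/-- The Jacobiator of the brackets of two operators. -/
def jac (Z Z' : A →+ A) (x y z : A) : A :=
  brk Z x (brk Z' y z) + brk Z y (brk Z' x z) + brk Z z (brk Z' x y)

variable {Z Z' : A →+ A}

lemma jac_swap_left (x y z : A) : jac Z Z' x y z = jac Z Z' y x z := by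
  rw [jac, jac, brk_comm x y]; ring

lemma jac_swap_right (x y z : A) : jac Z Z' x y z = jac Z Z' x z y := by
  rw [jac, jac, brk_comm y z]; ring

lemma brk_zero_right (u : A) : brk Z u 0 = 0 := by simp [brk]

lemma brk_neg_right (u v : A) : brk Z u (-v) = -brk Z u v := by simp [brk]; ring

/-- When `Z'` kills the three factors, `Z' (xyz)` is the sum of `x {y, z}'` and its analogues. As
`Z` kills both factors of each summand, only their brackets remain. -/
lemma apply_apply_mul_mul (h' : DiffOpOn Set.univ 3 Z') (h1 : Z' 1 = 0) {x y z : A}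
    (hx : Z x = 0) (hy : Z y = 0) (hz : Z z = 0) (hx' : Z' x = 0) (hy' : Z' y = 0) (hz' : Z' z = 0)
    (hxy : Z (Z' (x * y)) = 0) (hxz : Z (Z' (x * z)) = 0) (hyz : Z (Z' (y * z)) = 0) :
    Z (Z' (x * (y * z))) = jac Z Z' x y z := by
  have e : ∀ {a b : A}, Z' a = 0 → Z' b = 0 → brk Z' a b = Z' (a * b) := fun ha hb => by
    simp [brk, ha, hb]
  have e' : Z' (x * (y * z)) = x * brk Z' y z + (brk Z' x y * z + y * brk Z' x z) := by
    rw [← brk_mul_right h' h1, apply_mul_eq, hx', e hy' hz']; ring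
  have k : ∀ {a b : A}, Z a = 0 → Z b = 0 → Z (a * b) = brk Z a b := fun ha hb => by
    simp [brk, ha, hb]
  rw [e', map_add, map_add, k hx (by rw [e hy' hz', hyz]), k (by rw [e hx' hy', hxy]) hz,
    k hy (by rw [e hx' hz', hxz]), jac, brk_comm (brk Z' x y) z]
  ring

end Jacobiator

/-! ### Vanishing of the square. -/

section SquareZero

open scoped ComonObj

variable {C : Type u} [Category.{v} C] [MonoidalCategory C] [SymmetricCategory C]
  [Preadditive C] [MonoidalPreadditive C] [HasBinaryBiproducts C]
  [HasColimits C] [∀ x : C, PreservesColimitsOfSize.{0, 0} (tensorLeft x)]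
  {P : ParityStructure C} {V : Type w} {E : Type w'} [Finite E] {s t : E → V}
  {c : V → C} [∀ i, HasRightDual (c i)] {J : ∀ i, OddHom P (c i) (c i)}
  {S : FreeCommMon (hTildeDual P s t c J)}
  {φ : ∀ a b : E ⊕ E, OddHom P (hDual s t c a ⊗ hDual s t c b) S.obj} {D : OddHom P S.obj S.obj}

/-- The value of a generator at a vector and a covector. -/
def genVal (S : FreeCommMon (hTildeDual P s t c J)) {K : C} [ComonObj K] (a : E ⊕ E)
    (p : K ⟶ c (src s t a)) (q : K ⟶ (c (tgt s t a))ᘁ) : K ⟶ S.obj := (p ⊠ q) ≫ gen S a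

/-- Since `Δ_θ` and `Δ_θ'` anticommute, twice their composite is their commutator, of order at most
three. It is thus enough to treat products of two generators and the Jacobiator of three. -/
lemma IsExtension.oddComp_eq_zero (h : IsExtension S φ D)
    (h2 : ∀ {X Y : C} (g : X ⟶ Y), g + g = 0 → g = 0)
    (hD2 : ∀ (K : C) [ComonObj K] [IsCommComonObj K] (θ θ' : K ⟶ P.pi) (a b : E ⊕ E) p q p' q',
      oddOp D θ (oddOp D θ' (genVal S a p q * genVal S b p' q')) = 0)
    (hD3 : ∀ (K : C) [ComonObj K] [IsCommComonObj K] (θ θ' : K ⟶ P.pi) (a b e : E ⊕ E) p q p' q'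
      p'' q'', jac (oddOp D θ) (oddOp D θ') (genVal S a p q) (genVal S b p' q')
        (genVal S e p'' q'') = 0) :
    oddComp P D D = 0 := by
  suffices (α_ P.pi P.pi S.obj).hom ≫ P.pi ◁ D ≫ D = 0 by
    rw [oddComp, this, comp_zero, comp_zero]
  refine (((spans_top P.pi).purePts (spans_top P.pi) (stable_top _) (stable_top _)).purePts
    (spans_monomials S spans_pureGen stable_pureGen) ((stable_top _).purePts (stable_top _))
    (stable_monomials S stable_pureGen)).ext ?_
  rintro K _ _ _ ⟨_, _, ⟨θ, θ', -, -, rfl⟩, ⟨l, hl, rfl⟩, rfl⟩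
  rw [pair_associator_assoc, pair_whiskerLeft_assoc, comp_zero]
  change oddOp D θ (oddOp D θ' _) = 0
  have key := DiffOpOn.vanish
    (Z := (oddOp D θ).comp (oddOp D θ') - (oddOp D θ').comp (oddOp D θ))
    (G := {z | ∃ (a : E ⊕ E) (p : K ⟶ c (src s t a)) (q : K ⟶ (c (tgt s t a))ᘁ),
      z = genVal S a p q}) 3 ?_ ?_ (l.map (· ≫ S.incl)) ?_
  · refine h2 _ ?_
    rw [AddMonoidHom.sub_apply, AddMonoidHom.comp_apply, AddMonoidHom.comp_apply,
      oddOp_anticomm D θ' θ, sub_neg_eq_add] at key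
    exact key
  · have := (h.order_two.diffOpOn θ).commutator (m := 2) (n := 2) (h.order_two.diffOpOn θ')
    exact fun f _ g _ k _ m _ => this f trivial g trivial k trivial m trivial
  · intro l hl hk
    suffices ∀ θ θ' : K ⟶ P.pi, oddOp D θ (oddOp D θ' l.prod) = 0 by
      rw [AddMonoidHom.sub_apply, AddMonoidHom.comp_apply, AddMonoidHom.comp_apply, this, this,
        sub_zero]
    intro θ θ'
    match l with
    | [] => rw [List.prod_nil, h.oddOp_one, map_zero]
    | [x] =>
      obtain ⟨a, p, q, rfl⟩ := hl x (by simp)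
      rw [List.prod_singleton, genVal, h.oddOp_gen, map_zero]
    | [x, y] =>
      obtain ⟨a, p, q, rfl⟩ := hl x (by simp)
      obtain ⟨b, p', q', rfl⟩ := hl y (by simp)
      rw [List.prod_cons, List.prod_singleton, hD2]
    | [x, y, z] =>
      obtain ⟨a, p, q, rfl⟩ := hl x (by simp)
      obtain ⟨b, p', q', rfl⟩ := hl y (by simp)
      obtain ⟨e, p'', q'', rfl⟩ := hl z (by simp)
      have g : ∀ (θ : K ⟶ P.pi) (a : E ⊕ E) (p : K ⟶ c (src s t a)) (q : K ⟶ (c (tgt s t a))ᘁ),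
        oddOp D θ (genVal S a p q) = 0 := fun θ a p q => h.oddOp_gen _ _
      rw [List.prod_cons, List.prod_cons, List.prod_singleton,
        apply_apply_mul_mul (h.order_two.diffOpOn θ') (h.oddOp_one θ') (g _ _ _ _)
          (g _ _ _ _) (g _ _ _ _) (g _ _ _ _) (g _ _ _ _) (g _ _ _ _) (hD2 _ _ _ _ _ _ _ _ _) (hD2 _ _ _ _ _ _ _ _ _) (hD2 _ _ _ _ _ _ _ _ _), hD3]
    | _ :: _ :: _ :: _ :: l => simp only [List.length_cons] at hk; omega
  · simp only [List.mem_map]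
    rintro _ ⟨z, hz, rfl⟩
    obtain ⟨a, p, q, rfl⟩ := hl z hz
    exact ⟨a, p, q, by rw [genVal, gen, Category.assoc]⟩

lemma IsExtension.isBVOperator (h : IsExtension S φ D) (hD : oddComp P D D = 0) :
    IsBVOperator P S.obj D := ⟨h.order_two, hD, h.on_zero⟩

variable {K : C} [ComonObj K] [IsCommComonObj K]

namespace IsExtension

variable (h : IsExtension S φ D)
include h

lemma apply_genVal_mul_genVal (θ : K ⟶ P.pi) (a b : E ⊕ E) (p : K ⟶ c (src s t a))
    (q : K ⟶ (c (tgt s t a))ᘁ) (p' : K ⟶ c (src s t b)) (q' : K ⟶ (c (tgt s t b))ᘁ) :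
    oddOp D θ (genVal S a p q * genVal S b p' q') = (θ ⊠ ((p ⊠ q) ⊠ (p' ⊠ q'))) ≫ φ a b :=
  h.oddOp_gen_mul_gen _ _ _

lemma apply_genVal (θ : K ⟶ P.pi) (a : E ⊕ E) (p : K ⟶ c (src s t a))
    (q : K ⟶ (c (tgt s t a))ᘁ) : oddOp D θ (genVal S a p q) = 0 := h.oddOp_gen _ _

lemma brk_genVal_genVal (θ : K ⟶ P.pi) (a b : E ⊕ E) (p : K ⟶ c (src s t a))
    (q : K ⟶ (c (tgt s t a))ᘁ) (p' : K ⟶ c (src s t b)) (q' : K ⟶ (c (tgt s t b))ᘁ) :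
    brk (oddOp D θ) (genVal S a p q) (genVal S b p' q') =
      (θ ⊠ ((p ⊠ q) ⊠ (p' ⊠ q'))) ≫ φ a b := by
  rw [brk, h.apply_genVal_mul_genVal, h.apply_genVal, h.apply_genVal, zero_mul, mul_zero, sub_zero,
    sub_zero]

/-- An operator whose values on products of two generators are scalars has square zero. -/
lemma oddComp_eq_zero_of_scalar (h2 : ∀ {X Y : C} (g : X ⟶ Y), g + g = 0 → g = 0)
    (hφ : ∀ a b, ∃ ψ, φ a b = ψ ≫ η[S.obj]) : oddComp P D D = 0 := by
  -- Operators on points are linear over scalars. As `D` kills `1`, it kills scalars and has zero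
  -- bracket with them.
  have e : ∀ {K : C} [ComonObj K] [IsCommComonObj K] (w : K ⟶ 𝟙_ C) (θ : K ⟶ P.pi) (z : K ⟶ S.obj),
      oddOp D θ ((w ≫ η[S.obj]) * z) = (w ≫ η[S.obj]) * oddOp D θ z := by
    intro K _ _ w θ z
    rw [← scal_eq_mul, ← scal_eq_mul]
    exact val_scal_right D w θ z
  have e1 : ∀ {K : C} [ComonObj K] [IsCommComonObj K] (w : K ⟶ 𝟙_ C) (θ : K ⟶ P.pi),
      oddOp D θ (w ≫ η[S.obj]) = 0 := by
    intro K _ _ w θ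
    rw [← mul_one (w ≫ η[S.obj]), e, h.oddOp_one, mul_zero]
  have e2 : ∀ {K : C} [ComonObj K] [IsCommComonObj K] (w : K ⟶ 𝟙_ C) (θ : K ⟶ P.pi) (z : K ⟶ S.obj),
      brk (oddOp D θ) z (w ≫ η[S.obj]) = 0 := by
    intro K _ _ w θ z
    rw [brk_comm, brk, e, e1]; ring
  choose ψ hψ using hφ
  refine h.oddComp_eq_zero h2 (fun K _ _ θ θ' a b p q p' q' => ?_)
    (fun K _ _ θ θ' a b e p q p' q' p'' q'' => ?_)
  · rw [h.apply_genVal_mul_genVal, hψ, ← Category.assoc, e1]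
  · simp only [jac, h.brk_genVal_genVal, hψ]
    simp only [← Category.assoc, e2, add_zero]

end IsExtension

lemma exists_phiMinus_eq (a b : E ⊕ E) : ∃ ψ, phiMinus S a b = ψ ≫ η[S.obj] := by
  by_cases hab : b = bar a
  · subst hab
    have h : phiMinus S a (bar a) = pairing a (bar a) • minusCore P c J S.obj
        (src_bar s t a).symm (tgt_bar s t a).symm := dif_pos rfl
    cases a with
    | inl e =>
      exact ⟨pairing (.inl e) (.inr e) • evChord P c J (s e) (t e),
        h.trans (Preadditive.zsmul_comp (evChord P c J (s e) (t e)) η[S.obj] _).symm⟩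
    | inr e =>
      exact ⟨pairing (.inr e) (.inl e) • evChord P c J (t e) (s e),
        h.trans (Preadditive.zsmul_comp (evChord P c J (t e) (s e)) η[S.obj] _).symm⟩
  · exact ⟨0, by rw [zero_comp]; exact dif_neg hab⟩

section Plus

variable (h : IsExtension S (phiPlus S) D)
include h

lemma IsExtension.chordOp (e : E) :
    ChordOp (J (s e)) (J (t e)) (genInl S e) (genInr S e) D where
  balanced_left := balanced_genInl e
  balanced_right := balanced_genInr e
  order_two K _ _ θ := h.order_two.diffOpOn θ
  apply_one K _ _ θ := h.oddOp_one θ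
  apply_left K _ _ θ p p' := h.apply_genVal θ (.inl e) p p'
  apply_right K _ _ θ p p' := h.apply_genVal θ (.inr e) p p'
  apply_left_left K _ _ θ p r p' r' :=
    (h.apply_genVal_mul_genVal θ (.inl e) (.inl e) p p' r r').trans
      (by rw [chordFamily_phiPlus.eq_zero _ _ (by simp [bar]), comp_zero])
  apply_right_right K _ _ θ p r p' r' :=
    (h.apply_genVal_mul_genVal θ (.inr e) (.inr e) p p' r r').trans
      (by rw [chordFamily_phiPlus.eq_zero _ _ (by simp [bar]), comp_zero])
  apply_left_right K _ _ θ p p' q q' :=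
    (h.apply_genVal_mul_genVal θ (.inl e) (.inr e) p p' q q').trans
      (chordFamily_phiPlus.inl_inr e K θ p p' q q')

end Plus

/-- The bracket with a function that commutes with two matrices kills chords in them. -/
lemma ChordOp.brk_chord_eq_zero {i j : V} {X : c i ⊗ (c j)ᘁ ⟶ S.obj} {Y : c j ⊗ (c i)ᘁ ⟶ S.obj}
    (h : ChordOp (J i) (J j) X Y D) {a b : C} {F : a ⊗ b ⟶ S.obj}
    (hX : ∀ (K : C) [ComonObj K] [IsCommComonObj K] (θ : K ⟶ P.pi) (x : K ⟶ a) (y : K ⟶ b) p q,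
      brk (oddOp D θ) (val F x y) (val X p q) = 0)
    (hY : ∀ (K : C) [ComonObj K] [IsCommComonObj K] (θ : K ⟶ P.pi) (x : K ⟶ a) (y : K ⟶ b) p q,
      brk (oddOp D θ) (val F x y) (val Y p q) = 0)
    (θ θ' : K ⟶ P.pi) (x : K ⟶ a) (y : K ⟶ b) (p : K ⟶ c i) (p' : K ⟶ (c j)ᘁ) (q : K ⟶ c j)
    (q' : K ⟶ (c i)ᘁ) :
    brk (oddOp D θ) (val F x y) (chord (J i) (J j) (star X Y) (star Y X) θ' p p' q q') = 0 := by
  have hN : ∀ p q, brk (oddOp D θ) (val F x y) (val (star X Y) p q) = 0 := by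
    intro p q
    rw [val_star, ← cupSum_brk_right]
    simp only [h.brk_mul, comp_val, hX, hY, zero_mul, mul_zero, add_zero, cupSum_zero]
  have hB : ∀ p q, brk (oddOp D θ) (val F x y) (val (star Y X) p q) = 0 := by
    intro p q
    rw [val_star, ← cupSum_brk_right]
    simp only [h.brk_mul, comp_val, hX, hY, zero_mul, mul_zero, add_zero, cupSum_zero]
  simp only [chord, brk_sub_right, h.brk_mul, hN, hB, zero_mul, mul_zero, add_zero, sub_zero]

namespace ChordOp

variable {i j : V} {X : c i ⊗ (c j)ᘁ ⟶ S.obj} {Y : c j ⊗ (c i)ᘁ ⟶ S.obj}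
    (h : ChordOp (J i) (J j) X Y D)
include h

lemma jac_left_left_left (θ θ' : K ⟶ P.pi) (p p' q q' r r') :
    jac (oddOp D θ) (oddOp D θ') (val X p p') (val X q q') (val X r r') = 0 := by
  simp only [jac, h.brk_left_left, brk_zero_right, add_zero]

lemma jac_right_right_right (θ θ' : K ⟶ P.pi) (p p' q q' r r') :
    jac (oddOp D θ) (oddOp D θ') (val Y p p') (val Y q q') (val Y r r') = 0 := by
  simpa only [jac, neg_oddOp, brk_neg, brk_neg_right, neg_neg] using
    h.symm.jac_left_left_left θ θ' p p' q q' r r'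

variable (h2 : ∀ {X Y : C} (g : X ⟶ Y), g + g = 0 → g = 0)
    (hJ : ∀ i, oddComp P (J i) (J i) = 𝟙 (c i))
include h2 hJ

lemma jac_left_left_right (θ θ' : K ⟶ P.pi) (p p' q q' r r') :
    jac (oddOp D θ) (oddOp D θ') (val X p p') (val X q q') (val Y r r') = 0 := by
  rw [jac, h.brk_left_left, brk_zero_right, add_zero,
    h.brk_brk_left_right_left h2 (hJ _) (hJ _)]

lemma jac_right_right_left (θ θ' : K ⟶ P.pi) (p p' q q' r r') :
    jac (oddOp D θ) (oddOp D θ') (val Y p p') (val Y q q') (val X r r') = 0 := by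
  have := h.symm.jac_left_left_right h2 hJ θ θ' p p' q q' r r'
  simpa only [jac, neg_oddOp, brk_neg, brk_neg_right, neg_neg] using this

end ChordOp

section Plus

variable (h : IsExtension S (phiPlus S) D) (h2 : ∀ {X Y : C} (g : X ⟶ Y), g + g = 0 → g = 0)
  (hJ : ∀ i, oddComp P (J i) (J i) = 𝟙 (c i))

/-- The arrow of the quiver underlying an arrow of its double. -/
def edge : E ⊕ E → E := Sum.elim id id

lemma edge_bar (a : E ⊕ E) : edge (bar a) = edge a := by cases a <;> rfl

include h

lemma IsExtension.brk_genVal_eq_zero (θ : K ⟶ P.pi) {a b : E ⊕ E} (hab : edge a ≠ edge b)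
    (p q p' q') :
    brk (oddOp D θ) (genVal S a p q) (genVal S b p' q') = 0 := by
  rw [h.brk_genVal_genVal, chordFamily_phiPlus.eq_zero a b, comp_zero]
  rintro rfl
  exact hab (edge_bar a).symm

/-- The inner bracket is zero or a chord in the matrices over the edge of `b`, and a generator over
another edge has zero bracket with every entry of these. -/
lemma IsExtension.brk_brk_genVal_eq_zero (θ θ' : K ⟶ P.pi) {a b e : E ⊕ E} (hab : edge a ≠ edge b)
    (p q p' q' p'' q'') :
    brk (oddOp D θ) (genVal S a p q) (brk (oddOp D θ') (genVal S b p' q') (genVal S e p'' q'')) =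
      0 := by
  by_cases hbe : e = bar b
  · subst hbe
    have key : ∀ (f : E) (_ : edge a ≠ f) (p' p'' q' q''), brk (oddOp D θ) (genVal S a p q)
        (chord (J (s f)) (J (t f)) (star (genInl S f) (genInr S f))
          (star (genInr S f) (genInl S f)) θ' p' p'' q' q'') = 0 := by
      intro f hf p' p'' q' q''
      exact (h.chordOp f).brk_chord_eq_zero (F := gen S a)
        (fun K _ _ θ x y p q => h.brk_genVal_eq_zero θ (b := .inl f) hf x y p q)
        (fun K _ _ θ x y p q => h.brk_genVal_eq_zero θ (b := .inr f) hf x y p q) _ _ _ _ _ _ _ _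
    rw [h.brk_genVal_genVal]
    cases b with
    | inl f =>
      exact (congrArg _ (chordFamily_phiPlus.inl_inr f K θ' p' q' p'' q'')).trans
        (key f hab _ _ _ _)
    | inr f =>
      exact (congrArg _ (chordFamily_phiPlus.inr_inl f K θ' p'' q'' p' q')).trans
        (key f hab _ _ _ _)
  · rw [h.brk_genVal_genVal, chordFamily_phiPlus.eq_zero b e hbe, comp_zero, brk_zero_right]

lemma IsExtension.brk_brk_genVal_eq_zero' (θ θ' : K ⟶ P.pi) {a b e : E ⊕ E}
    (hab : ¬ (edge a = edge b ∧ edge b = edge e)) (p q p' q' p'' q'') :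
    brk (oddOp D θ) (genVal S a p q) (brk (oddOp D θ') (genVal S b p' q') (genVal S e p'' q'')) =
      0 := by
  by_cases hb : edge b = edge e
  · exact h.brk_brk_genVal_eq_zero θ θ' (fun ha => hab ⟨ha, hb⟩) _ _ _ _ _ _
  · rw [h.brk_genVal_eq_zero θ' hb, brk_zero_right]

include h2 hJ

/-- Over a single edge, symmetry of the Jacobiator reduces the eight orientations to the four cases
of `ChordOp`; otherwise each term vanishes separately. -/
lemma IsExtension.jac_genVal_eq_zero (θ θ' : K ⟶ P.pi) (a b e : E ⊕ E) (p q p' q' p'' q'') :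
    jac (oddOp D θ) (oddOp D θ') (genVal S a p q) (genVal S b p' q') (genVal S e p'' q'') = 0 := by
  by_cases hab : edge a = edge b ∧ edge b = edge e
  · obtain ⟨h3, h4⟩ := hab
    match a, b, e, h3, h4 with
    | .inl a, .inl _, .inl _, rfl, rfl =>
      exact (h.chordOp a).jac_left_left_left θ θ' _ _ _ _ _ _
    | .inl a, .inl _, .inr _, rfl, rfl =>
      exact (h.chordOp a).jac_left_left_right h2 hJ θ θ' _ _ _ _ _ _
    | .inl a, .inr _, .inl _, rfl, rfl =>
      rw [jac_swap_right]
      exact (h.chordOp a).jac_left_left_right h2 hJ θ θ' _ _ _ _ _ _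
    | .inr a, .inl _, .inl _, rfl, rfl =>
      rw [jac_swap_left, jac_swap_right]
      exact (h.chordOp a).jac_left_left_right h2 hJ θ θ' _ _ _ _ _ _
    | .inr a, .inr _, .inl _, rfl, rfl =>
      exact (h.chordOp a).jac_right_right_left h2 hJ θ θ' _ _ _ _ _ _
    | .inr a, .inl _, .inr _, rfl, rfl =>
      rw [jac_swap_right]
      exact (h.chordOp a).jac_right_right_left h2 hJ θ θ' _ _ _ _ _ _
    | .inl a, .inr _, .inr _, rfl, rfl =>
      rw [jac_swap_left, jac_swap_right]
      exact (h.chordOp a).jac_right_right_left h2 hJ θ θ' _ _ _ _ _ _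
    | .inr a, .inr _, .inr _, rfl, rfl =>
      exact (h.chordOp a).jac_right_right_right θ θ' _ _ _ _ _ _
  · rw [jac, h.brk_brk_genVal_eq_zero' θ θ' hab, h.brk_brk_genVal_eq_zero' θ θ' fun H => hab ?_,
      h.brk_brk_genVal_eq_zero' θ θ' fun H => hab ?_]
    · simp
    · exact ⟨H.2, by rw [← H.2, H.1]⟩
    · exact ⟨H.1.symm, H.1.trans H.2⟩

lemma IsExtension.apply_apply_genVal_eq_zero (θ θ' : K ⟶ P.pi) (a b : E ⊕ E) (p q p' q') :
    oddOp D θ (oddOp D θ' (genVal S a p q * genVal S b p' q')) = 0 := by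
  by_cases hab : b = bar a
  · subst hab
    cases a with
    | inl e => exact (h.chordOp e).apply_apply_left_right h2 (hJ _) (hJ _) θ θ' p q p' q'
    | inr e =>
      rw [mul_comm]
      exact (h.chordOp e).apply_apply_left_right h2 (hJ _) (hJ _) θ θ' p' q' p q
  · rw [h.apply_genVal_mul_genVal, chordFamily_phiPlus.eq_zero a b hab, comp_zero, map_zero]

lemma IsExtension.oddComp_phiPlus : oddComp P D D = 0 :=
  h.oddComp_eq_zero h2
    (fun _ _ _ θ θ' a b p q p' q' => h.apply_apply_genVal_eq_zero h2 hJ θ θ' a b p q p' q')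
    (fun _ _ _ θ θ' a b e p q p' q' p'' q'' =>
      h.jac_genVal_eq_zero h2 hJ θ θ' a b e p q p' q' p'' q'')

end Plus

end SquareZero

end NecklaceBV

end

open NecklaceBV in
theorem mainTheorem9
    {R : Type*} [CommRing R] (h2 : IsUnit (2 : R))
    {C : Type*} [Category C] [MonoidalCategory C] [SymmetricCategory C]
    [Preadditive C] [Linear R C] [MonoidalPreadditive C] [MonoidalLinear R C]
    [HasColimits C]
    [∀ x : C, PreservesColimits (tensorLeft x)] [∀ x : C, PreservesColimits (tensorRight x)]
    (P : ParityStructure C)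
    {V : Type*} {E : Type*} [Finite V] [Finite E] (s t : E → V)
    (c : V → C) [∀ i, HasRightDual (c i)]
    (J : ∀ i, OddHom P (c i) (c i)) (hJ : ∀ i, oddComp P (J i) (J i) = 𝟙 (c i)) :
    Nonempty (FreeCommMon (hTildeDual P s t c J)) ∧
    ∀ S : FreeCommMon (hTildeDual P s t c J),
      ((∃! Δ, IsExtension S (phiMinus S) Δ) ∧
        ∀ Δ, IsExtension S (phiMinus S) Δ → IsBVOperator P S.obj Δ) ∧
      ((∃! Δ, IsExtension S (phiPlus S) Δ) ∧
        ∀ Δ, IsExtension S (phiPlus S) Δ → IsBVOperator P S.obj Δ) := by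
  have : HasFiniteCoproducts C := ⟨fun _ => inferInstance⟩
  have : HasBinaryBiproducts C := HasBinaryBiproducts.of_hasBinaryCoproducts
  have : ∀ x : C, PreservesColimitsOfSize.{0, 0} (tensorLeft x) := fun x =>
    preservesSmallestColimits_of_preservesColimits _
  -- This absence of `2`-torsion in the groups of morphisms is the only form in which invertibility
  -- of `2` enters.
  have h2' : ∀ {X Y : C} (g : X ⟶ Y), g + g = 0 → g = 0 := fun g hg =>
    h2.smul_eq_zero.1 ((two_smul R g).trans hg)
  refine ⟨⟨symFree _⟩, fun S => ⟨⟨chordFamily_phiMinus.existsUnique hJ, fun Δ h => ?_⟩,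
    chordFamily_phiPlus.existsUnique hJ, fun Δ h => ?_⟩⟩
  · exact h.isBVOperator (h.oddComp_eq_zero_of_scalar h2' exists_phiMinus_eq)
  · exact h.isBVOperator (h.oddComp_phiPlus h2' hJ)
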